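/- Let $\mathrm{Diff}^1_+([0,1])$ be the group of increasing bijections $f$ of $[0,1]$ such that $f$ and $f^{-1}$ are of class $C^1$, and let $\mathrm{Diff}^1_+(\mathbb{R}/\mathbb{Z})$ be the group of orientation-preserving $C^1$ diffeomorphisms of the circle $\mathbb{R}/\mathbb{Z}$. Both carry the $C^1$ topology (uniform convergence of the maps and of their derivatives). For a group $\Gamma$ and $D$ one of these two groups, the space of actions $\mathrm{Hom}(\Gamma,D)$ of $\Gamma$ by elements of $D$ carries the topology of pointwise convergence: $\rho_i\to\rho$ if and only if $\rho_i(g)\to\rho(g)$ in the $C^1$ topology for every $g\in\Gamma$ (when $\Gamma$ is finitely generated, it is equivalent to require this for the elements $g$ of a finite generating set). Then: 1. For every finitely generated nilpotent group $\Gamma$, the space $\mathrm{Hom}(\Gamma,\mathrm{Diff}^1_+([0,1]))$ is path-connected. 2. For every integer $d\ge 0$, the space $\mathrm{Hom}(\mathbb{Z}^d,\mathrm{Diff}^1_+(\mathbb{R}/\mathbb{Z}))$ is path-connected. 3. For every finitely generated nilpotent group $\Gamma$ and every $\rho\in\mathrm{Hom}(\Gamma,\mathrm{Diff}^1_+(\mathbb{R}/\mathbb{Z}))$,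 there is a continuous path in $\mathrm{Hom}(\Gamma,\mathrm{Diff}^1_+(\mathbb{R}/\mathbb{Z}))$ from $\rho$ to an action $\rho_0$ that factors through a homomorphism from $\Gamma$ onto a finite group of rotations $x\mapsto x+a$ of $\mathbb{R}/\mathbb{Z}$. -/

import Mathlib

open Set Topology

/-! ### Orientation-preserving `C¹` diffeomorphisms of the closed interval `[0,1]` -/

/-- A self-map of `[0,1]` seen as a real function (extended by constants outside `[0,1]`; only its
values on `[0,1]` matter below). -/
noncomputable def intervalExt (f : Icc (0 : ℝ) 1 → Icc (0 : ℝ) 1) : ℝ → ℝ :=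
  fun t => (f (projIcc 0 1 zero_le_one t) : ℝ)

/-- A self-map of `[0,1]` of class `C¹` (with one-sided derivatives at the endpoints). -/
def IsC1Interval (f : Icc (0 : ℝ) 1 → Icc (0 : ℝ) 1) : Prop :=
  ContDiffOn ℝ 1 (intervalExt f) (Icc 0 1)

theorem IsC1Interval.id : IsC1Interval (fun x => x) := by
  have : ContDiffOn ℝ 1 (fun t : ℝ => t) (Icc 0 1) := contDiffOn_id
  refine this.congr fun t ht => ?_
  simp [intervalExt, projIcc_of_mem _ ht]

theorem IsC1Interval.comp {f g : Icc (0 : ℝ) 1 → Icc (0 : ℝ) 1}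
    (hf : IsC1Interval f) (hg : IsC1Interval g) : IsC1Interval (fun x => f (g x)) := by
  have h : ContDiffOn ℝ 1 (intervalExt f ∘ intervalExt g) (Icc 0 1) :=
    ContDiffOn.comp hf hg fun t _ => (g _).2
  refine h.congr fun t ht => ?_
  simp [intervalExt]

/-- The group `Diff¹₊([0,1])`: the increasing bijections `f` of `[0,1]` such that `f` and `f⁻¹` are
of class `C¹`; the group law is composition. -/
def IntervalDiff : Subgroup (Icc (0 : ℝ) 1 ≃o Icc (0 : ℝ) 1) where
  carrier := {f | IsC1Interval (fun x => f x) ∧ IsC1Interval (fun x => f.symm x)}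
  one_mem' := ⟨IsC1Interval.id, IsC1Interval.id⟩
  mul_mem' := fun hf hg => ⟨hf.1.comp hg.1, hg.2.comp hf.2⟩
  inv_mem' := fun hf => ⟨hf.2, hf.1⟩

/-- The underlying continuous map of an element of `Diff¹₊([0,1])`. -/
def IntervalDiff.toMap (f : IntervalDiff) : C(Icc (0 : ℝ) 1, Icc (0 : ℝ) 1) :=
  ⟨fun x => f.1 x, f.1.continuous⟩

/-- The derivative `Df : [0,1] → ℝ` of an element of `Diff¹₊([0,1])`. -/
noncomputable def IntervalDiff.deriv (f : IntervalDiff) : C(Icc (0 : ℝ) 1, ℝ) where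
  toFun x := derivWithin (intervalExt fun y => f.1 y) (Icc 0 1) x
  continuous_toFun := continuousOn_iff_continuous_domRestrict.1
    (ContDiffOn.continuousOn_derivWithin f.2.1 (uniqueDiffOn_Icc zero_lt_one) le_rfl)

/-- The `C¹` topology: uniform convergence of the maps and of their derivatives. -/
noncomputable instance IntervalDiff.instTopologicalSpace : TopologicalSpace IntervalDiff :=
  TopologicalSpace.induced (fun f => (IntervalDiff.toMap f, IntervalDiff.deriv f)) inferInstance

/-! ### Orientation-preserving `C¹` diffeomorphisms of the circle `ℝ/ℤ` -/

/-- `F : ℝ → ℝ` is an increasing `C¹` lift of degree one of the self-map `f` of `ℝ/ℤ`. -/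
structure IsC1Lift (F : ℝ → ℝ) (f : UnitAddCircle → UnitAddCircle) : Prop where
  contDiff : ContDiff ℝ 1 F
  strictMono : StrictMono F
  map_add_one : ∀ t, F (t + 1) = F t + 1
  apply_coe : ∀ t : ℝ, f (t : UnitAddCircle) = (F t : UnitAddCircle)

theorem IsC1Lift.id : IsC1Lift (fun t => t) (fun x => x) :=
  ⟨contDiff_id, strictMono_id, fun _ => rfl, fun _ => rfl⟩

theorem IsC1Lift.comp {F G : ℝ → ℝ} {f g : UnitAddCircle → UnitAddCircle}
    (hF : IsC1Lift F f) (hG : IsC1Lift G g) :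
    IsC1Lift (fun t => F (G t)) (fun x => f (g x)) where
  contDiff := hF.contDiff.comp hG.contDiff
  strictMono := hF.strictMono.comp hG.strictMono
  map_add_one t := by rw [hG.map_add_one, hF.map_add_one]
  apply_coe t := by rw [hG.apply_coe, hF.apply_coe]

theorem IsC1Lift.periodic_deriv {F : ℝ → ℝ} {f : UnitAddCircle → UnitAddCircle}
    (hF : IsC1Lift F f) : Function.Periodic (deriv F) 1 := by
  intro t
  have h : (fun s => F (s + 1)) = fun s => F s + 1 := funext hF.map_add_one
  have h2 := deriv_comp_add_const (f := F) (a := 1) (x := t)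
  rw [← h2, h, deriv_add_const]

/-- Two lifts of the same circle map have the same derivative. -/
theorem IsC1Lift.deriv_eq {F G : ℝ → ℝ} {f : UnitAddCircle → UnitAddCircle}
    (hF : IsC1Lift F f) (hG : IsC1Lift G f) : deriv F = deriv G := by
  have hz : ∀ t, ∃ n : ℤ, (n : ℝ) = F t - G t := by
    intro t
    have h : ((F t : ℝ) : UnitAddCircle) = (G t : ℝ) := by
      rw [← hF.apply_coe, ← hG.apply_coe]
    rw [← sub_eq_zero, ← AddCircle.coe_sub, AddCircle.coe_eq_zero_iff] at h
    simpa using h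
  choose n hn using hz
  have hc : Continuous n := by
    rw [Int.isClosedEmbedding_coe_real.isEmbedding.continuous_iff]
    have : (Int.cast ∘ n : ℝ → ℝ) = fun t => F t - G t := funext hn
    rw [this]
    exact hF.contDiff.continuous.sub hG.contDiff.continuous
  have hFG : F = fun t => G t + (n 0 : ℝ) := by
    funext t
    rw [← PreconnectedSpace.constant inferInstance hc (x := t) (y := 0), hn]
    ring
  rw [hFG]
  funext t
  exact deriv_add_const _

/-- The group `Diff¹₊(ℝ/ℤ)`: the homeomorphisms `f` of `ℝ/ℤ` such that `f` and `f⁻¹` are of class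
`C¹` and preserve the orientation, i.e. have increasing `C¹` lifts of degree one to `ℝ`; the group
law is composition. -/
def CircleDiff : Subgroup (UnitAddCircle ≃ₜ UnitAddCircle) where
  carrier := {f | (∃ F, IsC1Lift F fun x => f x) ∧ ∃ G, IsC1Lift G fun x => f.symm x}
  one_mem' := ⟨⟨_, IsC1Lift.id⟩, ⟨_, IsC1Lift.id⟩⟩
  mul_mem' := by
    rintro f g ⟨⟨F, hF⟩, ⟨F', hF'⟩⟩ ⟨⟨G, hG⟩, ⟨G', hG'⟩⟩
    exact ⟨⟨_, hF.comp hG⟩, ⟨_, hG'.comp hF'⟩⟩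
  inv_mem' := fun hf => ⟨hf.2, hf.1⟩

/-- The underlying continuous map of an element of `Diff¹₊(ℝ/ℤ)`. -/
def CircleDiff.toMap (f : CircleDiff) : C(UnitAddCircle, UnitAddCircle) :=
  ⟨fun x => f.1 x, f.1.continuous⟩

/-- The derivative `Df : ℝ/ℤ → ℝ` of an element of `Diff¹₊(ℝ/ℤ)`, computed in any lift. -/
noncomputable def CircleDiff.deriv (f : CircleDiff) : C(UnitAddCircle, ℝ) where
  toFun := f.2.1.choose_spec.periodic_deriv.lift
  continuous_toFun := by
    refine continuous_coinduced_dom.mpr ?_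
    exact f.2.1.choose_spec.contDiff.continuous_deriv le_rfl

theorem CircleDiff.deriv_coe (f : CircleDiff) {F : ℝ → ℝ} (hF : IsC1Lift F fun x => f.1 x) (t : ℝ) :
    CircleDiff.deriv f (t : UnitAddCircle) = _root_.deriv F t :=
  congrFun (f.2.1.choose_spec.deriv_eq hF) t

/-- The `C¹` topology: uniform convergence of the maps and of their derivatives. -/
noncomputable instance CircleDiff.instTopologicalSpace : TopologicalSpace CircleDiff :=
  TopologicalSpace.induced (fun f => (CircleDiff.toMap f, CircleDiff.deriv f)) inferInstance

theorem isC1Lift_rotation (a : UnitAddCircle) : ∃ F, IsC1Lift F fun x => a + x := by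
  obtain ⟨s, rfl⟩ := QuotientAddGroup.mk_surjective a
  exact ⟨fun t => s + t, contDiff_const.add contDiff_id, fun _ _ h => by simpa using h,
    fun t => by ring, fun t => rfl⟩

/-- The rotation `x ↦ a + x` of `ℝ/ℤ`. -/
def circleRotation (a : UnitAddCircle) : CircleDiff :=
  ⟨Homeomorph.addLeft a, isC1Lift_rotation a, isC1Lift_rotation (-a)⟩

/-! ### Spaces of actions -/

/-- The space of actions of `Γ` by elements of `D`, i.e. of homomorphisms from `Γ` to `D`. -/
def ActionSpace (Γ D : Type*) [Group Γ] [Group D] := Γ →* D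

/-- The topology of pointwise convergence on the space of actions: `ρ` is close to `ρ'` when `ρ g` is
close to `ρ' g` for finitely many prescribed `g`. If `D` is a topological group and `Γ` is generated
by a finite set, it is enough to look at the elements `g` of this set. -/
instance ActionSpace.instTopologicalSpace (Γ D : Type*) [Group Γ] [Group D] [TopologicalSpace D] :
    TopologicalSpace (ActionSpace Γ D) :=
  TopologicalSpace.induced (fun (ρ : Γ →* D) (g : Γ) => ρ g) inferInstance

/-- The action `ρ` on the circle factors through a homomorphism from `Γ` onto a finite group of
rotations. -/
def FactorsThroughFiniteRotations {Γ : Type*} [Group Γ] (ρ : ActionSpace Γ CircleDiff) : Prop :=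
  ∃ H : Subgroup CircleDiff, (H : Set CircleDiff).Finite ∧ (∀ r ∈ H, ∃ a, r = circleRotation a) ∧
    ∃ φ : Γ →* H, Function.Surjective φ ∧ ρ = H.subtype.comp φ

open Set Topology
open scoped commutatorElement

/-! ### Affine actions of nilpotent groups by contractions -/

/-! What keeps an action from being by rotations is the cocycle `logD`. Conjugating by a
homeomorphism `h_s` with density proportional to `exp (s θ)` adds `s (θ ∘ ρ g - θ)` to the
logarithmic derivative of `ρ g`, read through `h_s`, and preserves rotation numbers. So it suffices
to find `θ` for which `logD (ρ g) + θ ∘ ρ g - θ` is uniformly small on a finite generating set: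
letting `s` run from `0` to `1` gives a path of actions along which the cocycle interpolates
linearly between the old one and a small one (`exists_path_norm_logD_le`). A small `logD` forces
`C¹` closeness to the rotation with the same rotation number, so infinitely many such paths, with
errors tending to `0`, concatenate into a path ending at an action by rotations
(`exists_joinedIn_rotationAction`).

A continuous `θ` cannot change the exponent at a periodic point, hence `θ` is allowed poles on a
finite invariant set `P`. The density near a pole is `1 / (r (1 - log r)²)`; its primitive `1 / (1 -
log r)` turns the germ `r ↦ λ r` into a parabolic one. The coboundary extends continuously over the
poles, with value `-logD` there (`exists_poleWeight_cocycle`). That a finite `P` contains all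
periodic points of the generators with exponent at least `ε` is the first use of nilpotency:
hyperbolic fixed points have finite orbits (`finite_orbit_of_hyperbolic`).

Once all periodic exponents are small, a closing lemma (`exists_periodic_of_contraction`) shows that
each generator has an iterate whose `logD` is small relative to its length. The second use of
nilpotency is `AffineContractionAction.exists_disp_le`: an affine action of a nilpotent group with
nonexpanding linear parts has a vector moved by each of finitely many elements by hardly more than a
common bound on their drifts. Applied to `logD` in `C(ℝ/ℤ)`, it gives a continuous correction to
`θ`.

Actions by rotations are deformed by lifting the angles of the free part of the image to `ℝ` and
shrinking them. Interval diffeomorphisms are identified with circle diffeomorphisms fixing `0` and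
commuting with `x ↦ -x`; the constructions respect this symmetry, and all rotation numbers are then
`0`. -/

/-- An affine action of `Γ` on `V`, with linear part `π` made of contractions and cocycle `b`. -/
structure AffineContractionAction (Γ V : Type*) [Group Γ] [NormedAddCommGroup V]
    [NormedSpace ℝ V] where
  π : Γ →* Module.End ℝ V
  norm_π_le : ∀ g v, ‖π g v‖ ≤ ‖v‖
  b : Γ → V
  b_mul : ∀ g h, b (g * h) = b g + π g (b h)

namespace AffineContractionAction

variable {Γ V : Type*} [Group Γ] [NormedAddCommGroup V] [NormedSpace ℝ V]
  (A : AffineContractionAction Γ V)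

theorem b_one : A.b 1 = 0 := by
  have h := A.b_mul 1 1
  simpa using h

theorem b_inv (g : Γ) : A.b g⁻¹ = -A.π g⁻¹ (A.b g) := by
  have h := A.b_mul g⁻¹ g
  rw [inv_mul_cancel, b_one] at h
  exact eq_neg_of_add_eq_zero_left h.symm

theorem norm_b_mul_le (g h : Γ) : ‖A.b (g * h)‖ ≤ ‖A.b g‖ + ‖A.b h‖ := by
  rw [A.b_mul]
  exact (norm_add_le _ _).trans (by gcongr; exact A.norm_π_le _ _)

theorem norm_b_inv_le (g : Γ) : ‖A.b g⁻¹‖ ≤ ‖A.b g‖ := by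
  rw [A.b_inv, norm_neg]
  exact A.norm_π_le _ _

theorem norm_b_pow_le (g : Γ) (n : ℕ) : ‖A.b (g ^ n)‖ ≤ n * ‖A.b g‖ := by
  induction n with
  | zero => simp [b_one]
  | succ n ih =>
    rw [pow_succ]
    refine (A.norm_b_mul_le _ _).trans ?_
    push_cast
    linarith

/-- The affine maps of the action. -/
def toEnd : Γ →* Function.End V where
  toFun g := fun v => A.π g v + A.b g
  map_one' := by
    funext v
    change A.π 1 v + A.b 1 = v
    simp [b_one]
  map_mul' g h := by
    funext v
    change A.π (g * h) v + A.b (g * h) = A.π g (A.π h v + A.b h) + A.b g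
    rw [A.b_mul, map_mul, Module.End.mul_apply, map_add]
    abel

theorem toEnd_apply (g : Γ) (v : V) : A.toEnd g v = A.π g v + A.b g := rfl

theorem b_eq_toEnd (g : Γ) : A.b g = A.toEnd g 0 := by simp [toEnd_apply]

theorem π_eq_toEnd (g : Γ) (v : V) : A.π g v = A.toEnd g v - A.toEnd g 0 := by
  simp [toEnd_apply]

/-- The elements of `Γ` which act centrally. -/
def centralizing : Set Γ := {c | ∀ g, Commute (A.toEnd c) (A.toEnd g)}

variable {A}

theorem pow_mem_centralizing {c : Γ} (hc : c ∈ A.centralizing) (n : ℕ) :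
    c ^ n ∈ A.centralizing := fun g => by
  rw [map_pow]
  exact (hc g).pow_left n

theorem commute_π {c : Γ} (hc : c ∈ A.centralizing) (g : Γ) : Commute (A.π c) (A.π g) := by
  ext v
  have h : A.toEnd (c * g) = A.toEnd (g * c) := by rw [map_mul, map_mul, (hc g).eq]
  rw [← map_mul, ← map_mul, π_eq_toEnd, π_eq_toEnd, h]

variable (A)

/-- The displacement of `v` under `g`. -/
def disp (g : Γ) (v : V) : V := A.π g v + A.b g - v

theorem disp_zero (g : Γ) : A.disp g 0 = A.b g := by simp [disp]

/-- The average of the linear parts of the first `n` powers of `c`. -/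
noncomputable def avg (c : Γ) (n : ℕ) : Module.End ℝ V :=
  (n : ℝ)⁻¹ • ∑ i ∈ Finset.range n, A.π (c ^ i)

theorem avg_apply (c : Γ) (n : ℕ) (v : V) :
    A.avg c n v = (n : ℝ)⁻¹ • ∑ i ∈ Finset.range n, A.π (c ^ i) v := by
  simp [avg]

theorem norm_avg_le (c : Γ) (n : ℕ) (v : V) : ‖A.avg c n v‖ ≤ ‖v‖ := by
  rw [avg_apply, norm_smul, norm_inv, Real.norm_natCast]
  have h : ‖∑ i ∈ Finset.range n, A.π (c ^ i) v‖ ≤ n * ‖v‖ := by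
    refine (norm_sum_le _ _).trans ((Finset.sum_le_sum fun i _ => A.norm_π_le _ v).trans ?_)
    simp
  rcases Nat.eq_zero_or_pos n with rfl | hn
  · simp
  have hn' : (0 : ℝ) < n := Nat.cast_pos.2 hn
  rw [inv_mul_le_iff₀ hn']
  exact h

theorem avg_sub (c : Γ) (n : ℕ) (v : V) :
    A.avg c n (A.π c v - v) = (n : ℝ)⁻¹ • (A.π (c ^ n) v - v) := by
  rw [avg_apply]
  congr 1
  have h := Finset.sum_range_sub (fun i => A.π (c ^ i) v) n
  simp only [pow_zero, map_one, Module.End.one_apply] at h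
  rw [← h]
  refine Finset.sum_congr rfl fun i _ => ?_
  rw [map_sub, pow_succ, map_mul, Module.End.mul_apply]

/-- The Birkhoff sum of `b c` along powers of `c` is `b (c ^ n)`, so averaging turns the cocycle
into the drift. -/
theorem avg_b (c : Γ) (n : ℕ) : A.avg c n (A.b c) = (n : ℝ)⁻¹ • A.b (c ^ n) := by
  rw [avg_apply]
  congr 1
  induction n with
  | zero => simp [b_one]
  | succ n ih => rw [Finset.sum_range_succ, ih, pow_succ, A.b_mul]

/-- Since `c` commutes with `g` as an affine map, `π (c ^ i)` carries the displacement of `v` to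
that of `c ^ i v`. Replacing a point by the mean of its orbit therefore averages all displacements
simultaneously. -/
theorem disp_avg {c : Γ} (hc : c ∈ A.centralizing) {n : ℕ} (hn : 0 < n) (g : Γ) (v : V) :
    A.disp g ((n : ℝ)⁻¹ • ∑ i ∈ Finset.range n, A.toEnd (c ^ i) v) = A.avg c n (A.disp g v) := by
  have hn' : (n : ℝ) ≠ 0 := by positivity
  have key : ∀ i, A.π (c ^ i) (A.disp g v)
      = A.π g (A.toEnd (c ^ i) v) + A.b g - A.toEnd (c ^ i) v := by
    intro i
    have h := congrFun (pow_mem_centralizing hc i g).eq v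
    change A.toEnd (c ^ i) (A.toEnd g v) = A.toEnd g (A.toEnd (c ^ i) v) at h
    rw [A.toEnd_apply g (A.toEnd (c ^ i) v)] at h
    rw [← h, disp, map_sub, ← A.toEnd_apply g v]
    simp only [toEnd_apply]
    abel
  rw [avg_apply, Finset.sum_congr rfl fun i _ => key i, Finset.sum_sub_distrib,
    Finset.sum_add_distrib, disp, map_smul, map_sum, smul_sub, smul_add]
  simp [← Nat.cast_smul_eq_nsmul ℝ, smul_smul, hn']

/-- The monoid generated by averages over elements which act centrally. -/
noncomputable def averages : Submonoid (Module.End ℝ V) :=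
  Submonoid.closure {M | ∃ c ∈ A.centralizing, ∃ n : ℕ, 0 < n ∧ M = A.avg c n}

theorem avg_mem {c : Γ} (hc : c ∈ A.centralizing) {n : ℕ} (hn : 0 < n) :
    A.avg c n ∈ A.averages := Submonoid.subset_closure ⟨c, hc, n, hn, rfl⟩

variable {A}

theorem norm_le_of_mem_averages {M : Module.End ℝ V} (hM : M ∈ A.averages) (v : V) :
    ‖M v‖ ≤ ‖v‖ := by
  induction hM using Submonoid.closure_induction generalizing v with
  | mem M h =>
    obtain ⟨c, _, n, _, rfl⟩ := h
    exact A.norm_avg_le c n v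
  | one => simp
  | mul M M' _ _ h h' => exact (h _).trans (h' v)

theorem exists_disp_eq {M : Module.End ℝ V} (hM : M ∈ A.averages) (v : V) :
    ∃ w, ∀ g, A.disp g w = M (A.disp g v) := by
  induction hM using Submonoid.closure_induction generalizing v with
  | mem M h =>
    obtain ⟨c, hc, n, hn, rfl⟩ := h
    exact ⟨_, fun g => A.disp_avg hc hn g v⟩
  | one => exact ⟨v, fun g => by simp⟩
  | mul M M' _ _ h h' =>
    obtain ⟨w, hw⟩ := h' v
    obtain ⟨u, hu⟩ := h w
    exact ⟨u, fun g => by rw [hu, hw, Module.End.mul_apply]⟩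

theorem commute_π_of_mem_averages {M : Module.End ℝ V} (hM : M ∈ A.averages) (g : Γ) :
    Commute M (A.π g) := by
  induction hM using Submonoid.closure_induction with
  | mem M h =>
    obtain ⟨c, hc, n, hn, rfl⟩ := h
    refine Commute.smul_left (Commute.sum_left _ _ _ fun i _ => ?_) _
    exact commute_π (pow_mem_centralizing hc i) g
  | one => exact Commute.one_left _
  | mul M M' _ _ h h' => exact h.mul_left h'

theorem commute_of_mem_averages {M M' : Module.End ℝ V} (hM : M ∈ A.averages)
    (hM' : M' ∈ A.averages) : Commute M M' := by
  induction hM' using Submonoid.closure_induction with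
  | mem M' h =>
    obtain ⟨c, hc, n, hn, rfl⟩ := h
    exact Commute.smul_right (Commute.sum_right _ _ _ fun i _ => commute_π_of_mem_averages hM _) _
  | one => exact Commute.one_right _
  | mul M M' _ _ h h' => exact h.mul_right h'

/-- Averages commute and do not expand, so composing those chosen for the individual elements spoils
none of the bounds. -/
theorem exists_common_average (S : Finset Γ) (u : Γ → V) (δ : ℝ)
    (h : ∀ g ∈ S, ∃ M ∈ A.averages, ‖M (u g)‖ ≤ δ) :
    ∃ M ∈ A.averages, ∀ g ∈ S, ‖M (u g)‖ ≤ δ := by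
  classical
  induction S using Finset.induction_on with
  | empty => exact ⟨1, one_mem _, by simp⟩
  | insert a S _ ih =>
    obtain ⟨M, hM, hMS⟩ := ih fun g hg => h g (Finset.mem_insert_of_mem hg)
    obtain ⟨M', hM', hMa⟩ := h a (Finset.mem_insert_self _ _)
    refine ⟨M * M', mul_mem hM hM', fun g hg => ?_⟩
    rcases Finset.mem_insert.1 hg with rfl | hg
    · exact (norm_le_of_mem_averages hM _).trans hMa
    · rw [(commute_of_mem_averages hM hM').eq]
      exact (norm_le_of_mem_averages hM' _).trans (hMS g hg)

/-! ### Vectors killed by averaging, and the quotient by them -/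

variable (A)

/-- The vectors which are made arbitrarily small by averaging. -/
noncomputable def null : Submodule ℝ V where
  carrier := {v | ∀ η > 0, ∃ M ∈ A.averages, ‖M v‖ ≤ η}
  zero_mem' := fun η hη => ⟨1, one_mem _, by simpa using hη.le⟩
  add_mem' := by
    intro v w hv hw η hη
    obtain ⟨M, hM, hMv⟩ := hv (η / 2) (by positivity)
    obtain ⟨M', hM', hMw⟩ := hw (η / 2) (by positivity)
    refine ⟨M * M', mul_mem hM hM', ?_⟩
    rw [map_add]
    refine (norm_add_le _ _).trans ?_
    have h1 : ‖(M * M') v‖ ≤ η / 2 := by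
      rw [(commute_of_mem_averages hM hM').eq]
      exact (norm_le_of_mem_averages hM' _).trans hMv
    have h2 : ‖(M * M') w‖ ≤ η / 2 := (norm_le_of_mem_averages hM _).trans hMw
    linarith
  smul_mem' := by
    intro a v hv η hη
    obtain ⟨M, hM, hMv⟩ := hv (η / (‖a‖ + 1)) (by positivity)
    refine ⟨M, hM, ?_⟩
    rw [map_smul, norm_smul]
    rw [le_div_iff₀ (by positivity)] at hMv
    nlinarith [norm_nonneg (M v)]

/-- Averages are uniformly nonexpanding. Closedness is what makes the quotient by `null` a normed
space. -/
theorem isClosed_null : IsClosed (A.null : Set V) := by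
  refine isClosed_of_closure_subset fun v hv η hη => ?_
  obtain ⟨w, hw, hvw⟩ := Metric.mem_closure_iff.1 hv (η / 2) (by positivity)
  obtain ⟨M, hM, hMw⟩ := hw (η / 2) (by positivity)
  refine ⟨M, hM, ?_⟩
  have h1 : M v = M (v - w) + M w := by rw [map_sub, sub_add_cancel]
  rw [h1]
  refine (norm_add_le _ _).trans ?_
  have h2 := norm_le_of_mem_averages hM (v - w)
  rw [dist_eq_norm] at hvw
  linarith

theorem π_mem_null (g : Γ) {v : V} (hv : v ∈ A.null) : A.π g v ∈ A.null := by
  intro η hη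
  obtain ⟨M, hM, hMv⟩ := hv η hη
  refine ⟨M, hM, ?_⟩
  have h := LinearMap.congr_fun (commute_π_of_mem_averages hM g).eq v
  simp only [Module.End.mul_apply] at h
  rw [h]
  exact (A.norm_π_le _ _).trans hMv

/-- The average telescopes to `(π (c ^ n) v - v) / n`, of norm at most `2 ‖v‖ / n`. -/
theorem π_sub_mem_null {c : Γ} (hc : c ∈ A.centralizing) (v : V) : A.π c v - v ∈ A.null := by
  intro η hη
  obtain ⟨n, hn⟩ := exists_nat_gt (2 * ‖v‖ / η)
  have hn0 : (0 : ℝ) < n := lt_of_le_of_lt (by positivity) hn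
  refine ⟨_, A.avg_mem hc (Nat.cast_pos.1 hn0), ?_⟩
  rw [avg_sub, norm_smul, norm_inv, Real.norm_natCast, inv_mul_le_iff₀ hn0]
  rw [div_lt_iff₀ hη] at hn
  have := norm_sub_le (A.π (c ^ n) v) v
  have := A.norm_π_le (c ^ n) v
  linarith

/-- The cocycle is null on central commutators, because they are quadratically distorted. -/
theorem b_commutator_mem_null {x y : Γ} (hc : ⁅x, y⁆ ∈ A.centralizing) :
    A.b ⁅x, y⁆ ∈ A.null := by
  set c := ⁅x, y⁆ with hcdef
  have hxy : A.toEnd x * A.toEnd y = A.toEnd c * A.toEnd y * A.toEnd x := by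
    rw [← map_mul, ← map_mul, ← map_mul, hcdef, commutatorElement_def]
    congr 1
    group
  have h1 : ∀ n : ℕ, A.toEnd x * A.toEnd y ^ n = A.toEnd c ^ n * A.toEnd y ^ n * A.toEnd x := by
    intro n
    induction n with
    | zero => simp
    | succ n ih =>
      rw [pow_succ, ← mul_assoc, ih, mul_assoc _ (A.toEnd x), hxy, pow_succ (A.toEnd c)]
      have := ((hc y).pow_right n).eq
      simp only [mul_assoc]
      rw [← mul_assoc (A.toEnd c) (A.toEnd y ^ n), this]
      simp only [mul_assoc]
  -- For `m = n` this makes `c ^ (n * n)` act as the commutator of `x ^ n` and `y ^ n`, whose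
  -- cocycle grows only linearly in `n`; dividing by `n * n` gives `0` in the limit.
  have h2 : ∀ n m : ℕ, A.toEnd x ^ m * A.toEnd y ^ n
      = A.toEnd c ^ (m * n) * A.toEnd y ^ n * A.toEnd x ^ m := by
    intro n m
    induction m with
    | zero => simp
    | succ m ih =>
      rw [pow_succ', mul_assoc, ih, add_mul, one_mul, pow_add]
      have h3 := ((hc x).pow_left (m * n)).eq
      rw [mul_assoc (A.toEnd c ^ (m * n)), ← mul_assoc (A.toEnd x), ← h3, mul_assoc _ (A.toEnd x),
        ← mul_assoc (A.toEnd x), h1]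
      simp only [mul_assoc]
  have h4 : ∀ n : ℕ, A.toEnd (c ^ (n * n)) = A.toEnd (x ^ n * y ^ n * (x ^ n)⁻¹ * (y ^ n)⁻¹) := by
    intro n
    have h5 : A.toEnd (x ^ n * y ^ n) = A.toEnd (c ^ (n * n) * y ^ n * x ^ n) := by
      simp only [map_mul, map_pow]
      exact h2 n n
    have h6 : c ^ (n * n) = (c ^ (n * n) * y ^ n * x ^ n) * ((x ^ n)⁻¹ * (y ^ n)⁻¹) := by group
    rw [h6, map_mul, ← h5, ← map_mul]
    congr 1
    group
  have h7 : ∀ n : ℕ, ‖A.b (c ^ (n * n))‖ ≤ n * (2 * (‖A.b x‖ + ‖A.b y‖)) := by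
    intro n
    rw [b_eq_toEnd, h4, ← b_eq_toEnd]
    have e1 := A.norm_b_mul_le (x ^ n * y ^ n * (x ^ n)⁻¹) (y ^ n)⁻¹
    have e2 := A.norm_b_mul_le (x ^ n * y ^ n) (x ^ n)⁻¹
    have e3 := A.norm_b_mul_le (x ^ n) (y ^ n)
    have e4 := A.norm_b_inv_le (x ^ n)
    have e5 := A.norm_b_inv_le (y ^ n)
    have e6 := A.norm_b_pow_le x n
    have e7 := A.norm_b_pow_le y n
    linarith
  intro η hη
  obtain ⟨n, hn⟩ := exists_nat_gt (2 * (‖A.b x‖ + ‖A.b y‖) / η)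
  have hn0 : (0 : ℝ) < n := lt_of_le_of_lt (by positivity) hn
  have hnn : 0 < n * n := by
    have := Nat.cast_pos.1 hn0
    positivity
  refine ⟨_, A.avg_mem hc hnn, ?_⟩
  rw [avg_b, norm_smul, norm_inv, Real.norm_natCast, inv_mul_le_iff₀ (Nat.cast_pos.2 hnn)]
  rw [div_lt_iff₀ hη] at hn
  push_cast
  have := h7 n
  nlinarith

/-- The induced action on the quotient by the null vectors. -/
noncomputable def quotientNull :
    haveI := A.isClosed_null
    AffineContractionAction Γ (V ⧸ A.null) :=
  haveI := A.isClosed_null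
  { π :=
      { toFun := fun g => A.null.mapQ A.null (A.π g) fun _ hv => A.π_mem_null g hv
        map_one' := by ext; simp
        map_mul' := fun g h => by ext; simp }
    norm_π_le := by
      intro g v
      refine le_of_forall_pos_le_add fun δ hδ => ?_
      obtain ⟨m, rfl, hm⟩ := Submodule.Quotient.norm_mk_lt v hδ
      refine le_trans ?_ hm.le
      exact (Submodule.Quotient.norm_mk_le _ (A.π g m)).trans (A.norm_π_le g m)
    b := fun g => Submodule.Quotient.mk (A.b g)
    b_mul := fun g h => by simp [A.b_mul] }

theorem exists_disp_le_of_commutative (hA : A.centralizing = univ) (S : Finset Γ) {ε : ℝ}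
    (hS : ∀ g ∈ S, ∃ N : ℕ, 0 < N ∧ ‖A.b (g ^ N)‖ ≤ ε * N) :
    ∃ v, ∀ g ∈ S, ‖A.disp g v‖ ≤ ε := by
  obtain ⟨M, hM, h⟩ := A.exists_common_average S A.b ε fun g hg => by
    obtain ⟨N, hN, hb⟩ := hS g hg
    refine ⟨_, A.avg_mem (hA ▸ mem_univ g) hN, ?_⟩
    have hN' : (0 : ℝ) < N := Nat.cast_pos.2 hN
    rw [avg_b, norm_smul, norm_inv, Real.norm_natCast, inv_mul_le_iff₀ hN', mul_comm]
    exact hb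
  obtain ⟨w, hw⟩ := exists_disp_eq hM 0
  exact ⟨w, fun g hg => by rw [hw, disp_zero]; exact h g hg⟩

end AffineContractionAction

-- Induction on the step of nilpotency of the action. The last nontrivial term of the lower central
-- series acts centrally and is generated by central commutators, so modulo `null` both its linear
-- part and its cocycle become trivial. The quotient action thus has one step less, and a solution
-- there lifts up to null vectors, which a further average removes.
open AffineContractionAction in
theorem exists_disp_le_of_lowerCentralSeries {Γ : Type*} [Group Γ] (k : ℕ) :
    ∀ {V : Type*} [NormedAddCommGroup V] [NormedSpace ℝ V] (A : AffineContractionAction Γ V),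
    (∀ c ∈ (⊤ : Subgroup Γ).lowerCentralSeries (k + 1), A.toEnd c = 1) → ∀ (S : Finset Γ) {ε : ℝ},
    (∀ g ∈ S, ∃ N : ℕ, 0 < N ∧ ‖A.b (g ^ N)‖ ≤ ε * N) → ∀ ε' > ε,
    ∃ v, ∀ g ∈ S, ‖A.disp g v‖ ≤ ε' := by
  have comm : ∀ {k : ℕ} {V : Type _} [NormedAddCommGroup V] [NormedSpace ℝ V]
      (A : AffineContractionAction Γ V)
      (_ : ∀ c ∈ (⊤ : Subgroup Γ).lowerCentralSeries (k + 1), A.toEnd c = 1),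
      ∀ c ∈ (⊤ : Subgroup Γ).lowerCentralSeries k, c ∈ A.centralizing := by
    intro k V _ _ A hA c hc g
    have h1 : ⁅c, g⁆ ∈ (⊤ : Subgroup Γ).lowerCentralSeries (k + 1) :=
      Subgroup.commutator_mem_commutator hc (Subgroup.mem_top g)
    have h2 : c * g = ⁅c, g⁆ * (g * c) := by
      rw [commutatorElement_def]
      group
    change A.toEnd c * A.toEnd g = A.toEnd g * A.toEnd c
    rw [← map_mul, ← map_mul, h2, map_mul, hA _ h1, one_mul]
  induction k with
  | zero =>
    intro V _ _ A hA S ε hS ε' hε'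
    obtain ⟨v, hv⟩ := A.exists_disp_le_of_commutative
      (eq_univ_of_forall fun g => comm A hA g (Subgroup.mem_top g)) S hS
    exact ⟨v, fun g hg => (hv g hg).trans hε'.le⟩
  | succ k ih =>
    intro V _ _ A hA S ε hS ε' hε'
    have := A.isClosed_null
    have hC := comm A hA
    have hnull : ∀ c ∈ (⊤ : Subgroup Γ).lowerCentralSeries (k + 1), A.b c ∈ A.null := by
      intro c hc
      have hc' : c ∈ Subgroup.closure {g | ∃ x ∈ (⊤ : Subgroup Γ).lowerCentralSeries k,
          ∃ y ∈ (⊤ : Subgroup Γ), ⁅x, y⁆ = g} := hc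
      have hle : ∀ {c}, c ∈ Subgroup.closure {g | ∃ x ∈ (⊤ : Subgroup Γ).lowerCentralSeries k,
          ∃ y ∈ (⊤ : Subgroup Γ), ⁅x, y⁆ = g} → c ∈ A.centralizing := fun h => hC _ h
      induction hc' using Subgroup.closure_induction with
      | mem g hg =>
        obtain ⟨x, hx, y, hy, rfl⟩ := hg
        exact A.b_commutator_mem_null (hle (Subgroup.subset_closure ⟨x, hx, y, hy, rfl⟩))
      | one => rw [b_one]; exact zero_mem _
      | mul g h hg hh ihg ihh =>
        rw [A.b_mul]
        exact add_mem (ihg hg) (A.π_mem_null _ (ihh hh))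
      | inv g hg ihg =>
        rw [b_inv]
        exact neg_mem (A.π_mem_null _ (ihg hg))
    have htriv : ∀ c ∈ (⊤ : Subgroup Γ).lowerCentralSeries (k + 1),
        A.quotientNull.toEnd c = 1 := by
      intro c hc
      funext v
      obtain ⟨v, rfl⟩ := Submodule.Quotient.mk_surjective _ v
      change (Submodule.Quotient.mk (A.π c v) : V ⧸ A.null) + Submodule.Quotient.mk (A.b c)
        = Submodule.Quotient.mk v
      rw [← Submodule.Quotient.mk_add, Submodule.Quotient.eq, add_sub_right_comm]
      exact add_mem (A.π_sub_mem_null (hC c hc) v) (hnull c hc)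
    obtain ⟨w, hw⟩ := ih A.quotientNull htriv S (ε := ε) (fun g hg => by
      obtain ⟨N, hN, h⟩ := hS g hg
      exact ⟨N, hN, (Submodule.Quotient.norm_mk_le _ _).trans h⟩) ((ε + ε') / 2) (by linarith)
    obtain ⟨v, rfl⟩ := Submodule.Quotient.mk_surjective _ w
    -- Each displacement is a vector `m` of norm below `(ε + ε') / 2 + (ε' - ε) / 4` plus a null
    -- vector, which averaging brings down to `(ε' - ε) / 4`; the total is `ε'`.
    obtain ⟨M, hM, h⟩ := A.exists_common_average S (fun g => A.disp g v) ε' fun g hg => by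
      have h1 : ‖(Submodule.Quotient.mk (A.disp g v) : V ⧸ A.null)‖ ≤ (ε + ε') / 2 := hw g hg
      obtain ⟨m, hm, hm'⟩ := Submodule.Quotient.norm_mk_lt
        (Submodule.Quotient.mk (A.disp g v) : V ⧸ A.null) (ε := (ε' - ε) / 4) (by linarith)
      obtain ⟨M, hM, hMv⟩ := (Submodule.Quotient.eq _).1 hm.symm ((ε' - ε) / 4) (by linarith)
      refine ⟨M, hM, ?_⟩
      have h2 : M (A.disp g v) = M (A.disp g v - m) + M m := by rw [map_sub, sub_add_cancel]
      rw [h2]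
      have h3 := norm_add_le (M (A.disp g v - m)) (M m)
      have h4 := norm_le_of_mem_averages hM m
      linarith
    obtain ⟨u, hu⟩ := exists_disp_eq hM v
    exact ⟨u, fun g hg => by rw [hu]; exact h g hg⟩

/-- An affine action by contractions of a nilpotent group almost reaches, at finitely many elements
at once, the asymptotic drifts of these elements. -/
theorem AffineContractionAction.exists_disp_le {Γ V : Type*} [Group Γ] [Group.IsNilpotent Γ]
    [NormedAddCommGroup V] [NormedSpace ℝ V] (A : AffineContractionAction Γ V) (S : Finset Γ)
    {ε ε' : ℝ} (hS : ∀ g ∈ S, ∃ N : ℕ, 0 < N ∧ ‖A.b (g ^ N)‖ ≤ ε * N) (hε : ε < ε') :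
    ∃ v, ∀ g ∈ S, ‖A.disp g v‖ ≤ ε' := by
  obtain ⟨n, hn⟩ := Subgroup.nilpotent_iff_lowerCentralSeries.1 ‹Group.IsNilpotent Γ›
  refine exists_disp_le_of_lowerCentralSeries n A (fun c hc => ?_) S hS ε' hε
  have h := Subgroup.lowerCentralSeries_antitone (S := (⊤ : Subgroup Γ)) n.le_succ hc
  rw [hn, Subgroup.mem_bot] at h
  rw [h, map_one]

/-! ### Concatenation of infinitely many paths -/

/-- The `n`-th path is run on `[n, n + 1]`. These pieces form a locally finite closed cover; the
piece `n = 0` also takes the negative reals, where `⌊t⌋₊ = 0`. -/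
theorem continuous_floor_extend {X : Type*} [TopologicalSpace X] {x : ℕ → X}
    (γ : ∀ n, Path (x n) (x (n + 1))) :
    Continuous fun t : ℝ => (γ ⌊t⌋₊).extend (t - ⌊t⌋₊) := by
  have hfin : LocallyFinite fun n : ℕ => {t : ℝ | (n : ℝ) ≤ t ∨ n = 0} ∩ Iic ((n : ℝ) + 1) := by
    intro t
    refine ⟨Iio (t + 1), Iio_mem_nhds (by linarith), (finite_le_nat ⌈t + 1⌉₊).subset ?_⟩
    rintro n ⟨s, ⟨hs | hs, _⟩, hs'⟩
    · have h1 : (n : ℝ) ≤ ⌈t + 1⌉₊ := (hs.trans (mem_Iio.1 hs').le).trans (Nat.le_ceil _)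
      exact_mod_cast h1
    · simp [hs]
  refine hfin.continuous ?_ (fun n => ?_) fun n => ?_
  · refine eq_univ_of_forall fun t => mem_iUnion.2 ⟨⌊t⌋₊, ?_, (Nat.lt_floor_add_one t).le⟩
    rcases le_total 0 t with ht | ht
    · exact Or.inl (Nat.floor_le ht)
    · exact Or.inr (Nat.floor_of_nonpos ht)
  · refine IsClosed.inter ?_ isClosed_Iic
    by_cases hn : n = 0
    · simp [hn]
    · simp only [hn, or_false]
      exact isClosed_Ici
  · have hc : Continuous fun t : ℝ => (γ n).extend (t - n) :=
      (γ n).continuous_extend.comp (continuous_id.sub continuous_const)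
    refine hc.continuousOn.congr fun t ht => ?_
    obtain ⟨h1, h2⟩ := ht
    rw [mem_Iic] at h2
    rcases h2.lt_or_eq with h2 | h2
    · have : ⌊t⌋₊ = n := by
        rcases h1 with h1 | h1
        · exact (Nat.floor_eq_iff ((Nat.cast_nonneg n).trans h1)).2 ⟨h1, h2⟩
        · subst h1
          exact Nat.floor_eq_zero.2 (by simpa using h2)
      have key : ∀ m, m = n → (γ m).extend (t - m) = (γ n).extend (t - n) := by
        rintro _ rfl
        rfl
      exact key _ this
    · have h3 : ⌊t⌋₊ = n + 1 := by
        rw [h2]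
        exact_mod_cast Nat.floor_natCast (R := ℝ) (n + 1)
      have h4 : (γ ⌊t⌋₊).extend (t - ⌊t⌋₊) = x (n + 1) := by
        rw [h3, h2]
        simp
      have h5 : (γ n).extend (t - n) = x (n + 1) := by
        rw [h2]
        simp
      simp only [h4, h5]

/-- Infinitely many consecutive paths which shrink to a point can be concatenated. -/
theorem joinedIn_of_forall_path {X : Type*} [TopologicalSpace X] {F : Set X} {x : ℕ → X} {y : X}
    (hy : y ∈ F) (γ : ∀ n, Path (x n) (x (n + 1))) (hF : ∀ n t, γ n t ∈ F)
    (h : ∀ U ∈ 𝓝 y, ∀ᶠ n in Filter.atTop, ∀ t, γ n t ∈ U) : JoinedIn F (x 0) y := by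
  set q : ℝ → X := fun t => (γ ⌊t⌋₊).extend (t - ⌊t⌋₊) with hq
  have hqc : Continuous q := continuous_floor_extend γ
  have hqr : ∀ t, ∃ s, q t = γ ⌊t⌋₊ s := fun t => ⟨projIcc 0 1 zero_le_one _, rfl⟩
  -- `t ↦ t / (1 - t)` stretches `[0, 1)` onto `[0, ∞)`; continuity at `1` is the shrinking
  -- hypothesis.
  set p : ℝ → X := fun t => if t < 1 then q (t / (1 - t)) else y with hp
  have hpc : ContinuousOn p (Icc 0 1) := by
    intro t ht
    rcases ht.2.lt_or_eq with h1 | h1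
    · refine ContinuousAt.continuousWithinAt ?_
      have h2 : p =ᶠ[𝓝 t] fun t => q (t / (1 - t)) := by
        filter_upwards [Iio_mem_nhds h1] with s hs
        simp [hp, mem_Iio.1 hs]
      refine ContinuousAt.congr ?_ h2.symm
      refine hqc.continuousAt.comp ?_
      exact continuousAt_id.div (continuousAt_const.sub continuousAt_id) (by simp; linarith)
    · subst h1
      intro U hU
      have hp1 : p 1 = y := by simp [hp]
      rw [hp1] at hU
      obtain ⟨N, hN⟩ := Filter.eventually_atTop.1 (h U hU)
      have h3 : ∀ᶠ t : ℝ in 𝓝 1, 1 - t < 1 / (N + 2) := by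
        have : (0 : ℝ) < 1 / (N + 2) := by positivity
        filter_upwards [Ioi_mem_nhds (show (1 : ℝ) - 1 / (N + 2) < 1 by linarith)] with t ht
        linarith [mem_Ioi.1 ht]
      refine mem_nhdsWithin_of_mem_nhds ?_
      filter_upwards [h3] with t ht
      by_cases h4 : t < 1
      · obtain ⟨s, hs⟩ := hqr (t / (1 - t))
        simp only [hp, mem_preimage, h4, if_true, hs]
        refine hN _ (Nat.le_floor ?_) s
        have h5 : 0 < 1 - t := by linarith
        rw [lt_div_iff₀ (by positivity)] at ht
        rw [le_div_iff₀ h5]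
        nlinarith
      · simp only [hp, mem_preimage, h4, if_false]
        exact mem_of_mem_nhds hU
  refine JoinedIn.ofLine (f := p) hpc ?_ ?_ ?_
  · simp [hp, hq]
  · simp [hp]
  · rintro _ ⟨t, ht, rfl⟩
    by_cases h4 : t < 1
    · obtain ⟨s, hs⟩ := hqr (t / (1 - t))
      simp only [hp, h4, if_true, hs]
      exact hF _ s
    · simp only [hp, h4, if_false]
      exact hy

/-! ### Lifts of circle maps -/

/-- Two continuous lifts of the same circle map differ by an integer. -/
theorem exists_int_of_coe_eq {F G : ℝ → ℝ} (hF : Continuous F) (hG : Continuous G)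
    (h : ∀ t, (F t : UnitAddCircle) = (G t : UnitAddCircle)) : ∃ n : ℤ, ∀ t, F t = G t + n := by
  have hz : ∀ t, ∃ n : ℤ, (n : ℝ) = F t - G t := by
    intro t
    have h := h t
    rw [← sub_eq_zero, ← AddCircle.coe_sub, AddCircle.coe_eq_zero_iff] at h
    simpa using h
  choose n hn using hz
  have hc : Continuous n := by
    rw [Int.isClosedEmbedding_coe_real.isEmbedding.continuous_iff]
    have : (Int.cast ∘ n : ℝ → ℝ) = fun t => F t - G t := funext hn
    rw [this]
    exact hF.sub hG
  refine ⟨n 0, fun t => ?_⟩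
  rw [← PreconnectedSpace.constant inferInstance hc (x := t) (y := 0), hn]
  ring

theorem coe_add_int (t : ℝ) (n : ℤ) : ((t + n : ℝ) : UnitAddCircle) = (t : UnitAddCircle) := by
  rw [AddCircle.coe_add, add_eq_left, AddCircle.coe_eq_zero_iff]
  exact ⟨n, by simp⟩

theorem isOpenQuotientMap_coe : IsOpenQuotientMap ((↑) : ℝ → UnitAddCircle) :=
  ⟨QuotientAddGroup.mk_surjective, AddCircle.continuous_mk' 1, QuotientAddGroup.isOpenMap_coe⟩

/-- The circle map induced by a map of the line of degree one. -/
def degreeOneMap (F : ℝ → ℝ) (hF : ∀ t, F (t + 1) = F t + 1) : UnitAddCircle → UnitAddCircle :=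
  Function.Periodic.lift (f := fun t => (F t : UnitAddCircle)) (c := (1 : ℝ)) fun t => by
    simp [hF]

theorem map_symm_add_one {F : ℝ ≃o ℝ} (hF : ∀ t, F (t + 1) = F t + 1) (t : ℝ) :
    F.symm (t + 1) = F.symm t + 1 := by
  rw [OrderIso.symm_apply_eq, hF, OrderIso.apply_symm_apply]

/-- The circle homeomorphism induced by an increasing homeomorphism of the line of degree one. -/
def circleHomeo (F : ℝ ≃o ℝ) (hF : ∀ t, F (t + 1) = F t + 1) : UnitAddCircle ≃ₜ UnitAddCircle where
  toFun := degreeOneMap F hF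
  invFun := degreeOneMap F.symm (map_symm_add_one hF)
  left_inv x := by
    obtain ⟨t, rfl⟩ := QuotientAddGroup.mk_surjective x
    change ((F.symm (F t) : ℝ) : UnitAddCircle) = t
    simp
  right_inv x := by
    obtain ⟨t, rfl⟩ := QuotientAddGroup.mk_surjective x
    change ((F (F.symm t) : ℝ) : UnitAddCircle) = t
    simp
  continuous_toFun := continuous_coinduced_dom.mpr ((AddCircle.continuous_mk' 1).comp F.continuous)
  continuous_invFun :=
    continuous_coinduced_dom.mpr ((AddCircle.continuous_mk' 1).comp F.symm.continuous)

@[simp] theorem circleHomeo_coe (F : ℝ ≃o ℝ) (hF : ∀ t, F (t + 1) = F t + 1) (t : ℝ) :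
    circleHomeo F hF (t : UnitAddCircle) = (F t : UnitAddCircle) := rfl

@[simp] theorem circleHomeo_symm_coe (F : ℝ ≃o ℝ) (hF : ∀ t, F (t + 1) = F t + 1) (t : ℝ) :
    (circleHomeo F hF).symm (t : UnitAddCircle) = (F.symm t : UnitAddCircle) := rfl

theorem IsC1Lift.congr {F : ℝ → ℝ} {f g : UnitAddCircle → UnitAddCircle} (hF : IsC1Lift F f)
    (h : ∀ x, f x = g x) : IsC1Lift F g := by
  rwa [show g = f from (funext h).symm]

theorem IsC1Lift.add_int {F : ℝ → ℝ} {f : UnitAddCircle → UnitAddCircle} (hF : IsC1Lift F f)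
    (n : ℤ) : IsC1Lift (fun t => F t + n) f where
  contDiff := hF.contDiff.add contDiff_const
  strictMono := fun _ _ h => by simpa using hF.strictMono h
  map_add_one t := by rw [hF.map_add_one]; ring
  apply_coe t := by rw [hF.apply_coe, coe_add_int]

theorem IsC1Lift.hasDerivAt {F : ℝ → ℝ} {f : UnitAddCircle → UnitAddCircle} (hF : IsC1Lift F f)
    (t : ℝ) : HasDerivAt F (deriv F t) t :=
  ((hF.contDiff.differentiable (by simp)) t).hasDerivAt

theorem IsC1Lift.exists_int {F G : ℝ → ℝ} {f : UnitAddCircle → UnitAddCircle} (hF : IsC1Lift F f)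
    (hG : IsC1Lift G f) : ∃ n : ℤ, ∀ t, F t = G t + n :=
  exists_int_of_coe_eq hF.contDiff.continuous hG.contDiff.continuous fun t => by
    rw [← hF.apply_coe, ← hG.apply_coe]

/-- A lift as a monotone map of degree one. -/
def IsC1Lift.toDeg1 {F : ℝ → ℝ} {f : UnitAddCircle → UnitAddCircle} (hF : IsC1Lift F f) :
    CircleDeg1Lift where
  toFun := F
  monotone' := hF.strictMono.monotone
  map_add_one' := hF.map_add_one

theorem IsC1Lift.translationNumber_eq {F G : ℝ → ℝ} {f : UnitAddCircle → UnitAddCircle}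
    (hF : IsC1Lift F f) (hG : IsC1Lift G f) :
    (hF.toDeg1.translationNumber : UnitAddCircle) = (hG.toDeg1.translationNumber : ℝ) := by
  obtain ⟨n, hn⟩ := hF.exists_int hG
  have h1 : hF.toDeg1 = (CircleDeg1Lift.translate (Multiplicative.ofAdd (n : ℝ))) * hG.toDeg1 := by
    ext t
    change F t = n + G t
    rw [hn, add_comm]
  have h2 : Commute ((CircleDeg1Lift.translate (Multiplicative.ofAdd (n : ℝ))) : CircleDeg1Lift)
      hG.toDeg1 := by
    ext t
    change (n : ℝ) + hG.toDeg1 t = hG.toDeg1 (n + t)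
    rw [CircleDeg1Lift.map_int_add]
  rw [h1, CircleDeg1Lift.translationNumber_mul_of_commute h2,
    CircleDeg1Lift.translationNumber_translate, add_comm, coe_add_int]

/-! ### Logarithmic derivatives, rotation numbers and closeness to rotations -/

namespace CircleDiff

@[simp] theorem coe_mul (f g : CircleDiff) (x : UnitAddCircle) : (f * g).1 x = f.1 (g.1 x) := rfl
@[simp] theorem inv_apply_apply (f : CircleDiff) (x : UnitAddCircle) : f⁻¹.1 (f.1 x) = x :=
  f.1.symm_apply_apply x
@[simp] theorem apply_inv_apply (f : CircleDiff) (x : UnitAddCircle) : f.1 (f⁻¹.1 x) = x :=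
  f.1.apply_symm_apply x

theorem ext' {f g : CircleDiff} (h : ∀ x, f.1 x = g.1 x) : f = g :=
  Subtype.ext (Homeomorph.ext h)

theorem deriv_lift_pos (f : CircleDiff) {F : ℝ → ℝ} (hF : IsC1Lift F fun x => f.1 x) (t : ℝ) :
    0 < _root_.deriv F t := by
  obtain ⟨G, hG⟩ := f.2.2
  have h1 : _root_.deriv (fun t => G (F t)) = _root_.deriv fun t => t :=
    (hG.comp hF).deriv_eq (IsC1Lift.id.congr fun x => (f.1.symm_apply_apply x).symm)
  have h2 := ((hG.hasDerivAt (F t)).comp t (hF.hasDerivAt t)).deriv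
  have h3 : _root_.deriv (G ∘ F) t = 1 := by
    have := congrFun h1 t
    rwa [deriv_id''] at this
  rw [h3] at h2
  refine lt_of_le_of_ne hF.strictMono.monotone.deriv_nonneg fun h => ?_
  rw [← h, mul_zero] at h2
  exact one_ne_zero h2

theorem deriv_pos (f : CircleDiff) (x : UnitAddCircle) : 0 < CircleDiff.deriv f x := by
  obtain ⟨t, rfl⟩ := QuotientAddGroup.mk_surjective x
  obtain ⟨F, hF⟩ := f.2.1
  have := deriv_lift_pos f hF t
  rwa [← CircleDiff.deriv_coe f hF] at this

/-- The logarithm of the derivative. -/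
noncomputable def logD (f : CircleDiff) : C(UnitAddCircle, ℝ) :=
  ⟨fun x => Real.log (CircleDiff.deriv f x),
    (CircleDiff.deriv f).continuous.log fun x => (deriv_pos f x).ne'⟩

theorem exp_logD (f : CircleDiff) (x : UnitAddCircle) :
    Real.exp (logD f x) = CircleDiff.deriv f x := Real.exp_log (deriv_pos f x)

theorem logD_coe (f : CircleDiff) {F : ℝ → ℝ} (hF : IsC1Lift F fun x => f.1 x) (t : ℝ) :
    logD f (t : UnitAddCircle) = Real.log (_root_.deriv F t) := by
  rw [← CircleDiff.deriv_coe f hF]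
  rfl

theorem exp_logD_coe (f : CircleDiff) {F : ℝ → ℝ} (hF : IsC1Lift F fun x => f.1 x) (t : ℝ) :
    Real.exp (logD f (t : UnitAddCircle)) = _root_.deriv F t := by
  rw [exp_logD, CircleDiff.deriv_coe f hF]

/-- The chain rule makes `logD` a cocycle, hence the translation part of an affine action on
continuous functions. -/
theorem logD_mul (f g : CircleDiff) (x : UnitAddCircle) :
    logD (f * g) x = logD f (g.1 x) + logD g x := by
  obtain ⟨t, rfl⟩ := QuotientAddGroup.mk_surjective x
  obtain ⟨F, hF⟩ := f.2.1
  obtain ⟨G, hG⟩ := g.2.1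
  have h1 : g.1 ((t : ℝ) : UnitAddCircle) = (G t : UnitAddCircle) := hG.apply_coe t
  change logD (f * g) ((t : ℝ) : UnitAddCircle) = logD f (g.1 ((t : ℝ) : UnitAddCircle))
    + logD g ((t : ℝ) : UnitAddCircle)
  have h2 : _root_.deriv (fun t => F (G t)) t = _root_.deriv F (G t) * _root_.deriv G t :=
    ((hF.hasDerivAt (G t)).comp t (hG.hasDerivAt t)).deriv
  rw [logD_coe (f * g) (hF.comp hG), h1, logD_coe f hF, logD_coe g hG, h2,
    Real.log_mul (deriv_lift_pos f hF _).ne' (deriv_lift_pos g hG _).ne']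

@[simp] theorem logD_one (x : UnitAddCircle) : logD (1 : CircleDiff) x = 0 := by
  have h := logD_mul 1 1 x
  simpa using h

theorem logD_inv (f : CircleDiff) (x : UnitAddCircle) : logD f⁻¹ x = -logD f (f⁻¹.1 x) := by
  have h := logD_mul f f⁻¹ x
  rw [mul_inv_cancel, logD_one] at h
  linarith

theorem norm_logD_mul_le (f g : CircleDiff) : ‖logD (f * g)‖ ≤ ‖logD f‖ + ‖logD g‖ := by
  refine (ContinuousMap.norm_le _ (by positivity)).2 fun x => ?_
  rw [logD_mul]
  exact (norm_add_le _ _).trans (add_le_add ((logD f).norm_coe_le_norm _) ((logD g).norm_coe_le_norm _))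

theorem norm_logD_inv (f : CircleDiff) : ‖logD f⁻¹‖ = ‖logD f‖ := by
  have h : ∀ f : CircleDiff, ‖logD f⁻¹‖ ≤ ‖logD f‖ := fun f => by
    refine (ContinuousMap.norm_le _ (by positivity)).2 fun x => ?_
    rw [logD_inv, norm_neg]
    exact (logD f).norm_coe_le_norm _
  refine le_antisymm (h f) ?_
  simpa using h f⁻¹

theorem norm_logD_one : ‖logD (1 : CircleDiff)‖ = 0 := by
  rw [norm_eq_zero]
  ext x
  simp

/-- A family of circle diffeomorphisms is continuous when it has lifts which are continuous together
with their derivatives. -/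
theorem continuous_of_lift {X : Type*} [TopologicalSpace X] {f : X → CircleDiff} {F : X → ℝ → ℝ}
    (hF : ∀ s, IsC1Lift (F s) fun x => (f s).1 x) (hc : Continuous fun p : X × ℝ => F p.1 p.2)
    (hd : Continuous fun p : X × ℝ => _root_.deriv (F p.1) p.2) : Continuous f := by
  have hq : IsQuotientMap (Prod.map id ((↑) : ℝ → UnitAddCircle) : X × ℝ → X × UnitAddCircle) :=
    (IsOpenQuotientMap.id.prodMap isOpenQuotientMap_coe).isQuotientMap
  refine continuous_induced_rng.2 (Continuous.prodMk ?_ ?_)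
  · refine ContinuousMap.continuous_of_continuous_uncurry _ (hq.continuous_iff.2 ?_)
    refine ((AddCircle.continuous_mk' 1).comp hc).congr fun p => ?_
    exact ((hF p.1).apply_coe p.2).symm
  · refine ContinuousMap.continuous_of_continuous_uncurry _ (hq.continuous_iff.2 ?_)
    exact hd.congr fun p => (CircleDiff.deriv_coe (f p.1) (hF p.1) p.2).symm

/-- The rotation number. -/
noncomputable def rot (f : CircleDiff) : UnitAddCircle :=
  (f.2.1.choose_spec.toDeg1.translationNumber : ℝ)

theorem rot_eq (f : CircleDiff) {F : ℝ → ℝ} (hF : IsC1Lift F fun x => f.1 x) :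
    rot f = (hF.toDeg1.translationNumber : ℝ) := f.2.1.choose_spec.translationNumber_eq hF

/-- The rotation number is invariant under topological conjugacy. -/
theorem rot_eq_of_conj {f g : CircleDiff} {H : ℝ ≃o ℝ} (hH : ∀ t, H (t + 1) = H t + 1)
    (h : g.1 = circleHomeo H hH * f.1 * (circleHomeo H hH)⁻¹) : rot g = rot f := by
  obtain ⟨F, hF⟩ := f.2.1
  obtain ⟨G, hG⟩ := g.2.1
  have h1 : ∀ t : ℝ, ((G (H t) : ℝ) : UnitAddCircle) = (H (F t) : ℝ) := by
    intro t
    rw [← hG.apply_coe, h]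
    change circleHomeo H hH (f.1 ((circleHomeo H hH).symm (H t : ℝ))) = _
    rw [circleHomeo_symm_coe, OrderIso.symm_apply_apply, hF.apply_coe, circleHomeo_coe]
  obtain ⟨n, hn⟩ := exists_int_of_coe_eq (hG.contDiff.continuous.comp H.continuous)
    (H.continuous.comp hF.contDiff.continuous) h1
  have hF' := hF.add_int n
  rw [rot_eq f hF', rot_eq g hG]
  let H' : CircleDeg1Lift := ⟨⟨H, H.monotone⟩, hH⟩
  have h2 : SemiconjBy H' hF'.toDeg1 hG.toDeg1 := by
    ext t
    change H (F t + n) = G (H t)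
    have h3 : G (H t) = H (F t) + n := hn t
    rw [h3]
    exact H'.map_add_int (F t) n
  rw [CircleDeg1Lift.translationNumber_eq_of_semiconjBy h2]

theorem abs_exp_sub_one_le {x δ : ℝ} (h : |x| ≤ δ) : |Real.exp x - 1| ≤ Real.exp δ - 1 := by
  obtain ⟨h1, h2⟩ := abs_le.1 h
  rw [abs_le]
  have h3 := Real.exp_le_exp.2 h2
  have h4 := Real.exp_le_exp.2 h1
  have h5 : Real.exp δ * Real.exp (-δ) = 1 := by rw [← Real.exp_add]; simp
  refine ⟨?_, by linarith⟩
  nlinarith [sq_nonneg (Real.exp δ - 1), Real.exp_pos (-δ), Real.exp_pos δ,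
    sq_nonneg (Real.exp (-δ) - 1)]

/-- A diffeomorphism with small derivative distortion is close to a rotation. -/
theorem dist_apply_le (f : CircleDiff) {δ : ℝ} (hδ : ‖logD f‖ ≤ δ) (x : UnitAddCircle) :
    dist (f.1 x) (rot f + x) ≤ Real.exp δ - 1 := by
  obtain ⟨F, hF⟩ := f.2.1
  obtain ⟨t, rfl⟩ := QuotientAddGroup.mk_surjective x
  rw [rot_eq f hF]
  set τ := hF.toDeg1.translationNumber
  -- Some point is moved by exactly the translation number. As `F - id` has a small derivative, this
  -- nearly holds over a whole period, hence everywhere.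
  obtain ⟨t₀, ht₀⟩ := hF.toDeg1.exists_eq_add_translationNumber hF.contDiff.continuous
  change F t₀ = t₀ + τ at ht₀
  have h0 : ∀ s, |_root_.deriv F s - 1| ≤ Real.exp δ - 1 := fun s => by
    rw [← exp_logD_coe f hF]
    exact abs_exp_sub_one_le (((logD f).norm_coe_le_norm _).trans hδ)
  have h1 : ∀ s ∈ Icc t₀ (t₀ + 1), |F s - s - τ| ≤ Real.exp δ - 1 := by
    intro s hs
    have h2 := Convex.norm_image_sub_le_of_norm_hasDerivWithin_le (f := fun s => F s - s)
      (f' := fun s => _root_.deriv F s - 1) (s := univ) (C := Real.exp δ - 1) (x := t₀) (y := s)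
      (fun s _ => ((hF.hasDerivAt s).sub (hasDerivAt_id s)).hasDerivWithinAt) (fun s _ => h0 s)
      convex_univ (mem_univ _) (mem_univ _)
    have h3 : F s - s - (F t₀ - t₀) = F s - s - τ := by rw [ht₀]; ring
    rw [h3, Real.norm_eq_abs, Real.norm_eq_abs, abs_of_nonneg (by linarith [hs.1] : 0 ≤ s - t₀)] at h2
    have h4 := (abs_nonneg _).trans (h0 0)
    nlinarith [hs.2]
  set n : ℤ := ⌊t - t₀⌋
  have hs : t - n ∈ Icc t₀ (t₀ + 1) :=
    ⟨by linarith [Int.floor_le (t - t₀)], by linarith [Int.lt_floor_add_one (t - t₀)]⟩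
  have h5 := h1 _ hs
  have h6 : F (t - n) = F t - n := hF.toDeg1.map_sub_int t n
  have h7 : (QuotientAddGroup.mk t : UnitAddCircle) = ((t : ℝ) : UnitAddCircle) := rfl
  rw [h7, show f.1 ((t : ℝ) : UnitAddCircle) = ((F t : ℝ) : UnitAddCircle) from hF.apply_coe t,
    dist_eq_norm, ← AddCircle.coe_add, ← AddCircle.coe_sub]
  refine (QuotientAddGroup.norm_mk_le_norm).trans ?_
  rw [Real.norm_eq_abs]
  refine le_trans (le_of_eq ?_) h5
  rw [h6]
  congr 1
  ring

theorem deriv_circleRotation (a x : UnitAddCircle) : CircleDiff.deriv (circleRotation a) x = 1 := by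
  obtain ⟨s, rfl⟩ := QuotientAddGroup.mk_surjective a
  obtain ⟨t, rfl⟩ := QuotientAddGroup.mk_surjective x
  have hF : IsC1Lift (fun t => s + t) fun x => (circleRotation (s : UnitAddCircle)).1 x :=
    ⟨contDiff_const.add contDiff_id, fun _ _ h => by simpa using h, fun t => by ring, fun t => rfl⟩
  have h := CircleDiff.deriv_coe _ hF t
  refine h.trans ?_
  simp

/-- With the rotation number prescribed, the size of `logD` alone controls both the `C⁰` distance to
the rotation and that of the derivatives. -/
theorem eventually_mem_of_norm_logD_le {a : UnitAddCircle} {U : Set CircleDiff}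
    (hU : U ∈ 𝓝 (circleRotation a)) :
    ∃ δ > 0, ∀ f : CircleDiff, ‖logD f‖ ≤ δ → rot f = a → f ∈ U := by
  rw [nhds_induced, Filter.mem_comap] at hU
  obtain ⟨V, hV, hVU⟩ := hU
  obtain ⟨ε, hε, hεV⟩ := Metric.mem_nhds_iff.1 hV
  have h1 : Filter.Tendsto (fun δ : ℝ => Real.exp δ - 1) (𝓝[>] 0) (𝓝 0) := by
    have : Filter.Tendsto (fun δ : ℝ => Real.exp δ - 1) (𝓝 0) (𝓝 (Real.exp 0 - 1)) :=
      (Real.continuous_exp.sub continuous_const).tendsto 0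
    rw [Real.exp_zero, sub_self] at this
    exact this.mono_left nhdsWithin_le_nhds
  obtain ⟨δ, hδ1, hδ2⟩ :=
    ((h1.eventually (Iio_mem_nhds (half_pos hε))).and self_mem_nhdsWithin).exists
  refine ⟨δ, hδ2, fun f hf hfa => hVU (hεV ?_)⟩
  have h2 : dist (toMap f) (toMap (circleRotation a)) ≤ Real.exp δ - 1 := by
    refine (ContinuousMap.dist_le (by linarith [Real.add_one_le_exp δ, hδ2])).2
      fun x => ?_
    have := dist_apply_le f hf x
    rw [hfa] at this
    exact this
  have h3 : dist (CircleDiff.deriv f) (CircleDiff.deriv (circleRotation a)) ≤ Real.exp δ - 1 := by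
    refine (ContinuousMap.dist_le (by linarith [Real.add_one_le_exp δ, hδ2])).2
      fun x => ?_
    rw [deriv_circleRotation, ← exp_logD, Real.dist_eq]
    exact abs_exp_sub_one_le (((logD f).norm_coe_le_norm x).trans hf)
  rw [Metric.mem_ball, Prod.dist_eq]
  exact (max_le h2 h3).trans_lt ((mem_Iio.1 hδ1).trans (half_lt_self hε))

end CircleDiff

/-! ### A closing lemma for circle diffeomorphisms -/

/-- A sequence of reals with bounded increments which goes far down has many times, far apart from
each other, after which it stays below its current value. -/
theorem exists_record_times {b : ℕ → ℝ} {C : ℝ} (hb0 : b 0 = 0)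
    (hb : ∀ n, |b (n + 1) - b n| ≤ C) {n₀ N J : ℕ}
    (hN : b N < -(J * ((n₀ + 1) * C))) :
    ∃ m : ℕ → ℕ, ∀ j ≤ J, m j ≤ N ∧ (∀ n, m j ≤ n → n ≤ N → b n ≤ b (m j)) ∧
      ∀ i < j, m i + n₀ ≤ m j := by
  classical
  have hC : 0 ≤ C := (abs_nonneg _).trans (hb 0)
  set L := (n₀ + 1) * C with hL
  have hL0 : 0 ≤ L := by positivity
  -- `m j` is the last time up to `N` with `b ≥ -(j * L)`. Between `m i` and `m j` the value drops
  -- by more than `L - C = n₀ * C`, which takes at least `n₀` steps.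
  set m : ℕ → ℕ := fun j => Nat.findGreatest (fun n => -(j * L) ≤ b n) N with hm
  have h1 : ∀ j, -(j * L) ≤ b (m j) := fun j =>
    Nat.findGreatest_spec (P := fun n => -(j * L) ≤ b n) (Nat.zero_le N)
      (by rw [hb0]; have : (0 : ℝ) ≤ j * L := by positivity
          linarith)
  have h2 : ∀ j n, m j < n → n ≤ N → b n < -(j * L) := fun j n h h' =>
    not_le.1 (Nat.findGreatest_is_greatest h h')
  have h3 : ∀ j ≤ J, m j < N := by
    intro j hj
    refine lt_of_le_of_ne (Nat.findGreatest_le N) fun h => ?_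
    have h4 := h1 j
    rw [h] at h4
    have : (j : ℝ) * L ≤ J * L := by gcongr
    linarith
  refine ⟨m, fun j hj => ⟨(h3 j hj).le, fun n hn hnN => ?_, fun i hij => ?_⟩⟩
  · rcases hn.eq_or_lt with rfl | hn
    · exact le_rfl
    · exact (h2 j n hn hnN).le.trans (h1 j)
  · have hji : (i : ℝ) + 1 ≤ j := by exact_mod_cast hij
    have h5 : m i ≤ m j := by
      refine Nat.le_findGreatest (h3 i (hij.le.trans hj)).le ((h1 i).trans' ?_)
      nlinarith
    have h6 : b (m j) < -(j * L) + C := by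
      have := h2 j (m j + 1) (Nat.lt_succ_self _) (h3 j hj)
      have := (abs_le.1 (hb (m j))).1
      linarith
    have h7 : ∀ k, b (m i) - k * C ≤ b (m i + k) := by
      intro k
      induction k with
      | zero => simp
      | succ k ih =>
        have := (abs_le.1 (hb (m i + k))).1
        push_cast
        rw [← add_assoc]
        linarith
    have h8 := h7 (m j - m i)
    rw [Nat.add_sub_cancel' h5, Nat.cast_sub h5] at h8
    have h9 := h1 i
    by_contra h10
    push Not at h10
    have h11 : (m j : ℝ) + 1 ≤ m i + n₀ := by exact_mod_cast h10
    nlinarith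

/-- Pigeonhole in a finite cover by balls. The bound `K` does not depend on the sequence, so it can
be fixed before the orbit is chosen. -/
theorem exists_dist_lt_of_compact {X : Type*} [PseudoMetricSpace X] [CompactSpace X] {δ : ℝ}
    (hδ : 0 < δ) : ∃ K : ℕ, ∀ x : ℕ → X, ∃ i j, i < j ∧ j ≤ K ∧ dist (x i) (x j) < δ := by
  obtain ⟨t, -, ht, hcov⟩ := (isCompact_univ (X := X)).finite_cover_balls (half_pos hδ)
  refine ⟨ht.toFinset.card, fun x => ?_⟩
  have h1 : ∀ i, ∃ c ∈ ht.toFinset, dist (x i) c < δ / 2 := fun i => by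
    simpa using hcov (mem_univ (x i))
  choose c hc hd using h1
  obtain ⟨i, hi, j, hj, hij, h⟩ := Finset.exists_ne_map_eq_of_card_lt_of_maps_to
    (s := Finset.range (ht.toFinset.card + 1)) (t := ht.toFinset) (by simp) (fun i _ => hc i)
  have key : ∀ i j, c i = c j → dist (x i) (x j) < δ := fun i j h => by
    have h1 := dist_triangle_right (x i) (x j) (c i)
    have h2 := hd i
    have h3 := hd j
    rw [← h] at h3
    linarith
  rw [Finset.mem_range] at hi hj
  rcases lt_or_gt_of_ne hij with h' | h'
  · exact ⟨i, j, h', by omega, key i j h⟩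
  · exact ⟨j, i, h', by omega, key j i h.symm⟩

theorem exists_abs_sub_int_eq_dist (s t : ℝ) :
    ∃ k : ℤ, |s - t - k| = dist (s : UnitAddCircle) (t : UnitAddCircle) := by
  refine ⟨round (s - t), ?_⟩
  rw [dist_eq_norm, ← AddCircle.coe_sub, UnitAddCircle.norm_eq]

namespace CircleDiff

theorem isC1Lift_iterate {f : CircleDiff} {F : ℝ → ℝ} (hF : IsC1Lift F fun x => f.1 x) (n : ℕ) :
    IsC1Lift F^[n] fun x => (f ^ n).1 x := by
  induction n with
  | zero => exact IsC1Lift.id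
  | succ n ih =>
    rw [Function.iterate_succ']
    exact (hF.comp ih).congr fun x => by rw [pow_succ', coe_mul]

theorem logD_pow_succ (f : CircleDiff) (n : ℕ) (x : UnitAddCircle) :
    logD (f ^ (n + 1)) x = logD f ((f ^ n).1 x) + logD (f ^ n) x := by
  rw [pow_succ', logD_mul]

/-- Contraction at a uniform exponential rate along long orbits creates a hyperbolic periodic
point. -/
theorem exists_periodic_of_contraction (f : CircleDiff) {ε : ℝ} (hε : 0 < ε)
    (h : ∀ N₀ : ℕ, ∃ N ≥ N₀, ∃ x, logD (f ^ N) x ≤ -(2 * ε * N)) :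
    ∃ q : ℕ, 0 < q ∧ ∃ p, (f ^ q).1 p = p ∧ logD (f ^ q) p ≤ -(ε * q) := by
  obtain ⟨F, hF⟩ := f.2.1
  have huc : UniformContinuous (logD f) := CompactSpace.uniformContinuous_of_continuous
    (logD f).continuous
  obtain ⟨δ, hδ, hδε⟩ := Metric.uniformContinuous_iff.1 huc (ε / 2) (by positivity)
  obtain ⟨K, hK⟩ := exists_dist_lt_of_compact (X := UnitAddCircle) (δ := δ / 4) (by positivity)
  obtain ⟨n₀, hn₀⟩ : ∃ n₀ : ℕ, 1 / ε < n₀ := exists_nat_gt _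
  have hn₀' : 1 < ε * n₀ := by
    rw [div_lt_iff₀ hε] at hn₀
    linarith
  -- The rate `3 / 2 * ε` leaves a margin on both sides: `b N ≤ -(ε / 2) * N` still tends to `-∞`,
  -- and after losing `ε / 2` per step to the modulus of continuity, rate `ε` remains.
  set C := ‖logD f‖ + 3 / 2 * ε with hC
  obtain ⟨N₀, hN₀⟩ := exists_nat_gt (2 * (K * ((n₀ + 1) * C)) / ε)
  obtain ⟨N, hN, x, hx⟩ := h N₀
  set b : ℕ → ℝ := fun n => logD (f ^ n) x + 3 / 2 * ε * n with hb
  have hb0 : b 0 = 0 := by simp [hb]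
  have hb1 : ∀ n, |b (n + 1) - b n| ≤ C := by
    intro n
    have h1 : b (n + 1) - b n = logD f ((f ^ n).1 x) + 3 / 2 * ε := by
      simp only [hb, logD_pow_succ]
      push_cast
      ring
    rw [h1]
    refine (abs_add_le _ _).trans (add_le_add ((logD f).norm_coe_le_norm _) ?_)
    rw [abs_of_pos (by positivity)]
  have hbN : b N < -(K * ((n₀ + 1) * C)) := by
    have h1 : (N₀ : ℝ) ≤ N := by exact_mod_cast hN
    rw [div_lt_iff₀ hε] at hN₀
    simp only [hb]
    nlinarith
  obtain ⟨m, hm⟩ := exists_record_times hb0 hb1 hbN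
  -- Two record times at which the orbit is `δ / 4`-close to itself: a near return from a point all
  -- of whose later iterates, up to time `N`, contract.
  obtain ⟨i, j, hij, hjK, hd⟩ := hK fun j => (f ^ m j).1 x
  obtain ⟨X, rfl⟩ := QuotientAddGroup.mk_surjective x
  obtain ⟨hmi, hrec, -⟩ := hm i (hij.le.trans hjK)
  obtain ⟨hmj, -, hgap⟩ := hm j hjK
  have hmij := hgap i hij
  set q := m j - m i with hq
  have hqm : m j = q + m i := by omega
  have hqn : n₀ ≤ q := by omega
  set Y := F^[m i] X with hY
  have hfm : ∀ n, (f ^ n).1 ((X : ℝ) : UnitAddCircle) = ((F^[n] X : ℝ) : UnitAddCircle) :=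
    fun n => (isC1Lift_iterate hF n).apply_coe X
  have hcon : ∀ k, m i + k ≤ N → logD (f ^ k) (Y : UnitAddCircle) ≤ -(3 / 2 * ε * k) := by
    intro k hk
    have h1 := hrec (m i + k) (by omega) hk
    simp only [hb] at h1
    rw [add_comm (m i) k, pow_add, logD_mul] at h1
    have h2 : (f ^ m i).1 ((X : ℝ) : UnitAddCircle) = (Y : UnitAddCircle) := hfm _
    change logD (f ^ k) ((f ^ m i).1 ((X : ℝ) : UnitAddCircle)) + _ + _ ≤ _ at h1
    rw [h2] at h1
    push_cast at h1
    linarith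
  set B := Icc (Y - δ / 2) (Y + δ / 2) with hB
  have hYB : Y ∈ B := ⟨by linarith, by linarith⟩
  -- The two bounds support each other: contraction keeps the images of `B` within `δ`, so each step
  -- costs at most `ε / 2` in `logD`, and this in turn yields contraction at rate `ε`.
  have key : ∀ k, m i + k ≤ N → ∀ Z ∈ B,
      |F^[k] Z - F^[k] Y| ≤ Real.exp (-(ε * k)) * (δ / 2) ∧
      logD (f ^ k) (Z : UnitAddCircle) ≤ logD (f ^ k) (Y : UnitAddCircle) + k * (ε / 2) := by
    intro k
    induction k with
    | zero =>
      intro _ Z hZ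
      refine ⟨?_, by simp⟩
      have h1 : |Z - Y| ≤ δ / 2 := abs_le.2 ⟨by linarith [hZ.1], by linarith [hZ.2]⟩
      simpa using h1
    | succ k ih =>
      intro hk
      have h1 : ∀ Z ∈ B, logD (f ^ (k + 1)) (Z : UnitAddCircle)
          ≤ logD (f ^ (k + 1)) (Y : UnitAddCircle) + (k + 1 : ℕ) * (ε / 2) := by
        intro Z hZ
        obtain ⟨h2, h3⟩ := ih (by omega) Z hZ
        have h4 : ∀ W : ℝ, (f ^ k).1 (W : UnitAddCircle) = ((F^[k] W : ℝ) : UnitAddCircle) :=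
          (isC1Lift_iterate hF k).apply_coe
        have h5 : dist ((F^[k] Z : ℝ) : UnitAddCircle) ((F^[k] Y : ℝ) : UnitAddCircle) < δ := by
          rw [dist_eq_norm, ← AddCircle.coe_sub]
          refine lt_of_le_of_lt QuotientAddGroup.norm_mk_le_norm ?_
          rw [Real.norm_eq_abs]
          have h6 : Real.exp (-(ε * k)) ≤ 1 := Real.exp_le_one_iff.2 (by
            have : 0 ≤ ε * k := by positivity
            linarith)
          nlinarith
        have h7 := hδε h5
        rw [Real.dist_eq] at h7
        have h8 := (abs_lt.1 h7).2
        rw [logD_pow_succ, logD_pow_succ, h4, h4]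
        push_cast
        linarith
      intro Z hZ
      refine ⟨?_, h1 Z hZ⟩
      have hG := isC1Lift_iterate hF (k + 1)
      have h9 := Convex.norm_image_sub_le_of_norm_hasDerivWithin_le (f := F^[k + 1])
        (f' := fun s => _root_.deriv F^[k + 1] s) (s := B) (C := Real.exp (-(ε * (k + 1 : ℕ))))
        (x := Y) (y := Z) (fun s _ => (hG.hasDerivAt s).hasDerivWithinAt) (fun s hs => by
          rw [← exp_logD_coe (f ^ (k + 1)) hG, Real.norm_eq_abs, Real.abs_exp, Real.exp_le_exp]
          have h10 := hcon (k + 1) hk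
          have h11 := h1 s hs
          push_cast at *
          linarith) (convex_Icc _ _) hYB hZ
      rw [Real.norm_eq_abs, Real.norm_eq_abs] at h9
      have h1 : |Z - Y| ≤ δ / 2 := abs_le.2 ⟨by linarith [hZ.1], by linarith [hZ.2]⟩
      refine h9.trans ?_
      gcongr
  have hqN : m i + q ≤ N := by omega
  have hFq : F^[q] Y = F^[m j] X := by rw [hqm, Function.iterate_add_apply]
  obtain ⟨k, hk⟩ := exists_abs_sub_int_eq_dist (F^[m j] X) Y
  have hk' : |F^[q] Y - Y - k| < δ / 4 := by
    rw [hFq, hk, dist_comm]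
    have h1 : dist ((f ^ m i).1 ((X : ℝ) : UnitAddCircle)) ((f ^ m j).1 ((X : ℝ) : UnitAddCircle))
      < δ / 4 := hd
    rw [hfm, hfm] at h1
    exact h1
  have hhalf : Real.exp (-(ε * q)) ≤ 1 / 2 := by
    have h1 : (n₀ : ℝ) ≤ q := by exact_mod_cast hqn
    have h2 := Real.add_one_le_exp (ε * q)
    rw [Real.exp_neg, ← one_div]
    exact one_div_le_one_div_of_le (by norm_num) (by nlinarith)
  -- `B` has radius `δ / 2`; it is contracted by at least one half, and its centre returns within `δ
  -- / 4`.
  have hmaps : MapsTo (fun Z => F^[q] Z - k) B B := by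
    intro Z hZ
    have h1 := (key q hqN Z hZ).1
    have h2 : |F^[q] Z - F^[q] Y| ≤ δ / 4 := by nlinarith
    obtain ⟨h3, h4⟩ := abs_le.1 h2
    obtain ⟨h5, h6⟩ := abs_lt.1 hk'
    exact ⟨by linarith, by linarith⟩
  have hFqL := isC1Lift_iterate hF q
  obtain ⟨Z, hZ, hfix⟩ := exists_mem_Icc_isFixedPt_of_mapsTo
    (hFqL.contDiff.continuous.sub continuous_const).continuousOn
    (by linarith : Y - δ / 2 ≤ Y + δ / 2) hmaps
  have hq0 : 0 < q := by
    rcases Nat.eq_zero_or_pos q with h1 | h1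
    · have : n₀ = 0 := by omega
      rw [this] at hn₀'
      norm_num at hn₀'
    · exact h1
  refine ⟨q, hq0, (Z : UnitAddCircle), ?_, ?_⟩
  · have h1 : F^[q] Z - k = Z := hfix
    rw [hFqL.apply_coe, show F^[q] Z = Z + k by linarith, coe_add_int]
  · have h1 := (key q hqN Z hZ).2
    have h2 := hcon q hqN
    linarith

/-- If all periodic points have small exponents, the derivatives of some iterate grow slowly. -/
theorem exists_norm_logD_pow_le (f : CircleDiff) {ε : ℝ} (hε : 0 < ε)
    (h : ∀ q : ℕ, 0 < q → ∀ p, (f ^ q).1 p = p → |logD (f ^ q) p| < ε * q) :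
    ∃ N : ℕ, 0 < N ∧ ‖logD (f ^ N)‖ ≤ 2 * ε * N := by
  have h1 : ∃ N₁ : ℕ, ∀ N ≥ N₁, ∀ x, -(2 * ε * N) < logD (f ^ N) x := by
    by_contra hcon
    push Not at hcon
    obtain ⟨q, hq, p, hp, hlog⟩ := exists_periodic_of_contraction f hε hcon
    have := (abs_lt.1 (h q hq p hp)).1
    linarith
  -- Expansion of `f` is contraction of `f⁻¹`, and the two have the same periodic points, with
  -- opposite exponents.
  have h2 : ∃ N₁ : ℕ, ∀ N ≥ N₁, ∀ x, -(2 * ε * N) < logD (f⁻¹ ^ N) x := by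
    by_contra hcon
    push Not at hcon
    obtain ⟨q, hq, p, hp, hlog⟩ := exists_periodic_of_contraction f⁻¹ hε hcon
    rw [inv_pow] at hp hlog
    have hp' : (f ^ q).1 p = p := by
      conv_lhs => rw [← hp]
      simp
    rw [logD_inv, hp] at hlog
    have := (abs_lt.1 (h q hq p hp')).2
    linarith
  obtain ⟨N₁, h1⟩ := h1
  obtain ⟨N₂, h2⟩ := h2
  set N := max (max N₁ N₂) 1
  refine ⟨N, by omega, (ContinuousMap.norm_le _ (by positivity)).2 fun x => abs_le.2 ⟨?_, ?_⟩⟩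
  · exact (h1 N (by omega) x).le
  · have h3 := h2 N (by omega) ((f ^ N).1 x)
    rw [inv_pow, logD_inv, inv_apply_apply] at h3
    linarith

/-- All periodic points of a circle diffeomorphism are fixed by the same power. -/
theorem pow_apply_eq_of_periodic (f : CircleDiff) {a b : ℕ} (hb : 0 < b)
    {x y : UnitAddCircle} (hx : (f ^ a).1 x = x) (hy : (f ^ b).1 y = y) : (f ^ a).1 y = y := by
  obtain ⟨F, hF⟩ := f.2.1
  obtain ⟨X, rfl⟩ := QuotientAddGroup.mk_surjective x
  obtain ⟨Y, rfl⟩ := QuotientAddGroup.mk_surjective y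
  have key : ∀ (n : ℕ) (Z : ℝ), (f ^ n).1 (Z : UnitAddCircle) = (Z : UnitAddCircle) →
      ∃ k : ℤ, (hF.toDeg1 ^ n) Z = Z + k := by
    intro n Z h
    rw [(isC1Lift_iterate hF n).apply_coe, ← sub_eq_zero, ← AddCircle.coe_sub,
      AddCircle.coe_eq_zero_iff] at h
    obtain ⟨k, hk⟩ := h
    refine ⟨k, ?_⟩
    rw [CircleDeg1Lift.coe_pow]
    change F^[n] Z = Z + k
    simp only [zsmul_eq_mul, mul_one] at hk
    linarith
  obtain ⟨k, hk⟩ := key a X hx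
  obtain ⟨l, hl⟩ := key b Y hy
  have h1 := CircleDeg1Lift.translationNumber_of_eq_add_int _ hk
  have h2 := CircleDeg1Lift.translationNumber_of_eq_add_int _ hl
  rw [CircleDeg1Lift.translationNumber_pow] at h1 h2
  -- The translation number is `k / a = l / b`, so the `b`-th iterate of `F^a` moves `Y` by exactly
  -- `b * k`; monotonicity then forces `F^a` to move it by `k`.
  have h3 : (hF.toDeg1 ^ a) Y = Y + k := by
    rw [← CircleDeg1Lift.iterate_pos_eq_iff _ hb, ← CircleDeg1Lift.coe_pow, ← pow_mul, mul_comm,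
      pow_mul, CircleDeg1Lift.coe_pow, CircleDeg1Lift.iterate_eq_of_map_eq_add_int _ hl, ← h1, ← h2]
    ring
  rw [CircleDeg1Lift.coe_pow] at h3
  have h4 : (f ^ a).1 ((Y : ℝ) : UnitAddCircle) = ((F^[a] Y : ℝ) : UnitAddCircle) :=
    (isC1Lift_iterate hF a).apply_coe Y
  have h5 : F^[a] Y = Y + k := h3
  exact h4.trans (by rw [h5, coe_add_int])

end CircleDiff

/-! ### Hyperbolic fixed points of nilpotent groups of circle diffeomorphisms -/

namespace CircleDiff

/-- In a lift, `F - id` has nonzero derivative at the fixed point, so it does not take the same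
integer value again nearby, and by continuity no other integer value either. -/
theorem eventually_ne_of_hyperbolic (g : CircleDiff) {x : UnitAddCircle} (hx : g.1 x = x)
    (hlog : logD g x ≠ 0) : ∀ᶠ y in 𝓝 x, g.1 y = y → y = x := by
  obtain ⟨F, hF⟩ := g.2.1
  obtain ⟨t, rfl⟩ := isOpenQuotientMap_coe.surjective x
  have hint : ∀ s : ℝ, g.1 (s : UnitAddCircle) = (s : UnitAddCircle) → ∃ k : ℤ, F s = s + k := by
    intro s hs
    rw [hF.apply_coe, ← sub_eq_zero, ← AddCircle.coe_sub, AddCircle.coe_eq_zero_iff] at hs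
    obtain ⟨k, hk⟩ := hs
    exact ⟨k, by simp only [zsmul_eq_mul, mul_one] at hk; linarith⟩
  obtain ⟨k, hk⟩ := hint t hx
  have hd : HasDerivAt (fun s => F s - s) (_root_.deriv F t - 1) t :=
    (hF.hasDerivAt t).sub (hasDerivAt_id t)
  have hd0 : _root_.deriv F t - 1 ≠ 0 := by
    rw [← exp_logD_coe g hF, sub_ne_zero]
    exact fun h => hlog (Real.exp_eq_one_iff _ |>.1 h)
  have h1 : ∀ᶠ s in 𝓝 t, s ≠ t → F s - s ≠ k := by
    have := hd.eventually_ne (c := (k : ℝ)) hd0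
    exact eventually_nhdsWithin_iff.1 this
  have h2 : ∀ᶠ s in 𝓝 t, |(F s - s) - (F t - t)| < 1 := by
    have := hd.continuousAt.tendsto
    exact this (Metric.ball_mem_nhds _ one_pos)
  rw [← isOpenQuotientMap_coe.map_nhds_eq, Filter.eventually_map]
  filter_upwards [h1, h2] with s h1 h2 hs
  obtain ⟨l, hl⟩ := hint s hs
  have h3 : l = k := by
    rw [hl, hk] at h2
    have h4 : |((l - k : ℤ) : ℝ)| < 1 := by
      push_cast
      convert h2 using 2
      ring
    have h5 : |l - k| < 1 := by exact_mod_cast h4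
    have := Int.abs_lt_one_iff.1 h5
    omega
  by_contra h
  exact h1 (fun h' => h (by rw [h'])) (by rw [hl, h3]; ring)

/-- The set is compact and each of its points is isolated among the fixed points. -/
theorem finite_hyperbolic (g : CircleDiff) {ε : ℝ} (hε : 0 < ε) :
    {x | g.1 x = x ∧ ε ≤ |logD g x|}.Finite := by
  set T := {x | g.1 x = x ∧ ε ≤ |logD g x|} with hT
  have hcl : IsClosed T := (isClosed_eq g.1.continuous continuous_id).inter
    (isClosed_le continuous_const (logD g).continuous.abs)
  by_contra h
  obtain ⟨x, hx, hacc⟩ := Set.Infinite.exists_accPt_of_subset_isCompact h hcl.isCompact subset_rfl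
  have h1 := eventually_ne_of_hyperbolic g hx.1 fun h0 => by
    have := hx.2
    rw [h0, abs_zero] at this
    linarith
  obtain ⟨y, ⟨hy1, hy2⟩, hy3⟩ :=
    (accPt_iff_frequently.1 hacc).and_eventually h1 |>.exists
  exact hy1 (hy3 hy2.1)

theorem logD_pow_of_fixed (g : CircleDiff) {x : UnitAddCircle} (hx : g.1 x = x) (n : ℕ) :
    (g ^ n).1 x = x ∧ logD (g ^ n) x = n * logD g x := by
  induction n with
  | zero => simp
  | succ n ih =>
    refine ⟨?_, ?_⟩
    · rw [pow_succ, coe_mul, hx, ih.1]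
    · rw [logD_pow_succ, ih.1, ih.2]
      push_cast
      ring

theorem logD_neg (g : CircleDiff) (hg : ∀ x, g.1 (-x) = -g.1 x) (x : UnitAddCircle) :
    logD g (-x) = logD g x := by
  obtain ⟨F, hF⟩ := g.2.1
  obtain ⟨t, rfl⟩ := isOpenQuotientMap_coe.surjective x
  have hF' : IsC1Lift (fun t => -F (-t)) fun x => g.1 x :=
    { contDiff := (hF.contDiff.comp contDiff_neg).neg
      strictMono := fun a b h => by simpa using hF.strictMono (neg_lt_neg h)
      map_add_one := fun t => by
        have := hF.map_add_one (-(t + 1))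
        rw [show -(t + 1) + 1 = -t by ring] at this
        linarith
      apply_coe := fun t => by
        have := hF.apply_coe (-t)
        rw [AddCircle.coe_neg, hg] at this
        rw [AddCircle.coe_neg, ← this, neg_neg] }
  rw [← AddCircle.coe_neg, logD_coe g hF, logD_coe g hF']
  congr 1
  have := (((hF.hasDerivAt (-t)).comp t (hasDerivAt_neg t)).neg).deriv
  simp only [mul_neg, mul_one, neg_neg] at this
  exact this.symm

end CircleDiff

theorem eq_zero_of_bounded_of_sub_eq {ψ : ℕ → ℝ} {a C : ℝ} (h : ∀ n, ψ n - ψ (n + 1) = a)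
    (hC : ∀ n, |ψ n| ≤ C) : a = 0 := by
  have h1 : ∀ n : ℕ, ψ n = ψ 0 - n * a := by
    intro n
    induction n with
    | zero => simp
    | succ n ih =>
      have := h n
      push_cast
      linarith
  by_contra ha
  obtain ⟨n, hn⟩ := exists_nat_gt (2 * C / |a|)
  rw [div_lt_iff₀ (abs_pos.2 ha)] at hn
  have h2 : |(n : ℝ) * a| ≤ 2 * C := by
    have : (n : ℝ) * a = ψ 0 - ψ n := by rw [h1 n]; ring
    rw [this]
    refine (abs_sub _ _).trans ?_
    linarith [hC 0, hC n]
  rw [abs_mul, Nat.abs_cast] at h2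
  linarith

open CircleDiff

section Nilpotent

variable {Γ : Type*} [Group Γ] [Group.IsNilpotent Γ] (ρ : Γ →* CircleDiff)

/-- If `h` fixes the forward orbit of `p` under `f`, then its multiplier is constant along it. -/
theorem logD_eq_of_fixes_orbit {f h : Γ} {p : UnitAddCircle}
    (hp : ∀ n : ℕ, (ρ h).1 ((ρ (f ^ n)).1 p) = (ρ (f ^ n)).1 p) (n : ℕ) :
    logD (ρ h) ((ρ (f ^ n)).1 p) = logD (ρ h) p := by
  obtain ⟨N, hN⟩ := Subgroup.nilpotent_iff_lowerCentralSeries.1 ‹Group.IsNilpotent Γ›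
  -- Induction from the bottom of the lower central series upwards. The commutator `⁅h, f⁻¹⁆` also
  -- fixes the orbit, and its multiplier is the increment of that of `h`. By induction this
  -- increment is constant, so it vanishes because `logD (ρ h)` is bounded.
  have key : ∀ j i, i + j = N → ∀ h ∈ (⊤ : Subgroup Γ).lowerCentralSeries i,
      (∀ n : ℕ, (ρ h).1 ((ρ (f ^ n)).1 p) = (ρ (f ^ n)).1 p) →
      ∀ n, logD (ρ h) ((ρ (f ^ n)).1 p) = logD (ρ h) p := by
    intro j
    induction j with
    | zero =>
      intro i hi h hh _ n
      rw [add_zero] at hi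
      rw [hi, hN, Subgroup.mem_bot] at hh
      simp [hh]
    | succ j ih =>
      intro i hi h hh hfix n
      have hh' : ⁅h, f⁻¹⁆ ∈ (⊤ : Subgroup Γ).lowerCentralSeries (i + 1) :=
        Subgroup.commutator_mem_commutator hh (Subgroup.mem_top _)
      have hsucc : ∀ n : ℕ, (ρ f).1 ((ρ (f ^ n)).1 p) = (ρ (f ^ (n + 1))).1 p := by
        intro n
        rw [pow_succ', map_mul, coe_mul]
      have hinv : ∀ n : ℕ, ((ρ h)⁻¹).1 ((ρ (f ^ n)).1 p) = (ρ (f ^ n)).1 p := by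
        intro n
        conv_lhs => rw [← hfix n]
        rw [inv_apply_apply]
      have hcomm : ρ ⁅h, f⁻¹⁆ = ρ h * ((ρ f)⁻¹ * ((ρ h)⁻¹ * ρ f)) := by
        rw [commutatorElement_def]
        simp [mul_assoc]
      have hback : ∀ n : ℕ, ((ρ f)⁻¹).1 ((ρ (f ^ (n + 1))).1 p) = (ρ (f ^ n)).1 p := by
        intro n
        rw [← hsucc, inv_apply_apply]
      have hfix' : ∀ n : ℕ, (ρ ⁅h, f⁻¹⁆).1 ((ρ (f ^ n)).1 p) = (ρ (f ^ n)).1 p := by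
        intro n
        rw [hcomm]
        simp only [coe_mul]
        rw [hsucc, hinv, hback, hfix]
      have hlog : ∀ n : ℕ, logD (ρ h) ((ρ (f ^ n)).1 p) - logD (ρ h) ((ρ (f ^ (n + 1))).1 p)
          = logD (ρ ⁅h, f⁻¹⁆) ((ρ (f ^ n)).1 p) := by
        intro n
        rw [hcomm, logD_mul, logD_mul, logD_mul]
        simp only [coe_mul]
        rw [hsucc, hinv, hback, logD_inv (ρ f), hback, logD_inv (ρ h), hinv]
        ring
      have hconst := ih (i + 1) (by omega) _ hh' hfix'
      have h0 := eq_zero_of_bounded_of_sub_eq (ψ := fun n => logD (ρ h) ((ρ (f ^ n)).1 p))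
        (fun n => (hlog n).trans (hconst n)) fun n => (logD (ρ h)).norm_coe_le_norm _
      induction n with
      | zero => simp
      | succ n ihn =>
        have h1 := hlog n
        rw [hconst, h0] at h1
        linarith
  exact key N 0 (zero_add N) h (Subgroup.mem_top h) hp n

/-- The factorial provides one exponent depending only on the cardinality of `O`, which serves for
all conjugates of `g` at once when orbits are shown to be finite. -/
theorem CircleDiff.pow_factorial_apply_eq (u : CircleDiff) {p : UnitAddCircle}
    {O : Set UnitAddCircle} (hO : O.Finite) (h : ∀ i : ℕ, (u ^ i).1 p ∈ O) :
    (u ^ (O.ncard).factorial).1 p = p := by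
  obtain ⟨i, hi, j, hj, hij, he⟩ := Finset.exists_ne_map_eq_of_card_lt_of_maps_to
    (s := Finset.range (O.ncard + 1)) (t := hO.toFinset) (f := fun i => (u ^ i).1 p)
    (by rw [Set.ncard_eq_toFinset_card O hO]; simp) (fun i _ => by simpa using h i)
  rw [Finset.mem_range] at hi hj
  have key : ∀ i j, i < j → j < O.ncard + 1 → (u ^ i).1 p = (u ^ j).1 p →
      (u ^ (O.ncard).factorial).1 p = p := by
    intro i j hij hj he
    have h1 : (u ^ (j - i)).1 p = p := by
      have h2 : u ^ j = u ^ i * u ^ (j - i) := by rw [← pow_add, Nat.add_sub_cancel' hij.le]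
      rw [h2, coe_mul] at he
      exact ((u ^ i).1.injective he).symm
    obtain ⟨k, hk⟩ := Nat.dvd_factorial (show 0 < j - i by omega) (show j - i ≤ O.ncard by omega)
    rw [hk, pow_mul]
    exact (logD_pow_of_fixed (u ^ (j - i)) h1 k).1
  rcases lt_or_gt_of_ne hij with h' | h'
  · exact key i j h' hj he
  · exact key j i h' hi he.symm

/-- A hyperbolic fixed point of an element of a nilpotent group has a finite orbit. -/
theorem finite_orbit_of_hyperbolic {g : Γ} {p : UnitAddCircle} (hp : (ρ g).1 p = p)
    (hlog : logD (ρ g) p ≠ 0) : (range fun f => (ρ f).1 p).Finite := by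
  obtain ⟨N, hN⟩ := Group.IsNilpotent.nilpotent Γ
  -- The orbit is enlarged along the upper central series.
  have key : ∀ j, ((fun f => (ρ f).1 p) '' (Subgroup.upperCentralSeries Γ j : Set Γ)).Finite := by
    intro j
    induction j with
    | zero => simp
    | succ j ih =>
      set O := (fun f => (ρ f).1 p) '' (Subgroup.upperCentralSeries Γ j : Set Γ) with hO
      set m := (O.ncard).factorial with hm
      have hfix : ∀ f ∈ Subgroup.upperCentralSeries Γ (j + 1),
          (ρ (g ^ m)).1 ((ρ f).1 p) = (ρ f).1 p := by
        intro f hf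
        have hz : ⁅f⁻¹, g⁆ ∈ Subgroup.upperCentralSeries Γ j :=
          Subgroup.mem_upperCentralSeries_succ_iff.1 (inv_mem hf) g
        -- `⁅f⁻¹, g⁆ * g` is the conjugate `f⁻¹ g f`. It preserves the finite set `O`, so its power
        -- `m` fixes `p`, which means that `g ^ m` fixes the image of `p` under `f`.
        have hmaps : ∀ x ∈ O, (ρ (⁅f⁻¹, g⁆ * g)).1 x ∈ O := by
          rintro _ ⟨f', hf', rfl⟩
          refine ⟨⁅f⁻¹, g⁆ * (g * f' * g⁻¹), mul_mem hz
            (Subgroup.Normal.conj_mem inferInstance _ hf' g), ?_⟩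
          have : (ρ (⁅f⁻¹, g⁆ * g * f')).1 p
              = (ρ (⁅f⁻¹, g⁆ * (g * f' * g⁻¹) * g)).1 p := by
            congr 3
            group
          change _ = (ρ (⁅f⁻¹, g⁆ * g)).1 ((ρ f').1 p)
          rw [← coe_mul, ← map_mul, this, map_mul, coe_mul, hp]
        have hit : ∀ i : ℕ, (ρ (⁅f⁻¹, g⁆ * g) ^ i).1 p ∈ O := by
          intro i
          induction i with
          | zero => exact ⟨1, one_mem _, by simp⟩
          | succ i ihi =>
            rw [pow_succ', coe_mul]
            exact hmaps _ ihi
        have h1 := CircleDiff.pow_factorial_apply_eq _ ih hit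
        rw [← map_pow] at h1
        have h2 : g ^ m * f = f * (⁅f⁻¹, g⁆ * g) ^ m := by
          have h3 : ⁅f⁻¹, g⁆ * g = f⁻¹ * g * f := by
            rw [commutatorElement_def]
            group
          have h4 : (f⁻¹ * g * f) ^ m = f⁻¹ * g ^ m * f := by
            have := conj_pow (a := f⁻¹) (b := g) (i := m)
            simpa using this
          rw [h3, h4]
          group
        rw [← coe_mul, ← map_mul, h2, map_mul, coe_mul, h1]
      have hm0 : (m : ℝ) ≠ 0 := by
        have := Nat.factorial_pos O.ncard
        positivity
      have hc := (logD_pow_of_fixed (ρ g) hp m).2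
      have hpos : 0 < |(m : ℝ) * logD (ρ g) p| := abs_pos.2 (mul_ne_zero hm0 hlog)
      -- All new orbit points are fixed by `g ^ m` with the same nonzero exponent as `p`, so there
      -- are finitely many.
      refine (finite_hyperbolic (ρ (g ^ m)) hpos).subset ?_
      rintro _ ⟨f, hf, rfl⟩
      refine ⟨hfix f hf, ?_⟩
      have h1 := logD_eq_of_fixes_orbit ρ (f := f) (h := g ^ m) (p := p)
        (fun n => hfix _ (pow_mem hf n)) 1
      rw [pow_one] at h1
      change _ ≤ |logD (ρ (g ^ m)) ((ρ f).1 p)|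
      rw [h1, map_pow, hc]
  have := key N
  rw [hN] at this
  simpa [← image_univ] using this

/-- The periodic points with a large exponent of finitely many elements of a nilpotent group are
contained in a finite invariant set. -/
theorem exists_finite_invariant (S : Finset Γ) {ε : ℝ} (hε : 0 < ε) :
    ∃ P : Set UnitAddCircle, P.Finite ∧ (∀ g, ∀ x ∈ P, (ρ g).1 x ∈ P) ∧
      (∀ g ∈ S, ∀ q : ℕ, 0 < q → ∀ p, (ρ g ^ q).1 p = p → ε * q ≤ |logD (ρ g ^ q) p| → p ∈ P) ∧
      ((∀ g x, (ρ g).1 (-x) = -(ρ g).1 x) → ∀ x ∈ P, -x ∈ P) := by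
  set T : Γ → Set UnitAddCircle := fun g =>
    {p | ∃ q : ℕ, 0 < q ∧ (ρ g ^ q).1 p = p ∧ ε * q ≤ |logD (ρ g ^ q) p|} with hT
  -- One period `q₀` serves for all periodic points of `ρ g`, and the exponent per unit of time does
  -- not depend on the period used; hence these are hyperbolic fixed points of a single map.
  have hTfin : ∀ g, (T g).Finite := by
    intro g
    rcases (T g).eq_empty_or_nonempty with h | ⟨p₀, q₀, hq₀, hp₀, -⟩
    · rw [h]
      exact finite_empty
    · have hq₀' : (0 : ℝ) < q₀ := Nat.cast_pos.2 hq₀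
      refine (finite_hyperbolic (ρ g ^ q₀) (ε := ε * q₀) (by positivity)).subset ?_
      rintro p ⟨q, hq, hp, hle⟩
      have hq' : (0 : ℝ) < q := Nat.cast_pos.2 hq
      have h1 := pow_apply_eq_of_periodic (ρ g) hq hp₀ hp
      refine ⟨h1, ?_⟩
      have h2 := (logD_pow_of_fixed _ h1 q).2
      have h3 := (logD_pow_of_fixed _ hp q₀).2
      rw [← pow_mul] at h2 h3
      rw [mul_comm q q₀, h2] at h3
      have h4 : (q : ℝ) * |logD (ρ g ^ q₀) p| = q₀ * |logD (ρ g ^ q) p| := by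
        have := congrArg abs h3
        rwa [abs_mul, abs_mul, Nat.abs_cast, Nat.abs_cast] at this
      have h5 : q₀ * (ε * q) ≤ (q : ℝ) * |logD (ρ g ^ q₀) p| := by
        rw [h4]
        gcongr
      refine le_of_mul_le_mul_left ?_ hq'
      linarith
  refine ⟨⋃ g ∈ S, ⋃ p ∈ T g, range fun f => (ρ f).1 p, ?_, ?_, ?_, ?_⟩
  · refine S.finite_toSet.biUnion fun g _ => (hTfin g).biUnion ?_
    rintro p ⟨q, hq, hp, hle⟩
    rw [← map_pow] at hp hle
    refine finite_orbit_of_hyperbolic ρ hp fun h => ?_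
    rw [h, abs_zero] at hle
    have : 0 < ε * q := mul_pos hε (Nat.cast_pos.2 hq)
    linarith
  · intro g x hx
    simp only [mem_iUnion] at hx ⊢
    obtain ⟨g', hg', p, hp, f, rfl⟩ := hx
    exact ⟨g', hg', p, hp, g * f, by simp⟩
  · intro g hg q hq p hp hle
    simp only [mem_iUnion]
    exact ⟨g, hg, p, ⟨q, hq, hp, hle⟩, 1, by simp⟩
  · intro hodd x hx
    simp only [mem_iUnion] at hx ⊢
    obtain ⟨g', hg', p, ⟨q, hq, hp, hle⟩, f, rfl⟩ := hx
    refine ⟨g', hg', -p, ⟨q, hq, ?_, ?_⟩, f, ?_⟩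
    · rw [← map_pow] at hp ⊢
      rw [hodd, hp]
    · rw [← map_pow] at hle ⊢
      rwa [logD_neg _ (hodd _)]
    · exact hodd f p

end Nilpotent

/-! ### Conjugation by a path of singular densities -/

/-- The logarithm of a density on the circle which may be infinite at finitely many points. -/
structure IsSingularWeight (θ : UnitAddCircle → ℝ) (P : Set UnitAddCircle) : Prop where
  finite : P.Finite
  measurable : Measurable θ
  continuousOn : ContinuousOn θ Pᶜ
  intervalIntegrable : IntervalIntegrable (fun t : ℝ => Real.exp (θ t)) MeasureTheory.volume 0 1

open unitInterval

namespace IsSingularWeight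

variable {θ : UnitAddCircle → ℝ} {P : Set UnitAddCircle}

/-- An integrable bound for the densities that is uniform in `s`, for dominated convergence. -/
theorem exp_mul_le (s : I) (x : ℝ) : Real.exp (s * x) ≤ 1 + Real.exp x := by
  rcases le_total x 0 with h | h
  · have : Real.exp (s * x) ≤ 1 := Real.exp_le_one_iff.2 (mul_nonpos_of_nonneg_of_nonpos s.2.1 h)
    linarith [Real.exp_pos x]
  · have : Real.exp (s * x) ≤ Real.exp x :=
      Real.exp_le_exp.2 (mul_le_of_le_one_left h s.2.2)
    linarith

theorem measurable_coe (w : IsSingularWeight θ P) (s : ℝ) :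
    Measurable fun t : ℝ => Real.exp (s * θ t) :=
  Real.measurable_exp.comp ((w.measurable.comp (AddCircle.continuous_mk' 1).measurable).const_mul s)

theorem periodic (s : ℝ) : Function.Periodic (fun t : ℝ => Real.exp (s * θ t)) 1 := fun t => by
  have : ((t + 1 : ℝ) : UnitAddCircle) = t := by exact_mod_cast coe_add_int t 1
  simp only [this]

theorem intervalIntegrable_dom (w : IsSingularWeight θ P) (a b : ℝ) :
    IntervalIntegrable (fun t : ℝ => 1 + Real.exp (θ t)) MeasureTheory.volume a b := by
  refine intervalIntegrable_const.add ?_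
  have hp : Function.Periodic (fun t : ℝ => Real.exp (θ t)) 1 := by
    simpa only [one_mul] using periodic (θ := θ) 1
  refine hp.intervalIntegrable (t := 0) one_ne_zero ?_ a b
  simpa using w.intervalIntegrable

theorem intervalIntegrable_exp (w : IsSingularWeight θ P) (s : I) (a b : ℝ) :
    IntervalIntegrable (fun t : ℝ => Real.exp (s * θ t)) MeasureTheory.volume a b := by
  refine (w.intervalIntegrable_dom a b).mono_fun (w.measurable_coe s).aestronglyMeasurable ?_
  refine Filter.Eventually.of_forall fun t => ?_
  change ‖Real.exp _‖ ≤ ‖1 + Real.exp _‖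
  rw [Real.norm_eq_abs, Real.abs_exp, Real.norm_eq_abs, abs_of_pos (by positivity)]
  exact exp_mul_le s _

/-- The primitive of the density `exp (s θ)`. -/
noncomputable def prim (θ : UnitAddCircle → ℝ) (s t : ℝ) : ℝ :=
  ∫ τ in (0 : ℝ)..t, Real.exp (s * θ τ)

theorem prim_zero (s : ℝ) : prim θ s 0 = 0 := by simp [prim]

theorem prim_sub (w : IsSingularWeight θ P) (s : I) (a b : ℝ) :
    prim θ s b - prim θ s a = ∫ τ in a..b, Real.exp (s * θ τ) :=
  intervalIntegral.integral_interval_sub_left (w.intervalIntegrable_exp s _ _)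
    (w.intervalIntegrable_exp s _ _)

theorem prim_strictMono (w : IsSingularWeight θ P) (s : I) : StrictMono (prim θ s) := by
  intro a b hab
  have h := intervalIntegral.intervalIntegral_pos_of_pos (w.intervalIntegrable_exp s a b)
    (fun t => Real.exp_pos _) hab
  rw [← w.prim_sub] at h
  linarith

theorem prim_one_pos (w : IsSingularWeight θ P) (s : I) : 0 < prim θ s 1 := by
  have := w.prim_strictMono s zero_lt_one
  rwa [prim_zero] at this

theorem prim_add_one (w : IsSingularWeight θ P) (s : I) (t : ℝ) :
    prim θ s (t + 1) = prim θ s t + prim θ s 1 := by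
  have h := (periodic (θ := θ) s).intervalIntegral_add_eq t 0
  rw [← w.prim_sub, zero_add, ← w.prim_sub, prim_zero] at h
  linarith

/-- Dominated convergence handles `s` at a fixed endpoint; moving the endpoint costs at most the
integral of the dominating function, uniformly in `s`. -/
theorem continuous_prim (w : IsSingularWeight θ P) :
    Continuous fun p : I × ℝ => prim θ p.1 p.2 := by
  rw [continuous_iff_continuousAt]
  rintro ⟨s₀, t₀⟩
  have h1 : Continuous fun s : I => prim θ s t₀ := by
    refine intervalIntegral.continuous_of_dominated_interval
      (bound := fun t => 1 + Real.exp (θ t)) (fun s => (w.measurable_coe s).aestronglyMeasurable)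
      (fun s => ?_) (w.intervalIntegrable_dom _ _) ?_
    · refine Filter.Eventually.of_forall fun t _ => ?_
      rw [Real.norm_eq_abs, Real.abs_exp]
      exact exp_mul_le s _
    · refine Filter.Eventually.of_forall fun t _ => ?_
      fun_prop
  have h2 : Continuous fun t => ∫ τ in t₀..t, (1 + Real.exp (θ (τ : ℝ))) :=
    intervalIntegral.continuous_primitive (fun a b => w.intervalIntegrable_dom a b) _
  have h3 : Filter.Tendsto (fun p : I × ℝ => prim θ p.1 p.2 - prim θ p.1 t₀) (𝓝 (s₀, t₀))
      (𝓝 0) := by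
    have h4 : Filter.Tendsto (fun p : I × ℝ => |∫ τ in t₀..p.2, (1 + Real.exp (θ (τ : ℝ)))|)
        (𝓝 (s₀, t₀)) (𝓝 0) := by
      have := ((h2.comp continuous_snd).abs).tendsto ((s₀, t₀) : I × ℝ)
      simpa using this
    refine squeeze_zero_norm (fun p => ?_) h4
    rw [w.prim_sub]
    refine intervalIntegral.norm_integral_le_abs_of_norm_le
      (Filter.Eventually.of_forall fun t => ?_) (w.intervalIntegrable_dom _ _)
    rw [Real.norm_eq_abs, Real.abs_exp]
    exact exp_mul_le p.1 _
  have h5 := ((h1.comp continuous_fst).tendsto ((s₀, t₀) : I × ℝ)).add h3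
  simp only [Function.comp_apply, add_sub_cancel, add_zero] at h5
  exact h5

theorem hasDerivAt_prim (w : IsSingularWeight θ P) (s : I) {t : ℝ} (ht : (t : UnitAddCircle) ∉ P) :
    HasDerivAt (prim θ s) (Real.exp (s * θ t)) t := by
  have h1 : ContinuousAt θ (t : UnitAddCircle) :=
    w.continuousOn.continuousAt (w.finite.isClosed.isOpen_compl.mem_nhds ht)
  have h2 : ContinuousAt (fun t : ℝ => θ t) t :=
    ContinuousAt.comp (f := ((↑) : ℝ → UnitAddCircle)) h1 (AddCircle.continuous_mk' 1).continuousAt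
  exact intervalIntegral.integral_hasDerivAt_right (w.intervalIntegrable_exp s _ _)
    (w.measurable_coe s).stronglyMeasurable.stronglyMeasurableAtFilter
    (Real.continuous_exp.continuousAt.comp (continuousAt_const.mul h2))

theorem normalized_add_one (w : IsSingularWeight θ P) (s : I) (t : ℝ) :
    prim θ s (t + 1) / prim θ s 1 = prim θ s t / prim θ s 1 + 1 := by
  rw [w.prim_add_one, add_div, div_self (w.prim_one_pos s).ne']

theorem normalized_strictMono (w : IsSingularWeight θ P) (s : I) :
    StrictMono fun t => prim θ s t / prim θ s 1 := fun _ _ h =>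
  div_lt_div_of_pos_right (w.prim_strictMono s h) (w.prim_one_pos s)

theorem normalized_continuous (w : IsSingularWeight θ P) :
    Continuous fun p : I × ℝ => prim θ p.1 p.2 / prim θ p.1 1 :=
  w.continuous_prim.div (w.continuous_prim.comp (continuous_fst.prodMk continuous_const))
    fun p => (w.prim_one_pos p.1).ne'

theorem normalized_surjective (w : IsSingularWeight θ P) (s : I) :
    Function.Surjective fun t => prim θ s t / prim θ s 1 := by
  let F : CircleDeg1Lift := ⟨⟨_, (w.normalized_strictMono s).monotone⟩, w.normalized_add_one s⟩
  exact (CircleDeg1Lift.continuous_iff_surjective F).1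
    (w.normalized_continuous.comp (continuous_const.prodMk continuous_id))

/-- The normalized primitive, as an increasing homeomorphism of the line. -/
noncomputable def lift (w : IsSingularWeight θ P) (s : I) : ℝ ≃o ℝ :=
  (w.normalized_strictMono s).orderIsoOfSurjective _ (w.normalized_surjective s)

theorem lift_apply (w : IsSingularWeight θ P) (s : I) (t : ℝ) :
    w.lift s t = prim θ s t / prim θ s 1 := rfl

theorem lift_add_one (w : IsSingularWeight θ P) (s : I) (t : ℝ) :
    w.lift s (t + 1) = w.lift s t + 1 := w.normalized_add_one s t

theorem lift_zero (w : IsSingularWeight θ P) (s : I) : w.lift s 0 = 0 := by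
  rw [lift_apply, prim_zero, zero_div]

theorem lift_zero_left (w : IsSingularWeight θ P) (t : ℝ) : w.lift 0 t = t := by
  simp [lift_apply, prim]

theorem lift_neg (w : IsSingularWeight θ P) (hθ : ∀ x, θ (-x) = θ x) (s : I) (t : ℝ) :
    w.lift s (-t) = -w.lift s t := by
  rw [lift_apply, lift_apply, ← neg_div]
  congr 1
  have h := intervalIntegral.integral_comp_neg (a := t) (b := 0)
    (fun τ : ℝ => Real.exp (s * θ τ))
  simp only [AddCircle.coe_neg, hθ, neg_zero] at h
  rw [prim, prim, ← h, intervalIntegral.integral_symm]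

theorem continuous_lift (w : IsSingularWeight θ P) : Continuous fun p : I × ℝ => w.lift p.1 p.2 :=
  w.normalized_continuous

/-- By monotonicity, bounds on the inverse are strict inequalities for `lift` at fixed points, which
are open in the parameter. -/
theorem continuous_lift_symm (w : IsSingularWeight θ P) :
    Continuous fun p : I × ℝ => (w.lift p.1).symm p.2 := by
  rw [continuous_iff_continuousAt]
  rintro ⟨s₀, t₀⟩
  have hc : ∀ a, Continuous fun p : I × ℝ => w.lift p.1 a := fun a =>
    w.continuous_lift.comp (continuous_fst.prodMk continuous_const)
  refine tendsto_order.2 ⟨fun a ha => ?_, fun a ha => ?_⟩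
  · have h1 : w.lift s₀ a < t₀ := (OrderIso.lt_symm_apply _).1 ha
    have h2 := (hc a).continuousAt.eventually_lt continuous_snd.continuousAt
      (x₀ := ((s₀, t₀) : I × ℝ)) h1
    filter_upwards [h2] with p hp
    exact (OrderIso.lt_symm_apply _).2 hp
  · have h1 : t₀ < w.lift s₀ a := (OrderIso.symm_apply_lt _).1 ha
    have h2 := continuous_snd.continuousAt.eventually_lt (hc a).continuousAt
      (x₀ := ((s₀, t₀) : I × ℝ)) h1
    filter_upwards [h2] with p hp
    exact (OrderIso.symm_apply_lt _).2 hp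

theorem hasDerivAt_lift (w : IsSingularWeight θ P) (s : I) {t : ℝ}
    (ht : (t : UnitAddCircle) ∉ P) :
    HasDerivAt (w.lift s) (Real.exp (s * θ t) / prim θ s 1) t :=
  (w.hasDerivAt_prim s ht).div_const _

/-- The homeomorphism of the circle with density proportional to `exp (s θ)`. -/
noncomputable def homeo (w : IsSingularWeight θ P) (s : I) : UnitAddCircle ≃ₜ UnitAddCircle :=
  circleHomeo (w.lift s) (w.lift_add_one s)

end IsSingularWeight

theorem countable_preimage_coe {P : Set UnitAddCircle} (hP : P.Finite) :
    (((↑) : ℝ → UnitAddCircle) ⁻¹' P).Countable := by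
  rw [← biUnion_preimage_singleton]
  refine hP.countable.biUnion fun x _ => ?_
  obtain ⟨a, rfl⟩ := isOpenQuotientMap_coe.surjective x
  refine (countable_range fun n : ℤ => a + n).mono fun t ht => ?_
  rw [mem_preimage, mem_singleton_iff, ← sub_eq_zero, ← AddCircle.coe_sub,
    AddCircle.coe_eq_zero_iff] at ht
  obtain ⟨n, hn⟩ := ht
  simp only [zsmul_eq_mul, mul_one] at hn
  exact ⟨n, by simp only; linarith⟩

/-- A continuous function with a continuous derivative off a countable set is `C¹`. -/
theorem hasDerivAt_of_off_countable {G g : ℝ → ℝ} (hG : Continuous G) (hg : Continuous g)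
    {E : Set ℝ} (hE : E.Countable) (h : ∀ y ∉ E, HasDerivAt G (g y) y) (y : ℝ) :
    HasDerivAt G (g y) y := by
  have h1 : G = fun y => G 0 + ∫ τ in (0 : ℝ)..y, g τ := by
    funext y
    rw [MeasureTheory.integral_eq_of_hasDerivAt_off_countable G g hE hG.continuousOn
      (fun x hx => h x hx.2) (hg.intervalIntegrable _ _)]
    ring
  rw [h1]
  exact (intervalIntegral.integral_hasDerivAt_right (hg.intervalIntegrable _ _)
    hg.stronglyMeasurable.stronglyMeasurableAtFilter hg.continuousAt).const_add _

/-! ### Conjugates by the homeomorphisms of a singular weight -/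

namespace IsSingularWeight

variable {θ : UnitAddCircle → ℝ} {P : Set UnitAddCircle}

/-- Away from the poles this is the chain rule, in which the normalising constants cancel. The
formula involves `θ` only through `β`, which is continuous everywhere, so it persists over the
countably many exceptional points although the conjugacy itself is not differentiable there in
general. -/
theorem hasDerivAt_conj (w : IsSingularWeight θ P) {f : CircleDiff} {F : ℝ → ℝ}
    (hF : IsC1Lift F fun x => f.1 x) (hP : ∀ x, f.1 x ∈ P → x ∈ P) {β : C(UnitAddCircle, ℝ)}
    (hβ : ∀ x ∉ P, β x = θ (f.1 x) - θ x) (s : I) (y : ℝ) :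
    HasDerivAt (fun y => w.lift s (F ((w.lift s).symm y)))
      (Real.exp (logD f ((w.lift s).symm y : ℝ) + s * β ((w.lift s).symm y : ℝ))) y := by
  have hsymm : Continuous (w.lift s).symm := (w.lift s).symm.continuous
  have hcoe : Continuous fun y => (((w.lift s).symm y : ℝ) : UnitAddCircle) :=
    (AddCircle.continuous_mk' 1).comp hsymm
  refine hasDerivAt_of_off_countable (G := fun y => w.lift s (F ((w.lift s).symm y)))
    (g := fun y => Real.exp (logD f ((w.lift s).symm y : ℝ) + s * β ((w.lift s).symm y : ℝ)))
    (E := (w.lift s) '' (((↑) : ℝ → UnitAddCircle) ⁻¹' P))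
    ((w.lift s).continuous.comp (hF.contDiff.continuous.comp hsymm)) ?_
    ((countable_preimage_coe w.finite).image _) (fun y hy => ?_) y
  · exact Real.continuous_exp.comp (((logD f).continuous.comp hcoe).add
      (continuous_const.mul (β.continuous.comp hcoe)))
  · set x := (w.lift s).symm y with hx
    have hxP : (x : UnitAddCircle) ∉ P := fun h => hy ⟨x, h, by simp [hx]⟩
    have hFx : ((F x : ℝ) : UnitAddCircle) ∉ P := fun h => hxP (hP _ (by
      rwa [hF.apply_coe]))
    have h1 := w.hasDerivAt_lift s hxP
    have hc : prim θ s 1 ≠ 0 := (w.prim_one_pos s).ne'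
    have h2 : HasDerivAt (w.lift s).symm (Real.exp (s * θ x) / prim θ s 1)⁻¹ y :=
      HasDerivAt.of_local_left_inverse hsymm.continuousAt h1
        (div_ne_zero (Real.exp_ne_zero _) hc) (Filter.Eventually.of_forall fun y => by simp)
    have h3 := (w.hasDerivAt_lift s hFx).comp y ((hF.hasDerivAt x).comp y h2)
    refine h3.congr_deriv ?_
    rw [hβ _ hxP, hF.apply_coe, ← exp_logD_coe f hF, inv_div, Real.exp_add, mul_sub, Real.exp_sub]
    field_simp

theorem isC1Lift_conj (w : IsSingularWeight θ P) {f : CircleDiff} {F : ℝ → ℝ}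
    (hF : IsC1Lift F fun x => f.1 x) (hP : ∀ x, f.1 x ∈ P → x ∈ P) {β : C(UnitAddCircle, ℝ)}
    (hβ : ∀ x ∉ P, β x = θ (f.1 x) - θ x) (s : I) :
    IsC1Lift (fun y => w.lift s (F ((w.lift s).symm y)))
      fun x => (w.homeo s * f.1 * (w.homeo s)⁻¹) x where
  contDiff := by
    have h := w.hasDerivAt_conj hF hP hβ s
    refine contDiff_one_iff_deriv.2 ⟨fun y => (h y).differentiableAt, ?_⟩
    rw [funext fun y => (h y).deriv]
    have hcoe : Continuous fun y => (((w.lift s).symm y : ℝ) : UnitAddCircle) :=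
      (AddCircle.continuous_mk' 1).comp (w.lift s).symm.continuous
    exact Real.continuous_exp.comp (((logD f).continuous.comp hcoe).add
      (continuous_const.mul (β.continuous.comp hcoe)))
  strictMono := (w.lift s).strictMono.comp (hF.strictMono.comp (w.lift s).symm.strictMono)
  map_add_one t := by
    rw [map_symm_add_one (w.lift_add_one s), hF.map_add_one, w.lift_add_one]
  apply_coe t := by
    change w.homeo s (f.1 ((w.homeo s).symm t)) = _
    rw [homeo, circleHomeo_symm_coe, hF.apply_coe, circleHomeo_coe]

/-- The inverse is the conjugate of `f⁻¹`, whose coboundary is `-β ∘ f⁻¹`. -/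
theorem conj_mem (w : IsSingularWeight θ P) {f : CircleDiff}
    (hP : ∀ x, f.1 x ∈ P ↔ x ∈ P) {β : C(UnitAddCircle, ℝ)}
    (hβ : ∀ x ∉ P, β x = θ (f.1 x) - θ x) (s : I) :
    w.homeo s * f.1 * (w.homeo s)⁻¹ ∈ CircleDiff := by
  obtain ⟨F, hF⟩ := f.2.1
  obtain ⟨G, hG⟩ := f⁻¹.2.1
  refine ⟨⟨_, w.isC1Lift_conj hF (fun x => (hP x).1) hβ s⟩, ?_⟩
  have hP' : ∀ x, f⁻¹.1 x ∈ P → x ∈ P := fun x hx => by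
    have := (hP (f⁻¹.1 x)).2 hx
    rwa [apply_inv_apply] at this
  have h := w.isC1Lift_conj hG hP' (β := -(β.comp ⟨fun x => f⁻¹.1 x, f⁻¹.1.continuous⟩))
    (fun x hx => by
      have h1 : f⁻¹.1 x ∉ P := fun h => hx (hP' x h)
      change -(β (f⁻¹.1 x)) = _
      rw [hβ _ h1, apply_inv_apply]
      ring) s
  refine ⟨_, h.congr fun x => ?_⟩
  have h2 : (w.homeo s * f.1 * (w.homeo s)⁻¹)⁻¹ = w.homeo s * f⁻¹.1 * (w.homeo s)⁻¹ := by
    simp [mul_assoc]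
  exact (congrArg (fun g : UnitAddCircle ≃ₜ UnitAddCircle => g x) h2).symm

variable {Γ : Type*} [Group Γ]

/-- The conjugates of an action by the homeomorphisms with densities `exp (s θ)`. -/
noncomputable def conjAction (w : IsSingularWeight θ P) (ρ : Γ →* CircleDiff)
    (hP : ∀ g x, (ρ g).1 x ∈ P ↔ x ∈ P) (β : Γ → C(UnitAddCircle, ℝ))
    (hβ : ∀ g, ∀ x ∉ P, β g x = θ ((ρ g).1 x) - θ x) (s : I) : Γ →* CircleDiff where
  toFun g := ⟨w.homeo s * (ρ g).1 * (w.homeo s)⁻¹, w.conj_mem (hP g) (hβ g) s⟩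
  map_one' := Subtype.ext (by simp)
  map_mul' g h := Subtype.ext (by simp [mul_assoc])

theorem exists_conj_path (w : IsSingularWeight θ P) (ρ : Γ →* CircleDiff)
    (hP : ∀ g, ∀ x ∈ P, (ρ g).1 x ∈ P) (β : Γ → C(UnitAddCircle, ℝ))
    (hβ : ∀ g, ∀ x ∉ P, β g x = θ ((ρ g).1 x) - θ x) :
    ∃ (γ : I → Γ →* CircleDiff) (h : I → UnitAddCircle ≃ₜ UnitAddCircle),
      Continuous (Y := ActionSpace Γ CircleDiff) γ ∧ γ 0 = ρ ∧
      (∀ s g x, (γ s g).1 (h s x) = h s ((ρ g).1 x)) ∧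
      (∀ s g x, logD (γ s g) (h s x) = logD (ρ g) x + s * β g x) ∧
      (∀ s g, rot (γ s g) = rot (ρ g)) ∧ (∀ s, h s 0 = 0) ∧
      ((∀ x, θ (-x) = θ x) → ∀ s x, h s (-x) = -h s x) := by
  have hP' : ∀ g x, (ρ g).1 x ∈ P ↔ x ∈ P := fun g x => ⟨fun hx => by
    have := hP g⁻¹ _ hx
    rwa [map_inv, inv_apply_apply] at this, hP g x⟩
  have hconj : ∀ s g x, (w.conjAction ρ hP' β hβ s g).1 (w.homeo s x)
      = w.homeo s ((ρ g).1 x) := fun s g x => by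
    change w.homeo s ((ρ g).1 ((w.homeo s).symm (w.homeo s x))) = _
    rw [Homeomorph.symm_apply_apply]
  refine ⟨w.conjAction ρ hP' β hβ, w.homeo, ?_, ?_, hconj, ?_, ?_, ?_, ?_⟩
  · refine continuous_induced_rng.2 (continuous_pi fun g => ?_)
    obtain ⟨F, hF⟩ := (ρ g).2.1
    refine continuous_of_lift (F := fun s y => w.lift s (F ((w.lift s).symm y)))
      (fun s => w.isC1Lift_conj hF (fun x => (hP' g x).1) (hβ g) s) ?_ ?_
    · exact w.continuous_lift.comp (continuous_fst.prodMk
        (hF.contDiff.continuous.comp w.continuous_lift_symm))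
    · have hcoe : Continuous fun p : I × ℝ => (((w.lift p.1).symm p.2 : ℝ) : UnitAddCircle) :=
        (AddCircle.continuous_mk' 1).comp w.continuous_lift_symm
      have hs : Continuous fun p : I × ℝ => (p.1 : ℝ) := continuous_subtype_val.comp continuous_fst
      refine (Real.continuous_exp.comp (((logD (ρ g)).continuous.comp hcoe).add
        (hs.mul ((β g).continuous.comp hcoe)))).congr fun p => ?_
      exact (w.hasDerivAt_conj hF (fun x => (hP' g x).1) (hβ g) p.1 p.2).deriv.symm
  · refine MonoidHom.ext fun g => CircleDiff.ext' fun x => ?_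
    obtain ⟨t, rfl⟩ := isOpenQuotientMap_coe.surjective x
    have h0 : ∀ x, w.homeo 0 x = x := fun x => by
      obtain ⟨t, rfl⟩ := isOpenQuotientMap_coe.surjective x
      rw [homeo, circleHomeo_coe, w.lift_zero_left]
    have := hconj 0 g t
    rwa [h0, h0] at this
  · intro s g x
    obtain ⟨t, rfl⟩ := isOpenQuotientMap_coe.surjective x
    obtain ⟨F, hF⟩ := (ρ g).2.1
    rw [homeo, circleHomeo_coe, logD_coe (w.conjAction ρ hP' β hβ s g)
      (w.isC1Lift_conj hF (fun x => (hP' g x).1) (hβ g) s),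
      (w.hasDerivAt_conj hF (fun x => (hP' g x).1) (hβ g) s _).deriv, Real.log_exp,
      OrderIso.symm_apply_apply]
  · exact fun s g => rot_eq_of_conj (w.lift_add_one s) rfl
  · intro s
    have := circleHomeo_coe (w.lift s) (w.lift_add_one s) 0
    rw [w.lift_zero] at this
    exact_mod_cast this
  · intro hθ s x
    obtain ⟨t, rfl⟩ := isOpenQuotientMap_coe.surjective x
    rw [homeo, ← AddCircle.coe_neg, circleHomeo_coe, circleHomeo_coe, w.lift_neg hθ,
      AddCircle.coe_neg]

end IsSingularWeight

/-! ### A weight which makes finitely many hyperbolic fixed points parabolic -/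

/-- The logarithm of `1 / (r (1 - log r) ^ 2)`. -/
noncomputable def logPole (r : ℝ) : ℝ := -Real.log r - 2 * Real.log (1 - Real.log r)

theorem measurable_logPole : Measurable logPole := by
  unfold logPole
  exact (Real.measurable_log.neg).sub
    ((Real.measurable_log.comp (measurable_const.sub Real.measurable_log)).const_mul 2)

theorem one_le_one_sub_log {r : ℝ} (hr : 0 ≤ r) (hr1 : r ≤ 1) : 1 ≤ 1 - Real.log r := by
  linarith [Real.log_nonpos hr hr1]

theorem continuousOn_logPole : ContinuousOn logPole (Ioc 0 1) := by
  have h1 : ContinuousOn Real.log (Ioc 0 1) :=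
    Real.continuousOn_log.mono fun r hr => hr.1.ne'
  refine h1.neg.sub (continuousOn_const.mul ((continuousOn_const.sub h1).log fun r hr => ?_))
  have h : 1 ≤ 1 - Real.log r := one_le_one_sub_log hr.1.le hr.2
  change 1 - Real.log r ≠ 0
  linarith

theorem exp_logPole {r : ℝ} (hr : 0 < r) (hr1 : r ≤ 1) :
    Real.exp (logPole r) = r⁻¹ / (1 - Real.log r) ^ 2 := by
  have h1 := one_le_one_sub_log hr.le hr1
  have h2 : 0 < 1 - Real.log r := by linarith
  rw [logPole, Real.exp_sub, Real.exp_neg, Real.exp_log hr, mul_comm, Real.exp_mul,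
    Real.exp_log h2]
  norm_cast

/-- The primitive `1 / (1 - log r)` is continuous up to `0`, and the density is nonnegative. -/
theorem intervalIntegrable_exp_logPole :
    IntervalIntegrable (fun r => Real.exp (logPole r)) MeasureTheory.volume 0 (1 / 2) := by
  have hg : ContinuousOn (fun r : ℝ => if r ≤ 0 then 0 else (1 - Real.log r)⁻¹)
      (uIcc 0 (1 / 2)) := by
    rw [uIcc_of_le (by norm_num)]
    intro r hr
    rcases hr.1.eq_or_lt with rfl | h0
    · have h1 : Filter.Tendsto (fun r : ℝ => (1 - Real.log r)⁻¹) (𝓝[>] 0) (𝓝 0) := by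
        refine Filter.Tendsto.inv_tendsto_atTop ?_
        have := Filter.tendsto_neg_atBot_atTop.comp Real.tendsto_log_nhdsGT_zero
        refine (Filter.tendsto_atTop_add_const_left _ 1 this).congr fun r => ?_
        simp [sub_eq_add_neg]
      have h2 : ContinuousWithinAt (fun r : ℝ => if r ≤ 0 then 0 else (1 - Real.log r)⁻¹)
          (Ici 0) 0 := by
        rw [← continuousWithinAt_Ioi_iff_Ici, ContinuousWithinAt]
        simp only [le_refl, if_true]
        refine h1.congr' ?_
        filter_upwards [self_mem_nhdsWithin] with r hr
        simp [not_le.2 (mem_Ioi.1 hr)]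
      exact h2.mono Icc_subset_Ici_self
    · refine ContinuousAt.continuousWithinAt ?_
      have h1 : ContinuousAt (fun r : ℝ => (1 - Real.log r)⁻¹) r := by
        refine ContinuousAt.inv₀ (continuousAt_const.sub (Real.continuousAt_log h0.ne')) ?_
        linarith [one_le_one_sub_log h0.le (by linarith [hr.2] : r ≤ 1)]
      refine h1.congr ?_
      filter_upwards [Ioi_mem_nhds h0] with r hr
      simp [not_le.2 (mem_Ioi.1 hr)]
  refine intervalIntegral.intervalIntegrable_deriv_of_nonneg hg (fun r hr => ?_)
    fun r _ => (Real.exp_pos _).le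
  rw [min_eq_left (by norm_num), max_eq_right (by norm_num)] at hr
  have hr1 : r ≤ 1 := by linarith [hr.2]
  rw [exp_logPole hr.1 hr1]
  have h1 : HasDerivAt (fun r : ℝ => (1 - Real.log r)⁻¹) (r⁻¹ / (1 - Real.log r) ^ 2) r := by
    have := ((Real.hasDerivAt_log hr.1.ne').const_sub 1).inv
      (by linarith [one_le_one_sub_log hr.1.le hr1])
    rwa [neg_neg] at this
  refine h1.congr_of_eventuallyEq ?_
  filter_upwards [Ioi_mem_nhds hr.1] with r hr
  simp [not_le.2 (mem_Ioi.1 hr)]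

theorem norm_coe_of_abs_le {t : ℝ} (ht : |t| ≤ 1 / 2) : ‖(t : UnitAddCircle)‖ = |t| :=
  (AddCircle.norm_coe_eq_abs_iff 1 one_ne_zero).2 (by rwa [abs_one])

theorem intervalIntegrable_exp_logPole_dist (p : UnitAddCircle) :
    IntervalIntegrable (fun t : ℝ => Real.exp (logPole (dist (t : UnitAddCircle) p)))
      MeasureTheory.volume 0 1 := by
  obtain ⟨a, rfl⟩ := isOpenQuotientMap_coe.surjective p
  set K : ℝ → ℝ := fun t => Real.exp (logPole ‖(t : UnitAddCircle)‖) with hK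
  have h1 : IntervalIntegrable K MeasureTheory.volume 0 (1 / 2) := by
    refine intervalIntegrable_exp_logPole.congr fun t ht => ?_
    rw [uIoc_of_le (by norm_num)] at ht
    have : |t| = t := abs_of_pos ht.1
    simp only [hK]
    rw [norm_coe_of_abs_le (by rw [this]; exact ht.2), this]
  have h2 : IntervalIntegrable K MeasureTheory.volume 0 (-(1 / 2)) := by
    have := (IntervalIntegrable.iff_comp_neg (f := K) (a := 0) (b := 1 / 2)).1 h1
    simpa [hK, AddCircle.coe_neg, norm_neg] using this
  have hp : Function.Periodic K 1 := fun t => by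
    have : ((t + 1 : ℝ) : UnitAddCircle) = t := by exact_mod_cast coe_add_int t 1
    simp only [hK, this]
  have h3 : ∀ b c, IntervalIntegrable K MeasureTheory.volume b c := fun b c => by
    refine hp.intervalIntegrable (t := -(1 / 2)) one_ne_zero ?_ b c
    rw [show -(1 / 2) + (1 : ℝ) = 1 / 2 by norm_num]
    exact h2.symm.trans h1
  have h4 := (h3 (0 - a) (1 - a)).comp_sub_right a
  simp only [sub_add_cancel] at h4
  refine h4.congr fun t _ => ?_
  simp only [hK, dist_eq_norm, AddCircle.coe_sub]

/-- The weight with poles at the points of `P`. -/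
noncomputable def poleWeight (P : Set UnitAddCircle) (x : UnitAddCircle) : ℝ :=
  logPole (Metric.infDist x P)

theorem infDist_le_one {P : Set UnitAddCircle} (hP : P.Nonempty) (x : UnitAddCircle) :
    Metric.infDist x P ≤ 1 := by
  obtain ⟨p, hp⟩ := hP
  refine (Metric.infDist_le_dist_of_mem hp).trans ?_
  rw [dist_eq_norm]
  refine (AddCircle.norm_le_half_period 1 one_ne_zero).trans ?_
  norm_num

theorem infDist_pos_of_notMem {P : Set UnitAddCircle} (hP : P.Nonempty) (hfin : P.Finite)
    {x : UnitAddCircle} (hx : x ∉ P) : 0 < Metric.infDist x P :=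
  (hfin.isClosed.notMem_iff_infDist_pos hP).1 hx

theorem isSingularWeight_poleWeight {P : Set UnitAddCircle} (hfin : P.Finite)
    (hP : P.Nonempty) : IsSingularWeight (poleWeight P) P where
  finite := hfin
  measurable := measurable_logPole.comp (Metric.continuous_infDist_pt P).measurable
  continuousOn := continuousOn_logPole.comp (Metric.continuous_infDist_pt P).continuousOn
    fun x hx => ⟨infDist_pos_of_notMem hP hfin hx, infDist_le_one hP x⟩
  intervalIntegrable := by
    have h1 : IntervalIntegrable (fun t : ℝ => ∑ p ∈ hfin.toFinset,
        Real.exp (logPole (dist (t : UnitAddCircle) p))) MeasureTheory.volume 0 1 := by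
      have := IntervalIntegrable.sum (μ := MeasureTheory.volume) (a := (0 : ℝ)) (b := 1)
        hfin.toFinset (f := fun p t => Real.exp (logPole (dist (t : UnitAddCircle) p)))
        fun p _ => intervalIntegrable_exp_logPole_dist p
      refine this.congr fun t _ => ?_
      simp
    refine h1.mono_fun (Real.measurable_exp.comp (measurable_logPole.comp
      ((Metric.continuous_infDist_pt P).comp (AddCircle.continuous_mk' 1)).measurable)
        ).aestronglyMeasurable (Filter.Eventually.of_forall fun t => ?_)
    obtain ⟨p, hp, he⟩ := hfin.isCompact.exists_infDist_eq_dist hP (t : UnitAddCircle)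
    change ‖Real.exp (logPole _)‖ ≤ ‖∑ p ∈ hfin.toFinset, _‖
    rw [he, Real.norm_eq_abs, Real.abs_exp, Real.norm_eq_abs]
    refine le_trans ?_ (le_abs_self _)
    exact Finset.single_le_sum (f := fun p => Real.exp (logPole (dist (t : UnitAddCircle) p)))
      (fun p _ => (Real.exp_pos _).le) (hfin.mem_toFinset.2 hp)

theorem eventually_infDist_eq {X : Type*} [MetricSpace X] {P : Set X} (hfin : P.Finite) {p : X}
    (hp : p ∈ P) : ∀ᶠ x in 𝓝 p, Metric.infDist x P = dist x p := by
  have h1 : (P \ {p})ᶜ ∈ 𝓝 p :=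
    (hfin.subset sdiff_subset).isClosed.isOpen_compl.mem_nhds (by simp)
  obtain ⟨r, hr, hball⟩ := Metric.mem_nhds_iff.1 h1
  filter_upwards [Metric.ball_mem_nhds p (half_pos hr)] with x hx
  refine le_antisymm (Metric.infDist_le_dist_of_mem hp) ?_
  refine (Metric.le_infDist ⟨p, hp⟩).2 fun q hq => ?_
  by_cases h : q = p
  · rw [h]
  · by_contra hlt
    push Not at hlt
    have h2 : q ∈ Metric.ball p r := by
      rw [Metric.mem_ball] at hx ⊢
      have := dist_triangle_left q p x
      linarith
    exact hball h2 ⟨hq, h⟩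

/-! ### Extension of the coboundary over the poles -/

namespace CircleDiff

theorem tendsto_log_dist_sub (f : CircleDiff) (p : UnitAddCircle) :
    Filter.Tendsto (fun x => Real.log (dist (f.1 x) (f.1 p)) - Real.log (dist x p)) (𝓝[≠] p)
      (𝓝 (logD f p)) := by
  obtain ⟨F, hF⟩ := f.2.1
  obtain ⟨t, rfl⟩ := isOpenQuotientMap_coe.surjective p
  have h1 : Filter.Tendsto (fun s => Real.log |slope F t s|) (𝓝[≠] t)
      (𝓝 (logD f (t : UnitAddCircle))) := by
    have h2 := hasDerivAt_iff_tendsto_slope.1 (hF.hasDerivAt t)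
    have h3 := deriv_lift_pos f hF t
    rw [logD_coe f hF]
    have h4 := (Real.continuousAt_log h3.ne').tendsto.comp h2
    refine h4.congr fun s => ?_
    simp [Real.log_abs]
  have h5 : ∀ᶠ s in 𝓝 t, |s - t| ≤ 1 / 2 ∧ |F s - F t| ≤ 1 / 2 := by
    refine Filter.Eventually.and ?_ ?_
    · filter_upwards [Metric.closedBall_mem_nhds t (by norm_num : (0 : ℝ) < 1 / 2)] with s hs
      exact hs
    · filter_upwards [hF.contDiff.continuous.continuousAt.preimage_mem_nhds
        (Metric.closedBall_mem_nhds (F t) (by norm_num : (0 : ℝ) < 1 / 2))] with s hs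
      exact hs
  intro U hU
  rw [Filter.mem_map, mem_nhdsWithin_iff_eventually, ← isOpenQuotientMap_coe.map_nhds_eq,
    Filter.eventually_map]
  have h6 := mem_nhdsWithin_iff_eventually.1 (h1 hU)
  filter_upwards [h5, h6] with s hs hs' hne
  have hst : s ≠ t := fun h => hne (by rw [h]; rfl)
  have h7 := hs' hst
  rw [mem_preimage] at h7 ⊢
  rw [hF.apply_coe, hF.apply_coe, dist_eq_norm, dist_eq_norm, ← AddCircle.coe_sub,
    ← AddCircle.coe_sub, norm_coe_of_abs_le hs.1, norm_coe_of_abs_le hs.2]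
  rw [slope_def_field, abs_div, Real.log_div] at h7
  · exact h7
  · exact abs_ne_zero.2 (sub_ne_zero.2 fun h => hst (hF.strictMono.injective h))
  · exact abs_ne_zero.2 (sub_ne_zero.2 hst)

end CircleDiff

/-- The term `-log r` yields `-κ`, whereas the correction `log (1 - log r)`, needed only for
integrability, varies too slowly to contribute: `(1 - log a) / (1 - log b)` tends to `1`. -/
theorem tendsto_logPole_sub {X : Type*} {l : Filter X} {a b : X → ℝ} {κ : ℝ}
    (hb : Filter.Tendsto (fun x => Real.log (b x)) l Filter.atBot)
    (h : Filter.Tendsto (fun x => Real.log (a x) - Real.log (b x)) l (𝓝 κ)) :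
    Filter.Tendsto (fun x => logPole (a x) - logPole (b x)) l (𝓝 (-κ)) := by
  have h1 : Filter.Tendsto (fun x => 1 - Real.log (b x)) l Filter.atTop := by
    have := Filter.tendsto_atTop_add_const_left l (1 : ℝ) (Filter.tendsto_neg_atBot_atTop.comp hb)
    refine this.congr fun x => ?_
    simp [sub_eq_add_neg]
  have h2 : Filter.Tendsto (fun x => (Real.log (a x) - Real.log (b x)) / (1 - Real.log (b x))) l
      (𝓝 0) := h.div_atTop h1
  have h3 : Filter.Tendsto
      (fun x => 1 - (Real.log (a x) - Real.log (b x)) / (1 - Real.log (b x))) l (𝓝 1) := by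
    simpa using h2.const_sub 1
  have h4 := (Real.continuousAt_log one_ne_zero).tendsto.comp h3
  rw [Real.log_one] at h4
  have h5 : Filter.Tendsto (fun x => -(Real.log (a x) - Real.log (b x)) - 2 *
      Real.log (1 - (Real.log (a x) - Real.log (b x)) / (1 - Real.log (b x)))) l (𝓝 (-κ)) := by
    simpa using h.neg.sub (h4.const_mul 2)
  refine h5.congr' ?_
  filter_upwards [h1.eventually (Filter.eventually_gt_atTop 0),
    h3.eventually (Ioi_mem_nhds one_pos)] with x hx hx'
  have h6 : Real.log (1 - Real.log (a x)) = Real.log (1 - Real.log (b x)) +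
      Real.log (1 - (Real.log (a x) - Real.log (b x)) / (1 - Real.log (b x))) := by
    rw [← Real.log_mul hx.ne' (mem_Ioi.1 hx').ne']
    congr 1
    field_simp
    ring
  rw [logPole, logPole, h6]
  ring

/-- Near a pole, the ratio of the distances to `P` after and before `f` tends to the derivative of
`f`, so the coboundary of the weight has limit `-logD f` there. -/
theorem exists_poleWeight_cocycle {P : Set UnitAddCircle} (hfin : P.Finite) (hP : P.Nonempty)
    (f : CircleDiff) (hf : ∀ x, f.1 x ∈ P ↔ x ∈ P) :
    ∃ β : C(UnitAddCircle, ℝ), (∀ x ∉ P, β x = poleWeight P (f.1 x) - poleWeight P x) ∧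
      ∀ x ∈ P, β x = -logD f x := by
  classical
  have hw := isSingularWeight_poleWeight hfin hP
  refine ⟨⟨fun x => if x ∈ P then -logD f x else poleWeight P (f.1 x) - poleWeight P x, ?_⟩,
    fun x hx => if_neg hx, fun x hx => if_pos hx⟩
  rw [continuous_iff_continuousAt]
  intro x
  by_cases hx : x ∈ P
  · rw [continuousAt_iff_punctured_nhds]
    simp only [hx, if_true]
    have h1 : ∀ᶠ y in 𝓝[≠] x, y ∉ P := by
      have h1 : (P \ {x})ᶜ ∈ 𝓝 x :=
        (hfin.subset sdiff_subset).isClosed.isOpen_compl.mem_nhds (by simp)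
      filter_upwards [mem_nhdsWithin_of_mem_nhds h1, self_mem_nhdsWithin] with y hy hy' hyP
      exact hy ⟨hyP, hy'⟩
    have h2 : ∀ᶠ y in 𝓝[≠] x, Metric.infDist y P = dist y x :=
      (eventually_infDist_eq hfin hx).filter_mono nhdsWithin_le_nhds
    have h3 : ∀ᶠ y in 𝓝[≠] x, Metric.infDist (f.1 y) P = dist (f.1 y) (f.1 x) :=
      (f.1.continuous.continuousAt.eventually
        (eventually_infDist_eq hfin ((hf x).2 hx))).filter_mono nhdsWithin_le_nhds
    have h4 : Filter.Tendsto (fun y => Real.log (dist y x)) (𝓝[≠] x) Filter.atBot := by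
      refine Real.tendsto_log_nhdsGT_zero.comp (tendsto_nhdsWithin_iff.2 ⟨?_, ?_⟩)
      · have : Filter.Tendsto (fun y => dist y x) (𝓝 x) (𝓝 (dist x x)) :=
          (continuous_id.dist continuous_const).tendsto x
        rw [dist_self] at this
        exact this.mono_left nhdsWithin_le_nhds
      · filter_upwards [self_mem_nhdsWithin] with y hy
        exact dist_pos.2 hy
    refine (tendsto_logPole_sub h4 (tendsto_log_dist_sub f x)).congr' ?_
    filter_upwards [h1, h2, h3] with y h1 h2 h3
    simp [h1, poleWeight, h2, h3]
  · have h1 : Pᶜ ∈ 𝓝 x := hfin.isClosed.isOpen_compl.mem_nhds hx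
    have h2 : ContinuousAt (poleWeight P) x := hw.continuousOn.continuousAt h1
    have h3 : ContinuousAt (poleWeight P) (f.1 x) := hw.continuousOn.continuousAt
      (hfin.isClosed.isOpen_compl.mem_nhds fun h => hx ((hf x).1 h))
    refine ((h3.comp f.1.continuous.continuousAt).sub h2).congr ?_
    filter_upwards [h1] with y hy
    simp [show y ∉ P from hy]

theorem infDist_neg {P : Set UnitAddCircle} (hP : ∀ x ∈ P, -x ∈ P) (x : UnitAddCircle) :
    Metric.infDist (-x) P = Metric.infDist x P := by
  have h : -P = P := by
    ext y
    refine ⟨fun hy => ?_, fun hy => hP y hy⟩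
    have := hP _ hy
    rwa [neg_neg] at this
  have h1 := Metric.infDist_image (Φ := fun y : UnitAddCircle => -y) (x := x) (t := P)
    (IsometryEquiv.neg UnitAddCircle).isometry
  rw [Set.image_neg_eq_neg, h] at h1
  exact h1

/-- For every finite invariant set, there is a weight which makes the multipliers trivial on it. -/
theorem exists_singularWeight {Γ : Type*} [Group Γ] (ρ : Γ →* CircleDiff) {P : Set UnitAddCircle}
    (hfin : P.Finite) (hP : ∀ g, ∀ x ∈ P, (ρ g).1 x ∈ P) :
    ∃ (θ : UnitAddCircle → ℝ) (β : Γ → C(UnitAddCircle, ℝ)), IsSingularWeight θ P ∧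
      (∀ g, ∀ x ∉ P, β g x = θ ((ρ g).1 x) - θ x) ∧ (∀ g, ∀ x ∈ P, β g x = -logD (ρ g) x) ∧
      ((∀ x ∈ P, -x ∈ P) → ∀ x, θ (-x) = θ x) := by
  rcases P.eq_empty_or_nonempty with rfl | hne
  · refine ⟨fun _ => 0, fun _ => 0, ⟨hfin, measurable_const, continuousOn_const, ?_⟩, ?_, ?_, ?_⟩
    · exact intervalIntegrable_const
    · simp
    · simp
    · simp
  · have hP' : ∀ g x, (ρ g).1 x ∈ P ↔ x ∈ P := fun g x => ⟨fun hx => by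
      have := hP g⁻¹ _ hx
      rwa [map_inv, inv_apply_apply] at this, hP g x⟩
    choose β hβ1 hβ2 using fun g => exists_poleWeight_cocycle hfin hne (ρ g) (hP' g)
    refine ⟨poleWeight P, β, isSingularWeight_poleWeight hfin hne, hβ1, hβ2, fun h x => ?_⟩
    rw [poleWeight, poleWeight, infDist_neg h]

/-! ### Deforming actions of nilpotent groups to actions by rotations -/

section Deform

variable {Γ : Type*} [Group Γ]

/-- The affine action on continuous functions given by the logarithms of the derivatives. -/
noncomputable def logDAction (ρ : Γ →* CircleDiff) :
    AffineContractionAction Γ C(UnitAddCircle, ℝ) where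
  π :=
    { toFun := fun g =>
        { toFun := fun φ => φ.comp (toMap (ρ g⁻¹))
          map_add' := fun _ _ => rfl
          map_smul' := fun _ _ => rfl }
      map_one' := by
        ext φ x
        change φ ((ρ 1⁻¹).1 x) = φ x
        simp
      map_mul' := fun g h => by
        ext φ x
        change φ ((ρ (g * h)⁻¹).1 x) = φ ((ρ h⁻¹).1 ((ρ g⁻¹).1 x))
        rw [mul_inv_rev, map_mul, coe_mul] }
  norm_π_le g φ := (ContinuousMap.norm_le _ (norm_nonneg _)).2 fun x => φ.norm_coe_le_norm _
  -- The inverses turn composition on the right into a left action.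
  b g := logD (ρ g⁻¹)
  b_mul g h := by
    ext x
    change logD (ρ (g * h)⁻¹) x = logD (ρ g⁻¹) x + logD (ρ h⁻¹) ((ρ g⁻¹).1 x)
    rw [mul_inv_rev, map_mul, logD_mul, add_comm]

theorem logDAction_disp (ρ : Γ →* CircleDiff) (g : Γ) (φ : C(UnitAddCircle, ℝ))
    (x : UnitAddCircle) :
    (logDAction ρ).disp g⁻¹ φ x = φ ((ρ g).1 x) + logD (ρ g) x - φ x := by
  change φ ((ρ g⁻¹⁻¹).1 x) + logD (ρ g⁻¹⁻¹) x - φ x = _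
  rw [inv_inv]

/-- The action commutes with the reflection `x ↦ -x`. -/
def IsOddAction (ρ : Γ →* CircleDiff) : Prop := ∀ g x, (ρ g).1 (-x) = -(ρ g).1 x

/-- The affine action of `logD` has small drifts. For an odd action, averaging the solution with its
reflection makes it even without worsening the bound. -/
theorem exists_almost_invariant [Group.IsNilpotent Γ] (ρ : Γ →* CircleDiff) (S : Finset Γ)
    {ε ε' : ℝ} (hS : ∀ g ∈ S, ∃ N : ℕ, 0 < N ∧ ‖logD (ρ g ^ N)‖ ≤ ε * N) (hε : ε < ε') :
    ∃ φ : C(UnitAddCircle, ℝ), (∀ g ∈ S, ∀ x, |φ ((ρ g).1 x) + logD (ρ g) x - φ x| ≤ ε') ∧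
      (IsOddAction ρ → ∀ x, φ (-x) = φ x) := by
  classical
  obtain ⟨φ, hφ⟩ := (logDAction ρ).exists_disp_le (S.image fun g => g⁻¹) (ε := ε) (fun g hg => by
    obtain ⟨k, hk, rfl⟩ := Finset.mem_image.1 hg
    obtain ⟨N, hN, h⟩ := hS k hk
    refine ⟨N, hN, ?_⟩
    change ‖logD (ρ (k⁻¹ ^ N)⁻¹)‖ ≤ _
    rwa [inv_pow, inv_inv, map_pow]) hε
  have hφ' : ∀ g ∈ S, ∀ x, |φ ((ρ g).1 x) + logD (ρ g) x - φ x| ≤ ε' := by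
    intro g hg x
    rw [← logDAction_disp]
    exact (((logDAction ρ).disp g⁻¹ φ).norm_coe_le_norm x).trans
      (hφ _ (Finset.mem_image_of_mem _ hg))
  by_cases hodd : IsOddAction ρ
  · refine ⟨(2⁻¹ : ℝ) • (φ + φ.comp ⟨fun x => -x, continuous_neg⟩), fun g hg x => ?_,
      fun _ x => ?_⟩
    · have h1 := hφ' g hg x
      have h2 := hφ' g hg (-x)
      rw [hodd g, logD_neg _ (hodd g)] at h2
      change |2⁻¹ * (φ ((ρ g).1 x) + φ (-(ρ g).1 x)) + logD (ρ g) x - 2⁻¹ * (φ x + φ (-x))| ≤ ε'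
      rw [abs_le] at *
      constructor <;> linarith
    · change 2⁻¹ * (φ (-x) + φ (- -x)) = 2⁻¹ * (φ x + φ (-x))
      rw [neg_neg, add_comm]
  · exact ⟨φ, hφ', fun h => absurd h hodd⟩

theorem IsOddAction.of_conj {ρ ρ' : Γ →* CircleDiff} (hρ : IsOddAction ρ)
    {h : UnitAddCircle ≃ₜ UnitAddCircle} (hh : ∀ x, h (-x) = -h x)
    (hconj : ∀ g x, (ρ' g).1 (h x) = h ((ρ g).1 x)) : IsOddAction ρ' := by
  intro g x
  obtain ⟨y, rfl⟩ := h.surjective x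
  rw [← hh, hconj, hconj, hρ g, hh]

/-- One step of the deformation: the logarithmic derivatives of finitely many elements become
small. -/
theorem exists_path_norm_logD_le [Group.IsNilpotent Γ] (ρ : ActionSpace Γ CircleDiff)
    (S : Finset Γ) {ε : ℝ} (hε : 0 < ε) :
    ∃ (ρ' : ActionSpace Γ CircleDiff) (γ : Path ρ ρ'),
      (∀ t g, rot ((γ t).toFun g) = rot (ρ.toFun g)) ∧
      (IsOddAction ρ → (∀ g, (ρ.toFun g).1 0 = 0) →
        ∀ t, IsOddAction (γ t) ∧ ∀ g, ((γ t).toFun g).1 0 = 0) ∧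
      (∀ g ∈ S, ‖logD (ρ'.toFun g)‖ ≤ ε) ∧
      ∀ t, ∀ g ∈ S, ‖logD ((γ t).toFun g)‖ ≤ max ‖logD (ρ.toFun g)‖ ε := by
  obtain ⟨ρ, rfl⟩ : ∃ ρ' : Γ →* CircleDiff, ρ' = ρ := ⟨ρ, rfl⟩
  obtain ⟨P, hfin, hPinv, hPper, hPodd⟩ := exists_finite_invariant ρ S (ε := ε / 6) (by positivity)
  obtain ⟨θ, β, hw, hβ, hβP, hθeven⟩ := exists_singularWeight ρ hfin hPinv
  obtain ⟨γ₁, h₁, -, -, hconj₁, hlog₁, -, -, hodd₁⟩ := hw.exists_conj_path ρ hPinv β hβ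
  set ρ₁ := γ₁ 1
  set h := h₁ 1
  have hconj : ∀ g x, (ρ₁ g).1 (h x) = h ((ρ g).1 x) := hconj₁ 1
  have hlog : ∀ g x, logD (ρ₁ g) (h x) = logD (ρ g) x + β g x := fun g x => by
    have := hlog₁ 1 g x
    simpa using this
  -- After conjugation exponents vanish on the image of `P`. At other periodic points the coboundary
  -- vanishes, so the exponent is the old one, which is small by the choice of `P`.
  have hdrift : ∀ g ∈ S, ∃ N : ℕ, 0 < N ∧ ‖logD (ρ₁ g ^ N)‖ ≤ 2 * (ε / 6) * N := by
    intro g hg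
    refine exists_norm_logD_pow_le (ρ₁ g) (by positivity) fun q hq p hp => ?_
    have hq' : 0 < ε / 6 * q := by positivity
    obtain ⟨x, rfl⟩ := h.surjective p
    rw [← map_pow] at hp ⊢
    rw [hconj] at hp
    have hx := h.injective hp
    rw [hlog]
    by_cases hxP : x ∈ P
    · rw [hβP _ _ hxP, add_neg_cancel, abs_zero]
      exact hq'
    · rw [hβ _ _ hxP, hx, sub_self, add_zero]
      by_contra hle
      push Not at hle
      rw [map_pow] at hle hx
      exact hxP (hPper g hg q hq x hx hle)
  obtain ⟨φ, hφ, hφeven⟩ := exists_almost_invariant ρ₁ S hdrift (by linarith : 2 * (ε / 6) < ε)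
  have hφh : Continuous fun x => φ (h x) := φ.continuous.comp h.continuous
  -- Both conjugations are merged into one weight on the original circle, so that `logD` varies
  -- affinely along a single path. Following the path of `θ` alone gives no bound on `logD`.
  have hw' : IsSingularWeight (fun x => θ x + φ (h x)) P :=
    { finite := hfin
      measurable := hw.measurable.add hφh.measurable
      continuousOn := hw.continuousOn.add hφh.continuousOn
      intervalIntegrable := by
        have h1 : Continuous fun t : ℝ => Real.exp (φ (h (t : UnitAddCircle))) :=
          Real.continuous_exp.comp (hφh.comp (AddCircle.continuous_mk' 1))
        refine (hw.intervalIntegrable.mul_continuousOn h1.continuousOn).congr fun t _ => ?_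
        simp only [Real.exp_add] }
  let β' : Γ → C(UnitAddCircle, ℝ) := fun g =>
    β g + (φ.comp ⟨h, h.continuous⟩).comp (toMap (ρ g)) - φ.comp ⟨h, h.continuous⟩
  have hβ'apply : ∀ g x, β' g x = β g x + φ (h ((ρ g).1 x)) - φ (h x) := fun _ _ => rfl
  obtain ⟨γ, k, hγc, hγ0, hconjk, hlogk, hrotk, hk0, hoddk⟩ :=
    hw'.exists_conj_path ρ hPinv β' fun g x hx => by
      rw [hβ'apply, hβ g x hx]
      ring
  have hbound : ∀ g ∈ S, ∀ x, |logD (ρ g) x + β' g x| ≤ ε := by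
    intro g hg x
    have h1 := hφ g hg (h x)
    rw [hconj, hlog] at h1
    rw [hβ'apply]
    convert h1 using 2
    ring
  refine ⟨γ 1, ⟨⟨γ, hγc⟩, hγ0, rfl⟩, fun t g => hrotk t g, fun hodd h0 t => ⟨?_, fun g => ?_⟩,
    fun g hg => ?_, fun t g hg => ?_⟩
  · refine hodd.of_conj (h := k t) (hoddk (fun x => ?_) t) (hconjk t)
    have hθ := hθeven (hPodd hodd)
    have hh := hodd₁ hθ 1
    rw [hθ x]
    have h2 : φ (h (-x)) = φ (h x) := by
      rw [hh, hφeven (hodd.of_conj hh hconj)]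
    rw [h2]
  · have := hconjk t g 0
    rw [hk0] at this
    change (γ t g).1 0 = 0
    rw [this]
    have h3 : (ρ g).1 0 = 0 := h0 g
    rw [h3, hk0]
  · refine (ContinuousMap.norm_le _ hε.le).2 fun y => ?_
    obtain ⟨x, rfl⟩ := (k 1).surjective y
    change |logD (γ 1 g) (k 1 x)| ≤ ε
    rw [hlogk]
    simpa using hbound g hg x
  · refine (ContinuousMap.norm_le _ (le_max_of_le_right hε.le)).2 fun y => ?_
    obtain ⟨x, rfl⟩ := (k t).surjective y
    change |logD (γ t g) (k t x)| ≤ max ‖logD (ρ g)‖ ε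
    rw [hlogk]
    have h1 : logD (ρ g) x + t * β' g x
        = (1 - t) * logD (ρ g) x + t * (logD (ρ g) x + β' g x) := by ring
    rw [h1]
    have h2 : |logD (ρ g) x| ≤ max ‖logD (ρ g)‖ ε :=
      ((logD (ρ g)).norm_coe_le_norm x).trans (le_max_left _ _)
    have h3 := (hbound g hg x).trans (le_max_right ‖logD (ρ g)‖ ε)
    refine (abs_add_le _ _).trans ?_
    rw [abs_mul, abs_mul, abs_of_nonneg (sub_nonneg.2 t.2.2), abs_of_nonneg t.2.1]
    have h4 := mul_le_mul_of_nonneg_left h2 (sub_nonneg.2 t.2.2)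
    have h5 := mul_le_mul_of_nonneg_left h3 t.2.1
    linarith

/-- The action by rotations with given angles. -/
def rotationAction (α : Γ →* Multiplicative UnitAddCircle) : ActionSpace Γ CircleDiff where
  toFun g := circleRotation (α g).toAdd
  map_one' := CircleDiff.ext' fun x => by
    change (α 1).toAdd + x = x
    simp
  map_mul' g h := CircleDiff.ext' fun x => by
    change (α (g * h)).toAdd + x = (α g).toAdd + ((α h).toAdd + x)
    simp [add_assoc]

theorem rot_eq_zero_of_fixed (f : CircleDiff) (hf : f.1 0 = 0) : rot f = 0 := by
  obtain ⟨F, hF⟩ := f.2.1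
  have h1 := hF.apply_coe 0
  rw [AddCircle.coe_zero, hf, eq_comm, AddCircle.coe_eq_zero_iff] at h1
  obtain ⟨n, hn⟩ := h1
  simp only [zsmul_eq_mul, mul_one] at hn
  rw [rot_eq f hF, CircleDeg1Lift.translationNumber_of_eq_add_int (x := 0) (m := n)]
  · rw [← zero_add (n : ℝ), coe_add_int, AddCircle.coe_zero]
  · change F 0 = 0 + n
    rw [hn, zero_add]

/-- Each of the three maps is within `exp δ - 1` of its rotation, and rotations compose additively.
-/
theorem dist_rot_mul_le (f g : CircleDiff) {δ : ℝ} (hf : ‖logD f‖ ≤ δ) (hg : ‖logD g‖ ≤ δ)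
    (hfg : ‖logD (f * g)‖ ≤ δ) : dist (rot (f * g)) (rot f + rot g) ≤ 3 * (Real.exp δ - 1) := by
  have h1 := dist_apply_le _ hfg 0
  have h2 := dist_apply_le _ hf (g.1 0)
  have h3 := dist_apply_le _ hg 0
  rw [add_zero] at h1 h3
  rw [coe_mul] at h1
  have h4 : dist (rot f + g.1 0) (rot f + rot g) ≤ Real.exp δ - 1 := by rwa [dist_add_left]
  have h5 := dist_triangle (rot (f * g)) (f.1 (g.1 0)) (rot f + rot g)
  have h6 := dist_triangle (f.1 (g.1 0)) (rot f + g.1 0) (rot f + rot g)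
  rw [dist_comm] at h1
  linarith

/-- Every action of a finitely generated nilpotent group is joined to an action by rotations. -/
theorem exists_joinedIn_rotationAction [Group.FG Γ] [Group.IsNilpotent Γ]
    (ρ : ActionSpace Γ CircleDiff) :
    ∃ α : Γ →* Multiplicative UnitAddCircle,
      (∀ g, (α g).toAdd = rot (ρ.toFun g)) ∧
      JoinedIn {ρ' : ActionSpace Γ CircleDiff | IsOddAction ρ → (∀ g, (ρ.toFun g).1 0 = 0) →
        IsOddAction ρ' ∧ ∀ g, (ρ'.toFun g).1 0 = 0} ρ (rotationAction α) := by
  obtain ⟨S, hS⟩ := Group.fg_def.1 ‹Group.FG Γ›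
  choose next γ hrot hodd hend hbd using fun (r : ActionSpace Γ CircleDiff) (n : ℕ) =>
    exists_path_norm_logD_le r S (Nat.one_div_pos_of_nat (α := ℝ) (n := n))
  obtain ⟨x, hx0, hx⟩ : ∃ x : ℕ → ActionSpace Γ CircleDiff, x 0 = ρ ∧
      ∀ n, x (n + 1) = next (x n) n := ⟨fun n => Nat.rec ρ (fun n r => next r n) n, rfl, fun _ => rfl⟩
  let δ : ℕ → I → ActionSpace Γ CircleDiff := fun n t => γ (x n) n t
  have hrotx : ∀ n g, rot ((x n).toFun g) = rot (ρ.toFun g) := by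
    intro n g
    induction n with
    | zero => rw [hx0]
    | succ n ih =>
      have := hrot (x n) n 1 g
      rw [Path.target, ← hx] at this
      exact this.trans ih
  have hrotδ : ∀ (n : ℕ) (t : I) g, rot ((δ n t).toFun g) = rot (ρ.toFun g) := fun n t g =>
    (hrot (x n) n t g).trans (hrotx n g)
  have hoddx : IsOddAction ρ → (∀ g, (ρ.toFun g).1 0 = 0) → ∀ n, IsOddAction (x n) ∧
      ∀ g, ((x n).toFun g).1 0 = 0 := by
    intro h h0 n
    induction n with
    | zero => rw [hx0]; exact ⟨h, h0⟩
    | succ n ih =>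
      have := hodd (x n) n ih.1 ih.2 1
      rwa [Path.target, ← hx] at this
  -- The index is shifted because the initial segment starts at `ρ`, where nothing is small;
  -- afterwards each segment starts at the bound reached by the previous one.
  have hsmallS : ∀ g ∈ S, ∀ (n : ℕ) (t : I), ‖logD ((δ (n + 1) t).toFun g)‖ ≤ 1 / ((n : ℝ) + 1) := by
    intro g hg n t
    refine (hbd (x (n + 1)) (n + 1) t g hg).trans (max_le (hx n ▸ hend (x n) n g hg) ?_)
    exact one_div_le_one_div_of_le (by positivity) (by push_cast; linarith)
  have hsmall : ∀ g, ∀ η > 0, ∀ᶠ n : ℕ in Filter.atTop, ∀ t : I, ‖logD ((δ n t).toFun g)‖ ≤ η := by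
    intro g
    have hg : g ∈ Subgroup.closure (S : Set Γ) := by rw [hS]; exact Subgroup.mem_top g
    induction hg using Subgroup.closure_induction with
    | mem g hg =>
      intro η hη
      obtain ⟨N, hN⟩ := exists_nat_one_div_lt hη
      filter_upwards [Filter.eventually_ge_atTop (N + 1)] with n hn t
      obtain ⟨m, rfl⟩ : ∃ m, n = m + 1 := ⟨n - 1, by omega⟩
      refine (hsmallS g hg m t).trans (le_trans ?_ hN.le)
      have : (N : ℝ) ≤ m := by exact_mod_cast (by omega : N ≤ m)
      exact one_div_le_one_div_of_le (by positivity) (by linarith)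
    | one =>
      intro η hη
      refine Filter.Eventually.of_forall fun n t => ?_
      have : (δ n t).toFun 1 = 1 := (δ n t).map_one'
      rw [this, norm_logD_one]
      exact hη.le
    | mul g h _ _ hg hh =>
      intro η hη
      filter_upwards [hg (η / 2) (by positivity), hh (η / 2) (by positivity)] with n h1 h2 t
      have : (δ n t).toFun (g * h) = (δ n t).toFun g * (δ n t).toFun h := (δ n t).map_mul' g h
      rw [this]
      refine (norm_logD_mul_le _ _).trans ?_
      linarith [h1 t, h2 t]
    | inv g _ hg =>
      intro η hη
      filter_upwards [hg η hη] with n h1 t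
      have : (δ n t).toFun g⁻¹ = ((δ n t).toFun g)⁻¹ := MonoidHom.map_inv (δ n t) g
      rw [this, norm_logD_inv]
      exact h1 t
  -- Rotation numbers do not change along the path, while the actions become arbitrarily close to
  -- rotations, where they are additive.
  have hmul : ∀ g h, rot (ρ.toFun (g * h)) = rot (ρ.toFun g) + rot (ρ.toFun h) := by
    intro g h
    have h1 : Filter.Tendsto (fun η : ℝ => 3 * (Real.exp η - 1)) (𝓝[>] 0) (𝓝 0) := by
      have : Filter.Tendsto (fun η : ℝ => 3 * (Real.exp η - 1)) (𝓝 0)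
          (𝓝 (3 * (Real.exp 0 - 1))) :=
        (continuous_const.mul (Real.continuous_exp.sub continuous_const)).tendsto 0
      rw [Real.exp_zero, sub_self, mul_zero] at this
      exact this.mono_left nhdsWithin_le_nhds
    refine dist_le_zero.1 (ge_of_tendsto h1 ?_)
    filter_upwards [self_mem_nhdsWithin] with η hη
    obtain ⟨n, ⟨h2, h3⟩, h4⟩ := (((hsmall g η hη).and (hsmall h η hη)).and
      (hsmall (g * h) η hη)).exists
    rw [← hrotδ n 0 g, ← hrotδ n 0 h, ← hrotδ n 0 (g * h)]
    have h5 : (δ n 0).toFun (g * h) = (δ n 0).toFun g * (δ n 0).toFun h := (δ n 0).map_mul' g h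
    have h4' := h4 0
    rw [h5] at h4' ⊢
    exact dist_rot_mul_le _ _ (h2 0) (h3 0) h4'
  let α : Γ →* Multiplicative UnitAddCircle :=
    MonoidHom.mk' (fun g => Multiplicative.ofAdd (rot (ρ.toFun g))) fun g h => by
      rw [hmul, ofAdd_add]
  have hα : ∀ g, (α g).toAdd = rot (ρ.toFun g) := fun _ => rfl
  have key : JoinedIn (X := ActionSpace Γ CircleDiff) {ρ' | IsOddAction ρ → (∀ g, (ρ.toFun g).1 0 = 0) →
      IsOddAction ρ' ∧ ∀ g, (ρ'.toFun g).1 0 = 0} (x 0) (rotationAction α) := by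
    refine joinedIn_of_forall_path (X := ActionSpace Γ CircleDiff) (x := x) ?_
      (fun n => (γ (x n) n).cast rfl (hx n)) (fun n t h h0 => ?_) fun U hU => ?_
    · intro h h0
      have h1 : ∀ g x, ((rotationAction α).toFun g).1 x = x := fun g x => by
        change (α g).toAdd + x = x
        rw [hα, rot_eq_zero_of_fixed _ (h0 g), zero_add]
      refine ⟨fun g x => ?_, fun g => h1 g 0⟩
      change ((rotationAction α).toFun g).1 (-x) = -((rotationAction α).toFun g).1 x
      rw [h1, h1]
    · exact hodd (x n) n (hoddx h h0 n).1 (hoddx h h0 n).2 t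
    · rw [nhds_induced, Filter.mem_comap] at hU
      obtain ⟨V, hV, hVU⟩ := hU
      rw [nhds_pi, Filter.mem_pi] at hV
      obtain ⟨J, hJ, W, hW, hWV⟩ := hV
      have h1 : ∀ g ∈ J, ∀ᶠ n : ℕ in Filter.atTop, ∀ t : I, (δ n t).toFun g ∈ W g := by
        intro g _
        obtain ⟨η, hη, h2⟩ := eventually_mem_of_norm_logD_le
          (show W g ∈ 𝓝 (circleRotation (α g).toAdd) from hW g)
        filter_upwards [hsmall g η hη] with n hn t
        exact h2 _ (hn t) (hrotδ n t g)
      filter_upwards [(Filter.eventually_all_finite hJ).2 h1] with n hn t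
      exact hVU (hWV fun g hg => hn g hg t)
  rw [hx0] at key
  exact ⟨α, hα, key⟩

end Deform

/-! ### Paths of actions by rotations -/

section Rotations

variable {Γ : Type*} [Group Γ]

theorem continuous_circleRotation : Continuous circleRotation := by
  refine isOpenQuotientMap_coe.isQuotientMap.continuous_iff.2 ?_
  have hd : ∀ s : ℝ, _root_.deriv (fun t : ℝ => s + t) = fun _ => 1 := fun s => by
    funext t
    simp
  refine continuous_of_lift (F := fun s t => s + t) (fun s => ?_) (by fun_prop) ?_
  · exact ⟨contDiff_const.add contDiff_id, fun _ _ h => by simpa using h, fun t => by ring,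
      fun t => rfl⟩
  · simp only [hd]
    exact continuous_const

/-- The product of an action by rotations and an action by rotations whose angles lift to the line
can be deformed by shrinking the angles of the latter. -/
theorem joined_rotationAction_mul (ℓ : Γ →* Multiplicative ℝ)
    (τ α : Γ →* Multiplicative UnitAddCircle)
    (h : ∀ g, (α g).toAdd = ((ℓ g).toAdd : UnitAddCircle) + (τ g).toAdd) :
    Joined (rotationAction α) (rotationAction τ) := by
  let β : ℝ → Γ →* Multiplicative UnitAddCircle := fun s =>
    MonoidHom.mk' (fun g => Multiplicative.ofAdd (((s * (ℓ g).toAdd : ℝ) : UnitAddCircle) +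
      (τ g).toAdd)) fun g g' => by
        rw [← ofAdd_add, map_mul ℓ, map_mul τ, toAdd_mul, toAdd_mul, mul_add, AddCircle.coe_add]
        congr 1
        abel
  have hβ : ∀ s g, (β s g).toAdd = ((s * (ℓ g).toAdd : ℝ) : UnitAddCircle) + (τ g).toAdd :=
    fun _ _ => rfl
  refine ⟨⟨⟨fun s => rotationAction (β (1 - s)), ?_⟩, ?_, ?_⟩⟩
  · refine continuous_induced_rng.2 (continuous_pi fun g => ?_)
    change Continuous fun s : I => circleRotation (β (1 - s) g).toAdd
    simp only [hβ]
    have h1 : Continuous fun s : I => (((1 - s : ℝ) * (ℓ g).toAdd : ℝ) : UnitAddCircle) :=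
      (AddCircle.continuous_mk' 1).comp (by fun_prop)
    exact continuous_circleRotation.comp (h1.add continuous_const)
  · change rotationAction (β (1 - ((0 : I) : ℝ))) = rotationAction α
    congr 1
    ext g
    apply Multiplicative.toAdd.injective
    rw [hβ, h]
    simp
  · change rotationAction (β (1 - ((1 : I) : ℝ))) = rotationAction τ
    congr 1
    ext g
    apply Multiplicative.toAdd.injective
    rw [hβ]
    simp

/-- Angles of a basis can be lifted to `ℝ` independently, so the whole homomorphism lifts and
shrinks to `0`. -/
theorem joined_rotationAction_one (d : ℕ)
    (α : Multiplicative (Fin d → ℤ) →* Multiplicative UnitAddCircle) :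
    Joined (rotationAction α) (rotationAction 1) := by
  choose c hc using fun i : Fin d => isOpenQuotientMap_coe.surjective
    (α (Multiplicative.ofAdd (Pi.single i 1))).toAdd
  let ℓ : (Fin d → ℤ) →+ ℝ := ∑ i, (AddMonoidHom.mulRight (c i)).comp
    ((Int.castAddHom ℝ).comp (Pi.evalAddMonoidHom (fun _ : Fin d => ℤ) i))
  have hℓ : (AddMonoidHom.toMultiplicative.symm α) = (QuotientAddGroup.mk' _).comp ℓ := by
    refine AddMonoidHom.functions_ext' _ _ _ fun i => ?_
    ext
    simp only [AddMonoidHom.comp_apply]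
    refine (hc i).symm.trans ?_
    change _ = ((ℓ (Pi.single i 1) : ℝ) : UnitAddCircle)
    congr 1
    simp [ℓ, Pi.single_apply]
  refine joined_rotationAction_mul (AddMonoidHom.toMultiplicative ℓ) 1 α fun g => ?_
  have := DFunLike.congr_fun hℓ g.toAdd
  simpa using this

/-- A homomorphism from a free abelian group to the circle lifts to the line. -/
theorem exists_real_lift {ι : Type*} (f : (ι →₀ ℤ) →+ UnitAddCircle) :
    ∃ L : (ι →₀ ℤ) →+ ℝ, ∀ x, (L x : UnitAddCircle) = f x := by
  choose c hc using fun i => isOpenQuotientMap_coe.surjective (f (Finsupp.single i 1))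
  let L : (ι →₀ ℤ) →+ ℝ := Finsupp.liftAddHom fun i =>
    (AddMonoidHom.mulRight (c i)).comp (Int.castAddHom ℝ)
  refine ⟨L, DFunLike.congr_fun (f := (QuotientAddGroup.mk' _).comp L) (g := f) ?_⟩
  ext i
  change ((L (Finsupp.single i 1) : ℝ) : UnitAddCircle) = f (Finsupp.single i 1)
  rw [← hc]
  congr 1
  simp [L]

/-- Every action of a finitely generated group by rotations can be deformed to an action by a finite
group of rotations. -/
theorem exists_joined_rotationAction_finite [Group.FG Γ] (α : Γ →* Multiplicative UnitAddCircle) :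
    ∃ τ : Γ →* Multiplicative UnitAddCircle, (range τ).Finite ∧
      Joined (rotationAction α) (rotationAction τ) := by
  -- The image is a finitely generated abelian group. Its free part lifts to the line and is shrunk
  -- away; the torsion part remains and has finite image.
  obtain ⟨n, ι, _, p, hp, k, ⟨e⟩⟩ :=
    AddCommGroup.equiv_free_prod_directSum_zmod (Additive α.range)
  have : ∀ i, NeZero (p i ^ k i) := fun i => ⟨pow_ne_zero _ (hp i).ne_zero⟩
  have hfin : Finite (DirectSum ι fun i => ZMod (p i ^ k i)) :=
    Finite.of_equiv _ DFinsupp.equivFunOnFintype.symm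
  let q : Additive α.range →+ UnitAddCircle := AddMonoidHom.toMultiplicativeRight.symm α.range.subtype
  let v : Γ →* Multiplicative ((Fin n →₀ ℤ) × DirectSum ι fun i => ZMod (p i ^ k i)) :=
    (AddMonoidHom.toMultiplicativeRight e.toAddMonoidHom).comp α.rangeRestrict
  obtain ⟨L, hL⟩ := exists_real_lift ((q.comp e.symm.toAddMonoidHom).comp (AddMonoidHom.inl _ _))
  let T : ((Fin n →₀ ℤ) × DirectSum ι fun i => ZMod (p i ^ k i)) →+ UnitAddCircle :=
    (q.comp e.symm.toAddMonoidHom).comp ((AddMonoidHom.inr _ _).comp (AddMonoidHom.snd _ _))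
  refine ⟨(AddMonoidHom.toMultiplicative T).comp v, ?_, joined_rotationAction_mul
    ((AddMonoidHom.toMultiplicative (L.comp (AddMonoidHom.fst _ _))).comp v) _ α fun g => ?_⟩
  · refine (finite_range fun t => Multiplicative.ofAdd (q (e.symm (0, t)))).subset ?_
    rintro _ ⟨g, rfl⟩
    exact ⟨_, rfl⟩
  · change (α g).toAdd = ((L (v g).toAdd.1 : ℝ) : UnitAddCircle) + T (v g).toAdd
    rw [hL]
    change _ = q (e.symm ((v g).toAdd.1, 0)) + q (e.symm (0, (v g).toAdd.2))
    rw [← map_add, ← map_add, Prod.mk_add_mk, add_zero, zero_add]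
    change _ = q (e.symm (e (Additive.ofMul (α.rangeRestrict g))))
    rw [e.symm_apply_apply]
    rfl

theorem factorsThroughFiniteRotations_rotationAction (τ : Γ →* Multiplicative UnitAddCircle)
    (hτ : (range τ).Finite) : FactorsThroughFiniteRotations (rotationAction τ) := by
  let ρ : Γ →* CircleDiff := rotationAction τ
  refine ⟨ρ.range, ?_, ?_, ρ.rangeRestrict, ρ.rangeRestrict_surjective, ?_⟩
  · rw [MonoidHom.coe_range]
    refine (hτ.image fun a => circleRotation a.toAdd).subset ?_
    rintro _ ⟨g, rfl⟩
    exact ⟨_, mem_range_self g, rfl⟩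
  · rintro _ ⟨g, rfl⟩
    exact ⟨_, rfl⟩
  · rfl

end Rotations

/-! ### Odd circle diffeomorphisms and interval diffeomorphisms -/

/-- The circle diffeomorphisms which commute with the reflection `x ↦ -x` and fix `0`. -/
def OddCircleDiff : Subgroup CircleDiff where
  carrier := {f | f.1 0 = 0 ∧ ∀ x, f.1 (-x) = -f.1 x}
  one_mem' := ⟨rfl, fun _ => rfl⟩
  mul_mem' := by
    rintro f g ⟨hf, hf'⟩ ⟨hg, hg'⟩
    exact ⟨by rw [coe_mul, hg, hf], fun x => by rw [coe_mul, hg', hf', coe_mul]⟩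
  inv_mem' := by
    rintro f ⟨hf, hf'⟩
    refine ⟨?_, fun x => f.1.injective ?_⟩
    · conv_lhs => rw [← hf, inv_apply_apply]
    · rw [apply_inv_apply, hf', apply_inv_apply]

namespace OddCircleDiff

theorem exists_lift (f : OddCircleDiff) : ∃ F, IsC1Lift F (fun x => f.1.1 x) ∧ F 0 = 0 := by
  obtain ⟨F, hF⟩ := f.1.2.1
  have h1 := hF.apply_coe 0
  rw [AddCircle.coe_zero, f.2.1, eq_comm, AddCircle.coe_eq_zero_iff] at h1
  obtain ⟨n, hn⟩ := h1
  refine ⟨_, hF.add_int (-n), ?_⟩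
  simp only [← hn]
  simp

/-- The lift which fixes `0`. -/
noncomputable def lift (f : OddCircleDiff) : ℝ → ℝ := (exists_lift f).choose

theorem isC1Lift (f : OddCircleDiff) : IsC1Lift (lift f) fun x => f.1.1 x :=
  (exists_lift f).choose_spec.1

@[simp] theorem lift_zero (f : OddCircleDiff) : lift f 0 = 0 := (exists_lift f).choose_spec.2

theorem lift_eq (f : OddCircleDiff) {F : ℝ → ℝ} (hF : IsC1Lift F fun x => f.1.1 x)
    (h0 : F 0 = 0) : lift f = F := by
  obtain ⟨n, hn⟩ := (isC1Lift f).exists_int hF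
  have h1 := hn 0
  rw [lift_zero, h0, zero_add] at h1
  funext t
  rw [hn, ← h1, add_zero]

theorem lift_mul (f g : OddCircleDiff) (t : ℝ) : lift (f * g) t = lift f (lift g t) :=
  congrFun (lift_eq (f * g) ((isC1Lift f).comp (isC1Lift g)) (by simp)) t

@[simp] theorem lift_one (t : ℝ) : lift 1 t = t := congrFun (lift_eq 1 IsC1Lift.id rfl) t

theorem lift_neg (f : OddCircleDiff) (t : ℝ) : lift f (-t) = -lift f t := by
  have hc := (isC1Lift f).contDiff.continuous
  obtain ⟨n, hn⟩ := exists_int_of_coe_eq (hc.comp continuous_neg) hc.neg fun t => by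
    change (lift f (-t) : UnitAddCircle) = ((-lift f t : ℝ) : UnitAddCircle)
    rw [AddCircle.coe_neg, ← (isC1Lift f).apply_coe, ← (isC1Lift f).apply_coe, AddCircle.coe_neg,
      f.2.2]
  have h1 : lift f (-0) = -lift f 0 + n := hn 0
  have h2 : lift f (-t) = -lift f t + n := hn t
  rw [neg_zero, lift_zero] at h1
  linarith

/-- The points `1 / 2` and `-1 / 2` coincide on the circle, so oddness fixes the second end of the
half circle. -/
theorem lift_half (f : OddCircleDiff) : lift f (1 / 2) = 1 / 2 := by
  have h1 := (isC1Lift f).map_add_one (-(1 / 2))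
  rw [lift_neg, show -(1 / 2 : ℝ) + 1 = 1 / 2 by norm_num] at h1
  linarith

theorem two_mul_lift_mem (f : OddCircleDiff) (t : I) : 2 * lift f (t / 2) ∈ Icc (0 : ℝ) 1 := by
  have h1 := (isC1Lift f).strictMono.monotone (div_nonneg t.2.1 zero_le_two)
  have h2 := (isC1Lift f).strictMono.monotone (div_le_div_of_nonneg_right t.2.2 zero_le_two)
  rw [lift_zero] at h1
  rw [lift_half] at h2
  constructor <;> linarith

/-- The action on the upper half of the circle, identified with `[0,1]`. -/
noncomputable def foldMap (f : OddCircleDiff) (t : I) : I := ⟨2 * lift f (t / 2), two_mul_lift_mem f t⟩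

theorem foldMap_mul (f g : OddCircleDiff) (t : I) : foldMap (f * g) t = foldMap f (foldMap g t) := by
  refine Subtype.ext ?_
  change 2 * lift (f * g) (t / 2) = 2 * lift f (2 * lift g (t / 2) / 2)
  rw [lift_mul, mul_div_cancel_left₀ _ two_ne_zero]

theorem foldMap_one (t : I) : foldMap 1 t = t := by
  refine Subtype.ext ?_
  change 2 * lift 1 (t / 2) = t
  rw [lift_one, mul_div_cancel₀ _ two_ne_zero]

theorem intervalExt_foldMap (f : OddCircleDiff) :
    EqOn (intervalExt (foldMap f)) (fun t => 2 * lift f (t / 2)) (Icc 0 1) := fun t ht => by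
  simp only [intervalExt, projIcc_of_mem _ ht]
  rfl

theorem hasDerivAt_two_mul_lift (f : OddCircleDiff) (t : ℝ) :
    HasDerivAt (fun t => 2 * lift f (t / 2)) (_root_.deriv (lift f) (t / 2)) t := by
  have := (((isC1Lift f).hasDerivAt (t / 2)).comp t ((hasDerivAt_id t).div_const 2)).const_mul 2
  exact this.congr_deriv (by ring)

theorem isC1Interval_foldMap (f : OddCircleDiff) : IsC1Interval (foldMap f) :=
  (contDiff_const.mul ((isC1Lift f).contDiff.comp (contDiff_id.div_const 2))).contDiffOn.congr
    (intervalExt_foldMap f)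

/-- Odd circle diffeomorphisms act on the upper half of the circle. -/
noncomputable def fold : OddCircleDiff →* IntervalDiff where
  toFun f := ⟨{
    toFun := foldMap f
    invFun := foldMap f⁻¹
    left_inv := fun t => by rw [← foldMap_mul, inv_mul_cancel, foldMap_one]
    right_inv := fun t => by rw [← foldMap_mul, mul_inv_cancel, foldMap_one]
    map_rel_iff' := by
      intro s t
      change 2 * lift f (s / 2) ≤ 2 * lift f (t / 2) ↔ s ≤ t
      rw [mul_le_mul_iff_right₀ two_pos, (isC1Lift f).strictMono.le_iff_le,
        div_le_div_iff_of_pos_right two_pos]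
      rfl }, isC1Interval_foldMap f, isC1Interval_foldMap f⁻¹⟩
  map_one' := Subtype.ext (OrderIso.ext (funext foldMap_one))
  map_mul' f g := Subtype.ext (OrderIso.ext (funext (foldMap_mul f g)))

theorem fold_injective : Function.Injective fold := by
  intro f g h
  have h1 : ∀ t : ℝ, 0 ≤ t → t ≤ 1 / 2 → lift f t = lift g t := by
    intro t h0 h1
    have h2 : foldMap f ⟨2 * t, by constructor <;> linarith⟩
        = foldMap g ⟨2 * t, by constructor <;> linarith⟩ :=
      congrArg (fun k : IntervalDiff => k.1 _) h
    have h3 := congrArg Subtype.val h2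
    simpa [foldMap] using h3
  have h2 : ∀ t : ℝ, |t| ≤ 1 / 2 → lift f t = lift g t := by
    intro t ht
    rw [abs_le] at ht
    rcases le_total 0 t with h0 | h0
    · exact h1 t h0 ht.2
    · have := h1 (-t) (by linarith) (by linarith)
      rwa [lift_neg, lift_neg, neg_inj] at this
  refine Subtype.ext (CircleDiff.ext' fun x => ?_)
  obtain ⟨t, rfl⟩ := isOpenQuotientMap_coe.surjective x
  have h3 : ((t - round t : ℝ) : UnitAddCircle) = t := by
    have := coe_add_int (t - round t) (round t)
    rw [← this, sub_add_cancel]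
  rw [← h3]
  exact ((isC1Lift f).apply_coe _).trans
    ((congrArg _ (h2 _ (abs_sub_round t))).trans ((isC1Lift g).apply_coe _).symm)

/-- On the upper half circle the lift equals the norm on `ℝ/ℤ`, so the folded map is expressed by
the circle map itself and no continuity of the chosen lift is needed. -/
theorem continuous_fold : Continuous fold := by
  have hm' : Continuous fun f : CircleDiff => (CircleDiff.toMap f, CircleDiff.deriv f) :=
    continuous_induced_dom
  have hm : Continuous fun f : OddCircleDiff => (CircleDiff.toMap f.1, CircleDiff.deriv f.1) :=
    hm'.comp continuous_subtype_val
  have hc : Continuous fun p : OddCircleDiff × I => ((p.2 / 2 : ℝ) : UnitAddCircle) :=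
    (AddCircle.continuous_mk' 1).comp (by fun_prop)
  refine continuous_induced_rng.2 (Continuous.prodMk ?_ ?_)
  · refine ContinuousMap.continuous_of_continuous_uncurry _ (continuous_induced_rng.2 ?_)
    have h1 : Continuous fun p : OddCircleDiff × I =>
        2 * ‖CircleDiff.toMap p.1.1 ((p.2 / 2 : ℝ) : UnitAddCircle)‖ :=
      (((continuous_fst.comp hm).comp continuous_fst).eval hc).norm.const_mul 2
    refine h1.congr fun p => ?_
    change 2 * ‖p.1.1.1 ((p.2 / 2 : ℝ) : UnitAddCircle)‖ = 2 * lift p.1 (p.2 / 2)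
    have h2 := two_mul_lift_mem p.1 p.2
    have h3 : |lift p.1 (p.2 / 2)| = lift p.1 (p.2 / 2) := abs_of_nonneg (by linarith [h2.1])
    rw [(isC1Lift p.1).apply_coe, norm_coe_of_abs_le (by rw [h3]; linarith [h2.2]), h3]
  · refine ContinuousMap.continuous_of_continuous_uncurry _ ?_
    have h1 : Continuous fun p : OddCircleDiff × I =>
        CircleDiff.deriv p.1.1 ((p.2 / 2 : ℝ) : UnitAddCircle) :=
      ((continuous_snd.comp hm).comp continuous_fst).eval hc
    refine h1.congr fun p => ?_
    rw [CircleDiff.deriv_coe _ (isC1Lift p.1)]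
    change _ = derivWithin (intervalExt (foldMap p.1)) (Icc 0 1) p.2
    rw [derivWithin_congr (intervalExt_foldMap p.1) (intervalExt_foldMap p.1 p.2.2)]
    exact ((hasDerivAt_two_mul_lift p.1 p.2).hasDerivWithinAt.derivWithin
      (uniqueDiffOn_Icc zero_lt_one _ p.2.2)).symm

end OddCircleDiff

theorem IntervalDiff.differentiableOn (φ : IntervalDiff) :
    DifferentiableOn ℝ (intervalExt fun y => φ.1 y) (Icc 0 1) :=
  ContDiffOn.differentiableOn φ.2.1 one_ne_zero

theorem IntervalDiff.deriv_pos (φ : IntervalDiff) (x : I) : 0 < IntervalDiff.deriv φ x := by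
  have h1 := (IntervalDiff.differentiableOn φ x x.2).hasDerivWithinAt
  have h2 := (IntervalDiff.differentiableOn φ⁻¹ (intervalExt (fun y => φ.1 y) x) (φ.1 _).2).hasDerivWithinAt
  have h3 := h2.comp (x : ℝ) h1 fun t _ => (φ.1 _).2
  have h4 : HasDerivWithinAt (fun t : ℝ => t)
      (derivWithin (intervalExt fun y => φ⁻¹.1 y) (Icc 0 1) (intervalExt (fun y => φ.1 y) x) *
        derivWithin (intervalExt fun y => φ.1 y) (Icc 0 1) x) (Icc 0 1) x := by
    have h5 : EqOn (fun t : ℝ => t)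
        ((intervalExt fun y => φ⁻¹.1 y) ∘ intervalExt fun y => φ.1 y) (Icc 0 1) := fun t ht => by
      change t = (φ.1.symm (projIcc 0 1 _ (φ.1 (projIcc 0 1 _ t) : ℝ)) : ℝ)
      rw [projIcc_val, OrderIso.symm_apply_apply, projIcc_of_mem _ ht]
    exact h3.congr h5 (h5 x.2)
  have h6 := (uniqueDiffOn_Icc (zero_lt_one' ℝ) x x.2).eq_deriv _ h4 (hasDerivWithinAt_id _ _)
  have h7 : 0 ≤ derivWithin (intervalExt fun y => φ.1 y) (Icc 0 1) x :=
    MonotoneOn.derivWithin_nonneg fun s _ t _ hst => φ.1.monotone (monotone_projIcc _ hst)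
  refine lt_of_le_of_ne h7 fun h => ?_
  have h8 : derivWithin (intervalExt fun y => φ.1 y) (Icc 0 1) x = 0 := h.symm
  rw [h8, mul_zero] at h6
  exact zero_ne_one h6

/-! ### Unfolding interval diffeomorphisms to the circle -/

namespace OddCircleDiff

/-- The logarithm of the derivative of an interval diffeomorphism, unfolded to the circle. -/
noncomputable def unfoldWeight (φ : IntervalDiff) (x : UnitAddCircle) : ℝ :=
  Real.log (IntervalDiff.deriv φ (projIcc 0 1 zero_le_one (2 * ‖x‖)))

theorem continuous_unfoldWeight (φ : IntervalDiff) : Continuous (unfoldWeight φ) :=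
  ((IntervalDiff.deriv φ).continuous.comp (continuous_projIcc.comp (by fun_prop))).log
    fun _ => (IntervalDiff.deriv_pos φ _).ne'

theorem isSingularWeight_unfoldWeight (φ : IntervalDiff) :
    IsSingularWeight (unfoldWeight φ) ∅ where
  finite := finite_empty
  measurable := (continuous_unfoldWeight φ).measurable
  continuousOn := (continuous_unfoldWeight φ).continuousOn
  intervalIntegrable := (Real.continuous_exp.comp ((continuous_unfoldWeight φ).comp
    (AddCircle.continuous_mk' 1))).intervalIntegrable _ _

theorem prim_unfoldWeight (φ : IntervalDiff) {t : ℝ} (h0 : 0 ≤ t) (h1 : t ≤ 1 / 2) :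
    IsSingularWeight.prim (unfoldWeight φ) (1 : I) t
      = intervalExt (fun y => φ.1 y) (2 * t) / 2 := by
  have hint := (isSingularWeight_unfoldWeight φ).intervalIntegrable_exp 1 0 t
  have h2 := intervalIntegral.integral_eq_sub_of_hasDerivAt_of_le
    (f := fun t => intervalExt (fun y => φ.1 y) (2 * t) / 2) h0 ?_ (fun x hx => ?_) hint
  · rw [IsSingularWeight.prim, h2]
    have : (φ.1 0 : ℝ) = 0 := congrArg Subtype.val φ.1.map_bot
    simp [intervalExt, this]
  · exact (continuous_subtype_val.comp (φ.1.continuous.comp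
      (continuous_projIcc.comp (by fun_prop)))).continuousOn.div_const 2
  · have hx2 : 2 * x ∈ Ioo (0 : ℝ) 1 := ⟨by linarith [hx.1], by linarith [hx.2]⟩
    have h3 := (IntervalDiff.differentiableOn φ _ (Ioo_subset_Icc_self hx2)).hasDerivWithinAt.hasDerivAt
      (Icc_mem_nhds hx2.1 hx2.2)
    have h4 := (h3.comp x ((hasDerivAt_id x).const_mul 2)).div_const 2
    refine h4.congr_deriv ?_
    have h5 : |x| = x := abs_of_pos hx.1
    have h6 : ‖(x : UnitAddCircle)‖ = x := by
      rw [norm_coe_of_abs_le (by rw [h5]; linarith [hx.2]), h5]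
    rw [unfoldWeight, h6, Icc.coe_one, one_mul, Real.exp_log (IntervalDiff.deriv_pos φ _),
      projIcc_of_mem _ (Ioo_subset_Icc_self hx2)]
    simp only [mul_one, mul_div_cancel_right₀ _ (two_ne_zero' ℝ)]
    rfl

/-- The odd extension of `φ` is the primitive of the even extension of its derivative. That density
is continuous on the circle with no condition at the endpoints. -/
theorem fold_surjective : Function.Surjective fold := by
  intro φ
  have w := isSingularWeight_unfoldWeight φ
  have hodd := w.lift_neg (fun x => by rw [unfoldWeight, unfoldWeight, norm_neg]) 1
  have hhalf : w.lift 1 (1 / 2) = 1 / 2 := by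
    have h1 := w.lift_add_one 1 (-(1 / 2))
    rw [hodd, show -(1 / 2 : ℝ) + 1 = 1 / 2 by norm_num] at h1
    linarith
  -- By symmetry half of the total mass lies on the upper half circle, where it equals `φ 1 / 2`;
  -- the normalisation is therefore trivial.
  have hprim : IsSingularWeight.prim (unfoldWeight φ) (1 : I) 1 = 1 := by
    have h1 := w.lift_apply 1 (1 / 2)
    have h2 : (φ.1 1 : ℝ) = 1 := congrArg Subtype.val φ.1.map_top
    rw [hhalf, prim_unfoldWeight φ (by norm_num) le_rfl] at h1
    simp only [intervalExt, mul_one_div_cancel (two_ne_zero' ℝ), projIcc_right] at h1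
    change 1 / 2 = (φ.1 1 : ℝ) / 2 / _ at h1
    rw [h2, eq_div_iff (w.prim_one_pos 1).ne'] at h1
    linarith
  have hd : ∀ t : ℝ, HasDerivAt (w.lift 1) (Real.exp ((1 : I) * unfoldWeight φ t)) t := fun t => by
    have := w.hasDerivAt_lift 1 (notMem_empty (t : UnitAddCircle))
    rwa [hprim, div_one] at this
  have hcd : ContDiff ℝ 1 (w.lift 1) := by
    rw [contDiff_one_iff_deriv]
    refine ⟨fun t => (hd t).differentiableAt, ?_⟩
    rw [show _root_.deriv (w.lift 1) = _ from funext fun t => (hd t).deriv]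
    exact Real.continuous_exp.comp (continuous_const.mul ((continuous_unfoldWeight φ).comp
      (AddCircle.continuous_mk' 1)))
  have hcd' : ContDiff ℝ 1 (w.lift 1).symm :=
    (w.lift 1).toHomeomorph.contDiff_symm_deriv (fun t => (Real.exp_pos _).ne') hd hcd
  have hL : IsC1Lift (w.lift 1) fun x => w.homeo 1 x :=
    ⟨hcd, (w.lift 1).strictMono, w.lift_add_one 1, fun _ => rfl⟩
  have hL' : IsC1Lift (w.lift 1).symm fun x => (w.homeo 1).symm x :=
    ⟨hcd', (w.lift 1).symm.strictMono, map_symm_add_one (w.lift_add_one 1), fun _ => rfl⟩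
  let f : OddCircleDiff := ⟨⟨w.homeo 1, ⟨_, hL⟩, ⟨_, hL'⟩⟩, by
    change ((w.lift 1 0 : ℝ) : UnitAddCircle) = 0
    rw [w.lift_zero, AddCircle.coe_zero], fun x => by
      obtain ⟨t, rfl⟩ := isOpenQuotientMap_coe.surjective x
      change ((w.lift 1 (-t) : ℝ) : UnitAddCircle) = -((w.lift 1 t : ℝ) : UnitAddCircle)
      rw [hodd, AddCircle.coe_neg]⟩
  refine ⟨f, Subtype.ext (OrderIso.ext (funext fun t => Subtype.ext ?_))⟩
  change 2 * lift f (t / 2) = φ.1 t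
  rw [lift_eq f hL (w.lift_zero 1), w.lift_apply, hprim, div_one, prim_unfoldWeight φ
    (div_nonneg t.2.1 zero_le_two) (div_le_div_of_nonneg_right t.2.2 zero_le_two),
    mul_div_cancel₀ _ two_ne_zero, mul_div_cancel₀ _ two_ne_zero]
  simp [intervalExt]

/-- Odd circle diffeomorphisms are the same as interval diffeomorphisms. -/
noncomputable def foldEquiv : OddCircleDiff ≃* IntervalDiff :=
  MulEquiv.ofBijective fold ⟨fold_injective, fold_surjective⟩

end OddCircleDiff

/-! ### Connectedness of the spaces of actions -/

section Final

variable {Γ : Type*} [Group Γ]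

/-- The interval action carried by an odd circle action fixing `0`. -/
noncomputable def IsOddAction.fold {ρ : ActionSpace Γ CircleDiff} (h : IsOddAction ρ)
    (h0 : ∀ g, (ρ.toFun g).1 0 = 0) : ActionSpace Γ IntervalDiff :=
  OddCircleDiff.fold.comp (MonoidHom.codRestrict (ρ : Γ →* CircleDiff) OddCircleDiff
    fun g => ⟨h0 g, h g⟩)

/-- Every action of a finitely generated nilpotent group on the interval is joined to the trivial
action. -/
theorem joined_one_intervalDiff [Group.FG Γ] [Group.IsNilpotent Γ] (ρ : Γ →* IntervalDiff) :
    Joined (X := ActionSpace Γ IntervalDiff) ρ (1 : Γ →* IntervalDiff) := by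
  let ρ' : ActionSpace Γ CircleDiff :=
    OddCircleDiff.subtype.comp (OddCircleDiff.foldEquiv.symm.toMonoidHom.comp ρ)
  have hodd : IsOddAction ρ' :=
    fun g => (OddCircleDiff.foldEquiv.symm (ρ g)).2.2
  have h0 : ∀ g, (ρ'.toFun g).1 0 = 0 := fun g => (OddCircleDiff.foldEquiv.symm (ρ g)).2.1
  obtain ⟨α, hα, γ, hγ⟩ := exists_joinedIn_rotationAction ρ'
  -- The path stays among odd actions fixing `0`, so it folds back to the interval.
  have hγ' := fun t => hγ t hodd h0
  refine ⟨⟨⟨fun t => (hγ' t).1.fold (hγ' t).2, ?_⟩, ?_, ?_⟩⟩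
  · refine continuous_induced_rng.2 (continuous_pi fun g => ?_)
    refine OddCircleDiff.continuous_fold.comp (Continuous.subtype_mk ?_ _)
    have h1 : Continuous fun (ρ : ActionSpace Γ CircleDiff) (g : Γ) => ρ.toFun g :=
      continuous_induced_dom
    exact (continuous_apply g).comp (h1.comp γ.continuous)
  · refine MonoidHom.ext fun g => ?_
    refine Eq.trans ?_ (OddCircleDiff.foldEquiv.apply_symm_apply (ρ g))
    refine congrArg OddCircleDiff.fold (Subtype.ext ?_)
    change (γ 0).toFun g = _
    rw [γ.source]
    rfl
  · refine MonoidHom.ext fun g => ?_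
    refine Eq.trans ?_ (map_one OddCircleDiff.fold)
    refine congrArg OddCircleDiff.fold (Subtype.ext ?_)
    change (γ 1).toFun g = 1
    rw [γ.target]
    refine CircleDiff.ext' fun x => ?_
    change (α g).toAdd + x = x
    rw [hα, rot_eq_zero_of_fixed _ (h0 g), zero_add]

end Final

theorem mainTheorem1 :
    (∀ (Γ : Type*) [Group Γ] [Group.FG Γ] [Group.IsNilpotent Γ],
      PathConnectedSpace (ActionSpace Γ IntervalDiff)) ∧
    (∀ d : ℕ, PathConnectedSpace (ActionSpace (Multiplicative (Fin d → ℤ)) CircleDiff)) ∧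
    (∀ (Γ : Type*) [Group Γ] [Group.FG Γ] [Group.IsNilpotent Γ] (ρ : ActionSpace Γ CircleDiff),
      ∃ ρ₀ : ActionSpace Γ CircleDiff, FactorsThroughFiniteRotations ρ₀ ∧ Joined ρ ρ₀) := by
  refine ⟨fun Γ _ _ _ => ?_, fun d => ?_, fun Γ _ _ _ ρ => ?_⟩
  · exact ⟨⟨(1 : Γ →* IntervalDiff)⟩, fun ρ ρ' =>
      (joined_one_intervalDiff ρ).trans (joined_one_intervalDiff ρ').symm⟩
  · have key : ∀ ρ : ActionSpace (Multiplicative (Fin d → ℤ)) CircleDiff,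
        Joined ρ (rotationAction 1) := fun ρ => by
      obtain ⟨α, -, hα⟩ := exists_joinedIn_rotationAction ρ
      exact hα.joined.trans (joined_rotationAction_one d α)
    exact ⟨⟨rotationAction 1⟩, fun ρ ρ' => (key ρ).trans (key ρ').symm⟩
  · obtain ⟨α, -, hα⟩ := exists_joinedIn_rotationAction ρ
    obtain ⟨τ, hτ, hατ⟩ := exists_joined_rotationAction_finite α
    exact ⟨_, factorsThroughFiniteRotations_rotationAction τ hτ, hα.joined.trans hατ⟩
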